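/- **Setting.** Let $\Sigma$ be a finite alphabet, $\mathcal C=\{c_0,c_1,c_2,\dots\}$ an unbounded alphabet of objects, $\Omega=\Sigma\cup\mathcal C\cup\{\$\}$. Inputs are strings $x=\$w_2\cdots w_m$ with $w_i\in\Sigma\cup\mathcal C$; $|x|=m$. Let $\mathcal F(\Omega)$ be the set of all maps $f$ assigning to each input $x$ an array $f(x)\in\mathbb R^{|x|\times\Omega}$. Fix $\varepsilon>0$. *Transformers.* A transformer $T$ on a real inner product space $E$ consists of a context width $N(T)\in\mathbb N\cup\{\infty\}$, numbers $L,H,d_{\rm ff}$ (depth, heads, MLP width), a rounding precision $q$, positional encodings $p_t\in E$ ($0\le t<N(T)$), token embeddings $E_\omega\in E$ and unembedding vectors $U_\omega\in E$ (for $\omega\in\Sigma\cup\{\$\}$ and $\omega=c_k$, $0\le k<N(T)$; write $c_k$ also for $E_{c_k}$), bounded linear maps $K_{l,h},Q_{l,h},V_{l,h}:E\to E$, $A_l:E\to\mathbb R^{d_{\rm ff}}$, $B_l:\mathbb R^{d_{\rm ff}}\to E$, biases $b_l\in\mathbb R^{d_{\rm ff}}$, and for each MLP coordinate one of the activations ReLU,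 Heaviside, $z\mapsto 1/(z+\varepsilon)$. For an input $x$ with position offset $o_p$ and object offset $o_c$, the initial activation at position $i$ (counted from $0$) is $p_{i+o_p}$ plus the embedding of the $i$-th token, where $c_k$ is replaced by $c_{k+o_c}$. A layer sends $y$ to $Y_i+B_l\psi_l(A_lY_i+b_l)$, where $$Y_i=y_i+\sum_h\frac{\sum_{j\le i}w_{ij}V_{l,h}y_j}{\sum_{j\le i}w_{ij}},\qquad w_{ij}=\big[\exp(\log|x|\cdot[\,y_j^TK_{l,h}^TQ_{l,h}y_i\,])\big],$$ $[\cdot]$ is rounding to $q$ fractional bits (a head all of whose weights round to $0$ contributes $0$), and $\psi_l$ applies the chosen activations. The output $T(x,o_p,o_c)_{i,\omega}$ is $U_\omega^T$ times the final activation at $i$. $T$ *matches $f$ on $x$* if $T(x,o_p,o_c)_{i,c_{k+o_c}}=f(x)_{i,c_k}$ and $T(x,o_p,o_c)_{i,\omega}=f(x)_{i,\omega}$ ($\omega\in\Sigma\cup\{\$\}$) for all offsets with $|x|+o_p\le N(T)$ and $k+o_c<N(T)$ for all objects $c_k$ of $x$, all $i$, and all output tokens in the vocabulary of $T$. *Product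 functions.* Let $\mathcal P$ be the set of choices $\mathcal S$ of at most one head in every layer, $\Pi_{\mathcal S}$ the product of the chosen $V_{l,h}$ (lowest layer rightmost). For $v,w$ among the $p_t$, the $E_\omega$ and the columns of the $B_l$, the product functions are $\alpha^{\rm attn}_{l,h,\mathcal S_1,\mathcal S_2,v,w}=(\Pi_{\mathcal S_1}v)^TK_{l,h}^TQ_{l,h}\Pi_{\mathcal S_2}w$, $U_\omega^T\Pi_{\mathcal S}w$ (written $\alpha^{\rm unembed}_{\mathcal S,U_\omega,w}$ if $w$ is some $p_t$ or $E_\omega$), and $(A_l)_{s,\cdot}\Pi_{\mathcal S}w$. $T$ is *translation-invariant* if products of two positions, or of two objects (including $U_{c_k}$ with $c_m$), are unchanged when both indices are shifted by the same amount, while products of a position with an object, or of a single position or object with other vectors, do not depend on the position or object. $T$ is *local* if for some $\Delta$ products of two positions, or of two objects, with indices more than $\Delta$ apart vanish. *Symbolic Limit Transformers.* These are the transformers on a real Hilbert space with $N(T)=\infty$, with $\sup_t\|p_t\|<\infty$, $\sup_k\|c_k\|<\infty$, with $U:E\to\ell^2(\Omega)$ bounded, with all product functions and all bias entries integer multiples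 of $2^{-p}$ for some fixed $p$, that are translation-invariant and local. Such a $T$ *expresses* $f$ if $T(x,0,0)=f(x)$ for all inputs $x$. *Hypothesis class and regularizer.* $\Theta_n$ is the set of translation-invariant transformers on $\mathbb R^d$, $d$ arbitrary, with $N(T)=n$ and all parameter entries integer multiples of $2^{-p}$ for some $p$. Let $p(T)$ be the least such $p$ and $\Omega_n=\Sigma\cup\{\$\}\cup\{c_0,\dots,c_{n-1}\}$. With spectral norms unless marked $F$ (Frobenius), and with empty maxima $0$, $$\mathcal R(T)=L+H+p(T)+q+\max_{l,h}\|K_{l,h}^TQ_{l,h}\|+\max_{l,h}\|V_{l,h}\|+\max_l\|A_l\|_F+\max_l\|B_l\|_F+\|U\|+\max_t\|p_t\|+\max_{\omega\in\Omega_n}\|E_\omega\|+\max_l\|b_l\|+\zeta(T),$$ $$\zeta(T)=\sum_{l,h}\sum_{\mathcal S_1,\mathcal S_2\in\mathcal P}\Big(\sum_{j=0}^{n-1}|\alpha^{\rm attn}_{p_0,p_j}|^2+\sum_{j=1}^{n-1}|\alpha^{\rm attn}_{p_j,p_0}|^2+\sum_{\omega\in\Omega_n}|\alpha^{\rm attn}_{c_0,E_\omega}|^2+\sum_{k=1}^{n-1}|\alpha^{\rm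 attn}_{c_k,c_0}|^2\Big)+\sum_{\mathcal S\in\mathcal P}\Big(\sum_{\omega\in\Omega_n}|\alpha^{\rm unembed}_{U_{c_0},E_\omega}|^2+\sum_{k=1}^{n-1}|\alpha^{\rm unembed}_{U_{c_k},c_0}|^2\Big),$$ where the indices $l,h,\mathcal S_1,\mathcal S_2$, resp. $\mathcal S$, of $\alpha$ are suppressed. *Inference Procedure.* Let $U_n$ be the set of $T\in\Theta_n$ matching $f$ on all inputs $x$ with $|x|\le n/2$ whose objects have indices in $\{0,\dots,n-1\}$ differing pairwise by at most $n/2$. A *run* on $f$ is a sequence $T_1,T_2,\dots$ with $T_n\in U_n$ and $\mathcal R(T_n)\le\frac1n+\inf_{T\in U_n}\mathcal R(T)$ for all $n\ge1$. A run *length-generalizes* if $\sup_n\mathcal R(T_n)<\infty$ and there is $N_0$ such that for all $m>N_0$, $T_m$ matches $f$ on all inputs of length at most $m$ with objects among $c_0,\dots,c_{m-1}$. **Theorem.** Let $f\in\mathcal F(\Omega)$. The following are equivalent: 1. $f$ is expressible by a Symbolic Limit Transformer; 2. the Inference Procedure has a run on $f$, and every run on $f$ length-generalizes; 3. some run of the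 Inference Procedure on $f$ length-generalizes. -/

import Mathlib

namespace LengthGen

/-! ## Tokens and inputs -/

/-- The vocabulary `Ω = Σ ∪ C ∪ {$}`: the start symbol `$`, the symbols of the finite alphabet
`Sg = Σ`, and the objects `c₀, c₁, c₂, …` of the unbounded alphabet `C ≅ ℕ`.
Positions and objects are numbered from `0` throughout. -/
inductive Token (Sg : Type*) where
  | start : Token Sg
  | sym (σ : Sg) : Token Sg
  | obj (k : ℕ) : Token Sg

/-- Renumber the objects by the offset `o`. -/
def Token.shift {Sg : Type*} (o : ℕ) : Token Sg → Token Sg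
  | .start => .start
  | .sym σ => .sym σ
  | .obj k => .obj (k + o)

/-- The tokens known to a transformer with context width `N`: all of `Σ ∪ {$}`, and the first `N`
objects. -/
def Token.InVocab {Sg : Type*} (N : ℕ∞) : Token Sg → Prop
  | .start => True
  | .sym _ => True
  | .obj k => (k : ℕ∞) < N

/-- An input is a string `$ w₁ … wₘ` with `wᵢ ∈ Σ ∪ C`; it is given by `w₁ … wₘ`. -/
abbrev Input (Sg : Type*) : Type _ := List (Sg ⊕ ℕ)

/-- The length of the input string, the start symbol included. -/
abbrev Input.len {Sg : Type*} (x : Input Sg) : ℕ := List.length x + 1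

/-- The token at position `i` of the input string. -/
def Input.token {Sg : Type*} (x : Input Sg) (i : Fin x.len) : Token Sg :=
  Fin.cases .start (fun j => Sum.elim Token.sym Token.obj (List.get x j)) i

/-- The object `c_k` occurs in the input. -/
def Input.HasObj {Sg : Type*} (x : Input Sg) (k : ℕ) : Prop := Sum.inr k ∈ (x : List (Sg ⊕ ℕ))

/-- `F(Ω)`: all maps sending an input `x` to an `|x| × |Ω|` array of logits. -/
abbrev LogitMap (Sg : Type*) : Type _ := (x : Input Sg) → Fin x.len → Token Sg → ℝ

/-! ## Transformers -/

/-- The activation functions allowed in the coordinates of an MLP. -/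
inductive Activation where
  | relu : Activation
  | heaviside : Activation
  | reciprocal : Activation

/-- ReLU, Heaviside, and `z ↦ 1 / (z + ε)` for a fixed small constant `ε`. -/
noncomputable def Activation.apply (ε : ℝ) : Activation → ℝ → ℝ
  | .relu, z => max z 0
  | .heaviside, z => if 0 ≤ z then 1 else 0
  | .reciprocal, z => 1 / (z + ε)

/-- Rounding to `p` fractional bits. -/
noncomputable def roundTo (p : ℕ) (z : ℝ) : ℝ := (round (z * 2 ^ p) : ℝ) / 2 ^ p

/-- `z` is representable with `p` fractional bits. -/
def Dyadic (p : ℕ) (z : ℝ) : Prop := ∃ m : ℤ, z = (m : ℝ) / 2 ^ p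

/-- The parameters of a causal transformer whose residual stream lives in the inner product space
`E` (`E = ℝ^d` for an ordinary transformer of width `d`).

Only the positional encodings `pos t` with `t < N` and the (un)embeddings of the tokens
`ω` with `ω.InVocab N` are parameters; the other values of these functions are never used. -/
structure Transformer (Sg : Type*) (E : Type*) [NormedAddCommGroup E] [InnerProductSpace ℝ E] where
  /-- context width -/
  N : ℕ∞
  /-- depth -/
  L : ℕ
  /-- number of heads in each layer -/
  H : ℕ
  /-- number of hidden units of the MLPs -/
  dff : ℕ
  /-- fractional bits kept of the attention logits and of the outputs of `exp` -/
  attPrec : ℕ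
  /-- positional encodings `p_t` -/
  pos : ℕ → E
  /-- token embeddings: `E_σ` for the tokens of `Σ ∪ {$}` and `c_k` for the objects -/
  emb : Token Sg → E
  K : Fin L → Fin H → E →L[ℝ] E
  Q : Fin L → Fin H → E →L[ℝ] E
  V : Fin L → Fin H → E →L[ℝ] E
  A : Fin L → E →L[ℝ] EuclideanSpace ℝ (Fin dff)
  B : Fin L → EuclideanSpace ℝ (Fin dff) →L[ℝ] E
  b : Fin L → EuclideanSpace ℝ (Fin dff)
  act : Fin L → Fin dff → Activation
  /-- rows `U_ω` of the unembedding matrix -/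
  U : Token Sg → E

namespace Transformer

variable {Sg : Type*} {E : Type*} [NormedAddCommGroup E] [InnerProductSpace ℝ E]

/-- Attention weight (before normalization) of key position `j` at query position `i`, for the
activations `y` of a string of length `m`: the logit `y_jᵀ Kᵀ Q y_i` is rounded, multiplied by
`log m` and exponentiated, and the result is rounded. -/
noncomputable def attWeight (T : Transformer Sg E) {m : ℕ} (l : Fin T.L) (h : Fin T.H)
    (y : Fin m → E) (i j : Fin m) : ℝ :=
  roundTo T.attPrec
    (Real.exp (Real.log m * roundTo T.attPrec (inner ℝ (T.K l h (y j)) (T.Q l h (y i)))))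

/-- The causal attention block with its residual connection. A head all of whose weights are
rounded to `0` contributes `0`. -/
noncomputable def attBlock (T : Transformer Sg E) {m : ℕ} (l : Fin T.L) (y : Fin m → E)
    (i : Fin m) : E :=
  y i + ∑ h : Fin T.H,
    (∑ j ∈ Finset.univ.filter (· ≤ i), T.attWeight l h y i j)⁻¹ •
      ∑ j ∈ Finset.univ.filter (· ≤ i), T.attWeight l h y i j • T.V l h (y j)

/-- The MLP with its residual connection. -/
noncomputable def mlp (ε : ℝ) (T : Transformer Sg E) (l : Fin T.L) (z : E) : E :=
  z + T.B l (WithLp.toLp 2 fun s => (T.act l s).apply ε (T.A l z s + T.b l s))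

/-- One layer. -/
noncomputable def layer (ε : ℝ) (T : Transformer Sg E) {m : ℕ} (l : Fin T.L) (y : Fin m → E) :
    Fin m → E :=
  fun i => T.mlp ε l (T.attBlock l y i)

/-- The initial activations of the input `x` under the position offset `op` and the object offset
`oc`. -/
def initial (T : Transformer Sg E) (x : Input Sg) (op oc : ℕ) : Fin x.len → E :=
  fun i => T.emb ((x.token i).shift oc) + T.pos (i + op)

/-- The activations after the last layer; the layers are applied in increasing order. -/
noncomputable def final (ε : ℝ) (T : Transformer Sg E) (x : Input Sg) (op oc : ℕ) :
    Fin x.len → E :=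
  (List.finRange T.L).foldl (fun y l => T.layer ε l y) (T.initial x op oc)

/-- The output logits `T(x, op, oc)`. -/
noncomputable def eval (ε : ℝ) (T : Transformer Sg E) (x : Input Sg) (op oc : ℕ) :
    Fin x.len → Token Sg → ℝ :=
  fun i ω => inner ℝ (T.U ω) (T.final ε x op oc i)

/-! ## Product functions -/

/-- `𝒫`: the sets `{V_{l₁,h₁}, …, V_{l_k,h_k}}` with `l₁ < … < l_k`, given by the choice of at most
one head in every layer. -/
abbrev Path (T : Transformer Sg E) : Type := Fin T.L → Option (Fin T.H)

/-- The product of the value matrices in `S`, the lowest layer at the right. -/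
noncomputable def pathProd (T : Transformer Sg E) (S : T.Path) : E →L[ℝ] E :=
  (List.finRange T.L).foldl
    (fun M l => match S l with
      | none => M
      | some h => (T.V l h).comp M)
    (ContinuousLinearMap.id ℝ E)

/-- Labels of the vectors in `𝒱𝒪`: positional encodings, token embeddings, and the columns
`(B_l)_{·,s}`. -/
inductive Source (T : Transformer Sg E) where
  | pos (t : ℕ) : Source T
  | tok (ω : Token Sg) : Source T
  | hid (l : Fin T.L) (s : Fin T.dff) : Source T

/-- The vector with a given label. -/
noncomputable def vec (T : Transformer Sg E) : T.Source → E
  | .pos t => T.pos t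
  | .tok ω => T.emb ω
  | .hid l s => T.B l (EuclideanSpace.single s 1)

/-- Shift positions by `dp` and objects by `dc`. -/
def Source.shift {T : Transformer Sg E} (dp dc : ℕ) : T.Source → T.Source
  | .pos t => .pos (t + dp)
  | .tok ω => .tok (ω.shift dc)
  | .hid l s => .hid l s

/-- The label names an actual parameter of `T`. -/
def Source.InRange {T : Transformer Sg E} : T.Source → Prop
  | .pos t => (t : ℕ∞) < T.N
  | .tok ω => ω.InVocab T.N
  | .hid _ _ => True

/-- `α^attn_{l,h,S₁,S₂,v,w} = vᵀ (∏ S₁)ᵀ K_{l,h}ᵀ Q_{l,h} (∏ S₂) w`. -/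
noncomputable def attnProd (T : Transformer Sg E) (l : Fin T.L) (h : Fin T.H) (S₁ S₂ : T.Path)
    (v w : T.Source) : ℝ :=
  inner ℝ (T.K l h (T.pathProd S₁ (T.vec v))) (T.Q l h (T.pathProd S₂ (T.vec w)))

/-- `U_ωᵀ (∏ S) w`: this is `α^unembed_{S,ω,w}` if `w` is a position or a token, and
`β^unembed_{S,ω,w}` if `w` is a column of some `B_l`. -/
noncomputable def unembedProd (T : Transformer Sg E) (S : T.Path) (ω : Token Sg)
    (w : T.Source) : ℝ :=
  inner ℝ (T.U ω) (T.pathProd S (T.vec w))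

/-- `β^mlp_{S,(A_l)_{s,·},w} = (A_l)_{s,·} (∏ S) w`. -/
noncomputable def mlpProd (T : Transformer Sg E) (S : T.Path) (l : Fin T.L) (s : Fin T.dff)
    (w : T.Source) : ℝ :=
  T.A l (T.pathProd S (T.vec w)) s

/-- Translation invariance: every product function is unchanged when positions and objects are
shifted, independently of each other, inside the context window. As the two shifts are
independent, this says that a position-position or an object-object product depends only on the
difference of the two indices (and on their order), and that a product of a position with an
object, or of a single position or object with a vector of a fixed kind, is constant. -/
structure TranslationInvariant (T : Transformer Sg E) : Prop where
  attn : ∀ (l : Fin T.L) (h : Fin T.H) (S₁ S₂ : T.Path) (v w : T.Source) (dp dc : ℕ),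
    (v.shift dp dc).InRange → (w.shift dp dc).InRange →
      T.attnProd l h S₁ S₂ (v.shift dp dc) (w.shift dp dc) = T.attnProd l h S₁ S₂ v w
  unembed : ∀ (S : T.Path) (ω : Token Sg) (w : T.Source) (dp dc : ℕ),
    (ω.shift dc).InVocab T.N → (w.shift dp dc).InRange →
      T.unembedProd S (ω.shift dc) (w.shift dp dc) = T.unembedProd S ω w
  mlp : ∀ (S : T.Path) (l : Fin T.L) (s : Fin T.dff) (w : T.Source) (dp dc : ℕ),
    (w.shift dp dc).InRange → T.mlpProd S l s (w.shift dp dc) = T.mlpProd S l s w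

/-- Locality with bandwidth `Δ`: interactions of two positions, or of two objects, vanish when their
distance exceeds `Δ`. -/
structure Local (T : Transformer Sg E) (Δ : ℕ) : Prop where
  attn_pos : ∀ (l : Fin T.L) (h : Fin T.H) (S₁ S₂ : T.Path) (k m : ℕ),
    (k : ℕ∞) < T.N → (m : ℕ∞) < T.N → (Δ : ℤ) < |(k : ℤ) - m| →
      T.attnProd l h S₁ S₂ (.pos k) (.pos m) = 0
  attn_obj : ∀ (l : Fin T.L) (h : Fin T.H) (S₁ S₂ : T.Path) (k m : ℕ),
    (k : ℕ∞) < T.N → (m : ℕ∞) < T.N → (Δ : ℤ) < |(k : ℤ) - m| →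
      T.attnProd l h S₁ S₂ (.tok (.obj k)) (.tok (.obj m)) = 0
  unembed_obj : ∀ (S : T.Path) (k m : ℕ),
    (k : ℕ∞) < T.N → (m : ℕ∞) < T.N → (Δ : ℤ) < |(k : ℤ) - m| →
      T.unembedProd S (.obj k) (.tok (.obj m)) = 0

/-! ## Symbolic limit transformers -/

/-- The first `n` objects together with `Σ ∪ {$}`: the vocabulary at context width `n`. -/
abbrev Vocab (Sg : Type*) (n : ℕ) : Type _ := Option Sg ⊕ Fin n

/-- The token named by an element of the vocabulary at context width `n`. -/
def tokenOf {Sg : Type*} {n : ℕ} : Vocab Sg n → Token Sg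
  | .inl none => .start
  | .inl (some σ) => .sym σ
  | .inr k => .obj k

/-- `C` bounds the spectral norm of the `|Ω| × d` unembedding matrix at context width `n`. -/
def UnembedBound [Fintype Sg] (T : Transformer Sg E) (n : ℕ) (C : ℝ) : Prop :=
  0 ≤ C ∧ ∀ v : E, √(∑ ω : Vocab Sg n, inner ℝ (T.U (tokenOf ω)) v ^ 2) ≤ C * ‖v‖

/-- Symbolic limit transformers: infinite context width, bounded embeddings, bounded operators
(`K`, `Q`, `V`, `A`, `B` are bounded by their type; `U` is bounded as an operator from `E` to
`ℓ²(Ω)`), MLPs through a finite-dimensional space (also by type), product functions and biases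
in fixed finite precision, translation invariance and locality. -/
structure IsSymbolicLimit [Fintype Sg] (T : Transformer Sg E) : Prop where
  N_eq : T.N = ⊤
  bounded_emb : ∃ C : ℝ, (∀ t, ‖T.pos t‖ ≤ C) ∧ ∀ k, ‖T.emb (.obj k)‖ ≤ C
  bounded_unembed : ∃ C : ℝ, ∀ n, T.UnembedBound n C
  precision : ∃ p : ℕ,
    (∀ l h S₁ S₂ v w, Dyadic p (T.attnProd l h S₁ S₂ v w)) ∧
    (∀ S ω w, Dyadic p (T.unembedProd S ω w)) ∧
    (∀ S l s w, Dyadic p (T.mlpProd S l s w)) ∧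
    ∀ l s, Dyadic p (T.b l s)
  translationInvariant : T.TranslationInvariant
  isLocal : ∃ Δ : ℕ, T.Local Δ

/-! ## Matching a target function -/

/-- `T` computes `f` on the input `x` (whose objects are known to `T`), at every position offset and
every object offset that keep the input inside the context window. Under the object offset `oc`
the object `c_k` is represented by `c_{k+oc}`, in the input and among the output logits. -/
def MatchesOn (ε : ℝ) (T : Transformer Sg E) (f : LogitMap Sg) (x : Input Sg) : Prop :=
  ∀ op oc : ℕ, ((x.len + op : ℕ) : ℕ∞) ≤ T.N → (∀ k, x.HasObj k → ((k + oc : ℕ) : ℕ∞) < T.N) →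
    ∀ (i : Fin x.len) (ω : Token Sg), (ω.shift oc).InVocab T.N →
      T.eval ε x op oc i (ω.shift oc) = f x i ω

end Transformer

open Transformer

/-- `f` is expressible by a symbolic limit transformer (over some real Hilbert space), evaluated at
zero offsets. -/
def ExpressibleBySymbolicLimit {Sg : Type*} [Fintype Sg] (ε : ℝ) (f : LogitMap Sg) : Prop :=
  ∃ (E : Type) (_ : NormedAddCommGroup E) (_ : InnerProductSpace ℝ E) (_ : CompleteSpace E)
    (T : Transformer Sg E), T.IsSymbolicLimit ∧ ∀ (x : Input Sg) (i : Fin x.len) (ω : Token Sg),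
      T.eval ε x 0 0 i ω = f x i ω

/-! ## Hypothesis classes and the regularizer -/

/-- Transformers of finite width `d`. -/
structure FiniteTransformer (Sg : Type*) where
  d : ℕ
  T : Transformer Sg (EuclideanSpace ℝ (Fin d))

namespace FiniteTransformer

variable {Sg : Type*}

/-- All entries of all parameters have `p` fractional bits. -/
structure HasPrecision (F : FiniteTransformer Sg) (p : ℕ) : Prop where
  pos : ∀ t : ℕ, (t : ℕ∞) < F.T.N → ∀ i, Dyadic p (F.T.pos t i)
  emb : ∀ ω : Token Sg, ω.InVocab F.T.N → ∀ i, Dyadic p (F.T.emb ω i)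
  U : ∀ ω : Token Sg, ω.InVocab F.T.N → ∀ i, Dyadic p (F.T.U ω i)
  K : ∀ l h i j, Dyadic p (F.T.K l h (EuclideanSpace.single j 1) i)
  Q : ∀ l h i j, Dyadic p (F.T.Q l h (EuclideanSpace.single j 1) i)
  V : ∀ l h i j, Dyadic p (F.T.V l h (EuclideanSpace.single j 1) i)
  A : ∀ l s j, Dyadic p (F.T.A l (EuclideanSpace.single j 1) s)
  B : ∀ l i s, Dyadic p (F.T.B l (EuclideanSpace.single s 1) i)
  b : ∀ l s, Dyadic p (F.T.b l s)

/-- The hypothesis class `Θ_n`. -/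
def Theta (Sg : Type*) (n : ℕ) : Set (FiniteTransformer Sg) :=
  {F | F.T.N = n ∧ (∃ p, F.HasPrecision p) ∧ F.T.TranslationInvariant}

/-- The precision of the parameters. -/
noncomputable def precision (F : FiniteTransformer Sg) : ℕ := sInf {p | F.HasPrecision p}

/-- The Frobenius norm. -/
noncomputable def frobenius {a b : ℕ}
    (M : EuclideanSpace ℝ (Fin a) →L[ℝ] EuclideanSpace ℝ (Fin b)) : ℝ :=
  √(∑ i, ∑ j, M (EuclideanSpace.single j 1) i ^ 2)

/-- The spectral norm of the unembedding matrix at context width `n`. -/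
noncomputable def unembedNorm [Fintype Sg] (F : FiniteTransformer Sg) (n : ℕ) : ℝ :=
  sInf {C : ℝ | F.T.UnembedBound n C}

/-- The penalty `ζ` on interactions between far-away positions and between far-away objects at
context width `n`. Position `0` is paired with every position and object `0` with every token, and
each pair of distinct positions or distinct objects is taken in both orders, since a product
`α_{x_k,x_m}` depends on the signed difference `m - k`. -/
noncomputable def zeta [Fintype Sg] (F : FiniteTransformer Sg) (n : ℕ) : ℝ :=
  (∑ l : Fin F.T.L, ∑ h : Fin F.T.H, ∑ S₁ : F.T.Path, ∑ S₂ : F.T.Path,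
    ((∑ j ∈ Finset.range n, F.T.attnProd l h S₁ S₂ (.pos 0) (.pos j) ^ 2) +
      (∑ ω : Vocab Sg n, F.T.attnProd l h S₁ S₂ (.tok (.obj 0)) (.tok (tokenOf ω)) ^ 2) +
      (∑ j ∈ Finset.Ico 1 n, F.T.attnProd l h S₁ S₂ (.pos j) (.pos 0) ^ 2) +
      ∑ k ∈ Finset.Ico 1 n, F.T.attnProd l h S₁ S₂ (.tok (.obj k)) (.tok (.obj 0)) ^ 2)) +
  ∑ S : F.T.Path,
    ((∑ ω : Vocab Sg n, F.T.unembedProd S (.obj 0) (.tok (tokenOf ω)) ^ 2) +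
      ∑ k ∈ Finset.Ico 1 n, F.T.unembedProd S (.obj k) (.tok (.obj 0)) ^ 2)

/-- The regularizer `R` on `Θ_n`. -/
noncomputable def regularizer [Fintype Sg] (n : ℕ) (F : FiniteTransformer Sg) : ℝ :=
  (F.T.L + F.T.H) + (F.precision + F.T.attPrec) +
  ((⨆ l, ⨆ h, ‖(ContinuousLinearMap.adjoint (F.T.K l h)).comp (F.T.Q l h)‖) +
    (⨆ l, ⨆ h, ‖F.T.V l h‖) + (⨆ l, frobenius (F.T.A l)) + (⨆ l, frobenius (F.T.B l)) +
    F.unembedNorm n) +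
  ((⨆ t : Fin n, ‖F.T.pos t‖) + (⨆ ω : Vocab Sg n, ‖F.T.emb (tokenOf ω)‖) + ⨆ l, ‖F.T.b l‖) +
  F.zeta n

end FiniteTransformer

/-! ## The inference procedure -/

open FiniteTransformer

/-- The training inputs at context width `n`: length at most `n / 2`, and objects among the first
`n`, any two of which differ by at most `n / 2`. -/
def IsTraining {Sg : Type*} (n : ℕ) (x : Input Sg) : Prop :=
  2 * x.len ≤ n ∧ (∀ k, x.HasObj k → k < n) ∧
    ∀ k m, x.HasObj k → x.HasObj m → 2 * ((k : ℤ) - m) ≤ n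

/-- The inputs at context width `n`: length at most `n`, and objects among the first `n`. -/
def IsTest {Sg : Type*} (n : ℕ) (x : Input Sg) : Prop :=
  x.len ≤ n ∧ ∀ k, x.HasObj k → k < n

/-- `U_n`: the transformers in `Θ_n` that match `f` on all training inputs. -/
def fitting {Sg : Type*} (ε : ℝ) (f : LogitMap Sg) (n : ℕ) : Set (FiniteTransformer Sg) :=
  {F | F ∈ Theta Sg n ∧ ∀ x : Input Sg, IsTraining n x → F.T.MatchesOn ε f x}

/-- `F 1, F 2, …` is a possible output of the inference procedure (`F 0` plays no role). -/
def IsRun {Sg : Type*} [Fintype Sg] (ε : ℝ) (f : LogitMap Sg) (F : ℕ → FiniteTransformer Sg) :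
    Prop :=
  ∀ n : ℕ, 1 ≤ n → F n ∈ fitting ε f n ∧
    regularizer n (F n) ≤ 1 / n + sInf (regularizer n '' fitting ε f n)

/-- The regularizer is bounded along the sequence, and `F m` matches `f` on all inputs of length at
most `m` for all large `m`. -/
def LengthGeneralizes {Sg : Type*} [Fintype Sg] (ε : ℝ) (f : LogitMap Sg)
    (F : ℕ → FiniteTransformer Sg) : Prop :=
  (∃ C : ℝ, ∀ n : ℕ, 1 ≤ n → regularizer n (F n) ≤ C) ∧
    ∃ N₀ : ℕ, ∀ m : ℕ, N₀ < m → ∀ x : Input Sg, IsTest m x → (F m).T.MatchesOn ε f x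

end LengthGen

namespace LengthGen

open Transformer

/-! ## Folds over `List.finRange` -/

theorem foldl_finRange_rel {α β : Type*} {L : ℕ} (f : α → Fin L → α) (g : β → Fin L → β)
    (R : ℕ → α → β → Prop) (a : α) (b : β) (h0 : R 0 a b)
    (hs : ∀ (l : Fin L) a b, R l a b → R (l + 1) (f a l) (g b l)) :
    R L ((List.finRange L).foldl f a) ((List.finRange L).foldl g b) := by
  induction L with
  | zero => simpa using h0
  | succ L ih =>
    rw [List.finRange_succ_last, List.foldl_append, List.foldl_append, List.foldl_map,
      List.foldl_map]
    refine hs (Fin.last L) _ _ ?_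
    exact ih (fun a l => f a l.castSucc) (fun b l => g b l.castSucc)
      (fun l a b h => hs l.castSucc a b h)

theorem foldl_finRange_induction {α : Type*} {L : ℕ} (f : α → Fin L → α) (R : ℕ → α → Prop)
    (a : α) (h0 : R 0 a) (hs : ∀ (l : Fin L) a, R l a → R (l + 1) (f a l)) :
    R L ((List.finRange L).foldl f a) :=
  foldl_finRange_rel f f (fun i a _ => R i a) a a h0 (fun l a _ h => hs l a h)

/-! ## Labels independent of a transformer -/

/-- Labels of positional encodings, token embeddings and columns of the `B_l`, for depth `L` and
MLP width `D`. -/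
inductive Src (Sg : Type*) (L D : ℕ) where
  | pos (t : ℕ) : Src Sg L D
  | tok (ω : Token Sg) : Src Sg L D
  | hid (l : Fin L) (s : Fin D) : Src Sg L D

namespace Src

variable {Sg : Type*} {L D : ℕ}

/-- Shift positions by `dp` and objects by `dc`. -/
def shift (dp dc : ℕ) : Src Sg L D → Src Sg L D
  | .pos t => .pos (t + dp)
  | .tok ω => .tok (ω.shift dc)
  | .hid l s => .hid l s

/-- The label makes sense at context width `N`. -/
def InRange (N : ℕ∞) : Src Sg L D → Prop
  | .pos t => (t : ℕ∞) < N
  | .tok ω => ω.InVocab N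
  | .hid _ _ => True

/-- The label is not an object. -/
def NotObj : Src Sg L D → Prop
  | .tok (.obj _) => False
  | _ => True

/-- Two positions, or two objects, at distance more than `Δ`. -/
def Far (Δ : ℕ) : Src Sg L D → Src Sg L D → Prop
  | .pos k, .pos m => (Δ : ℤ) < |(k : ℤ) - m|
  | .tok (.obj k), .tok (.obj m) => (Δ : ℤ) < |(k : ℤ) - m|
  | _, _ => False

theorem InRange.mono {N N' : ℕ∞} (h : N ≤ N') {v : Src Sg L D} (hv : v.InRange N) :
    v.InRange N' := by
  rcases v with t | (_ | σ | k) | ⟨l, s⟩ <;>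
    simp only [InRange, Token.InVocab] at hv ⊢ <;> exact lt_of_lt_of_le hv h

theorem inRange_top (v : Src Sg L D) : v.InRange ⊤ := by
  rcases v with t | (_ | σ | k) | ⟨l, s⟩ <;> simp [InRange, Token.InVocab]

theorem InRange.of_shift {N : ℕ∞} {v : Src Sg L D} {dp dc : ℕ} (h : (v.shift dp dc).InRange N) :
    v.InRange N := by
  rcases v with t | (_ | σ | k) | ⟨l, s⟩ <;>
    simp only [InRange, Token.InVocab, shift, Token.shift] at h ⊢ <;>
    exact lt_of_le_of_lt (by exact_mod_cast Nat.le_add_right _ _) h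

@[simp] theorem shift_zero (v : Src Sg L D) : v.shift 0 0 = v := by
  rcases v with t | (_ | σ | k) | ⟨l, s⟩ <;> rfl

end Src

/-- The choices of at most one head in every layer. -/
abbrev Route (L H : ℕ) : Type := Fin L → Option (Fin H)

/-- The places where product functions are formed. -/
inductive Slot (L H D : ℕ) where
  | attn (l : Fin L) (h : Fin H) (S₁ S₂ : Route L H) : Slot L H D
  | unembed (S : Route L H) : Slot L H D
  | mlp (S : Route L H) (l : Fin L) (s : Fin D) : Slot L H D

/-- The left labels that a slot admits; for MLP slots, which need no left label, it is the start
token by convention. -/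
def Slot.Admits {Sg : Type*} {L H D : ℕ} : Slot L H D → Src Sg L D → Prop
  | .attn _ _ _ _, _ => True
  | .unembed _, .tok _ => True
  | .mlp _ _ _, .tok .start => True
  | _, _ => False

/-- All product functions of a transformer, as a function of the slot and of the labels on the left
and on the right. -/
abbrev Products (Sg : Type*) (L H D : ℕ) : Type _ := Slot L H D → Src Sg L D → Src Sg L D → ℝ

/-- Translation-invariant product functions with bandwidth `Δ` and `P` fractional bits, at context
width `N`. -/
structure Products.Regular {Sg : Type*} {L H D : ℕ} (β : Products Sg L H D) (N : ℕ∞) (Δ P : ℕ) :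
    Prop where
  shift : ∀ c v w dp dc, (v.shift dp dc).InRange N → (w.shift dp dc).InRange N →
    β c (v.shift dp dc) (w.shift dp dc) = β c v w
  far : ∀ c v w, v.InRange N → w.InRange N → v.Far Δ w → β c v w = 0
  dyadic : ∀ c v w, v.InRange N → w.InRange N → Dyadic P (β c v w)
  -- These products do not depend on `k`, while `U` is bounded into `ℓ²`: a nonzero value would
  -- occur in infinitely many coordinates of one vector. The explicit realization of `U` needs the
  -- vanishing in turn.
  unembed_obj : ∀ S (k : ℕ) w, (k : ℕ∞) < N → w.InRange N →
    w.NotObj → β (.unembed S) (.tok (.obj k)) w = 0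
  eq_zero : ∀ c v w, ¬ c.Admits v → β c v w = 0

/-- The parameters of a transformer, apart from the context width, with the sizes in the type. -/
structure Net (Sg : Type*) (L H D q : ℕ) (E : Type*) [NormedAddCommGroup E]
    [InnerProductSpace ℝ E] where
  pos : ℕ → E
  emb : Token Sg → E
  K : Fin L → Fin H → E →L[ℝ] E
  Q : Fin L → Fin H → E →L[ℝ] E
  V : Fin L → Fin H → E →L[ℝ] E
  A : Fin L → E →L[ℝ] EuclideanSpace ℝ (Fin D)
  B : Fin L → EuclideanSpace ℝ (Fin D) →L[ℝ] E
  b : Fin L → EuclideanSpace ℝ (Fin D)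
  act : Fin L → Fin D → Activation
  U : Token Sg → E

namespace Net

variable {Sg : Type*} {L H D q : ℕ} {E : Type*} [NormedAddCommGroup E] [InnerProductSpace ℝ E]

/-- The transformer with given parameters and context width. -/
@[reducible] def toTransformer (M : Net Sg L H D q E) (N : ℕ∞) : Transformer Sg E where
  N := N
  L := L
  H := H
  dff := D
  attPrec := q
  pos := M.pos
  emb := M.emb
  K := M.K
  Q := M.Q
  V := M.V
  A := M.A
  B := M.B
  b := M.b
  act := M.act
  U := M.U

/-- The product of the value matrices along a route. -/
noncomputable def prod (M : Net Sg L H D q E) (S : Route L H) : E →L[ℝ] E :=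
  (List.finRange L).foldl
    (fun A l => match S l with
      | none => A
      | some h => (M.V l h).comp A)
    (ContinuousLinearMap.id ℝ E)

/-- The vector with a given label. -/
noncomputable def vec (M : Net Sg L H D q E) : Src Sg L D → E
  | .pos t => M.pos t
  | .tok ω => M.emb ω
  | .hid l s => M.B l (EuclideanSpace.single s 1)

/-- The product functions. -/
noncomputable def val (M : Net Sg L H D q E) : Products Sg L H D
  | .attn l h S₁ S₂, v, w => inner ℝ (M.K l h (M.prod S₁ (M.vec v))) (M.Q l h (M.prod S₂ (M.vec w)))
  | .unembed S, .tok ω, w => inner ℝ (M.U ω) (M.prod S (M.vec w))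
  | .mlp S l s, .tok .start, w => M.A l (M.prod S (M.vec w)) s
  | _, _, _ => 0

theorem val_eq_zero (M : Net Sg L H D q E) (c : Slot L H D) (v w : Src Sg L D)
    (h : ¬ c.Admits v) : M.val c v w = 0 := by
  rcases c with _ | _ | _ <;> rcases v with t | (_ | σ | k) | ⟨l, s⟩ <;>
    simp_all [val, Slot.Admits]

theorem prod_none (M : Net Sg L H D q E) : M.prod (fun _ => none) = ContinuousLinearMap.id ℝ E := by
  refine foldl_finRange_induction _ (fun _ A => A = ContinuousLinearMap.id ℝ E) _ rfl ?_
  rintro l A rfl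
  rfl

/-- The route `S` uses no layer from `k` on, so the new factor stays leftmost. In the fold the two
products agree until layer `k` has been processed and differ by `V k h` afterwards. -/
theorem V_comp_prod (M : Net Sg L H D q E) (S : Route L H) (k : Fin L) (h : Fin H)
    (hS : ∀ l, k ≤ l → S l = none) :
    (M.V k h).comp (M.prod S) = M.prod (Function.update S k (some h)) := by
  have := foldl_finRange_rel
    (fun (A : E →L[ℝ] E) l => match S l with
      | none => A
      | some h => (M.V l h).comp A)
    (fun (A : E →L[ℝ] E) l => match Function.update S k (some h) l with
      | none => A
      | some h => (M.V l h).comp A)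
    (fun i A B => B = if i ≤ k then A else (M.V k h).comp A)
    (ContinuousLinearMap.id ℝ E) (ContinuousLinearMap.id ℝ E) (by simp) ?_
  · rw [prod, prod, this, if_neg (by simp)]
  · rintro l A B rfl
    rcases lt_trichotomy l k with hl | rfl | hl
    · have h1 : (l : ℕ) < k := hl
      simp only [Function.update_of_ne hl.ne, if_pos h1.le, if_pos (Nat.succ_le_of_lt h1)]
    · simp [hS l le_rfl]
    · have h1 : (k : ℕ) < l := hl
      have h2 : ¬ (l : ℕ) ≤ k := by omega
      have h3 : ¬ (l : ℕ) + 1 ≤ k := by omega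
      simp only [Function.update_of_ne hl.ne', hS l hl.le, if_neg h2, if_neg h3]

/-! ### Outputs depend only on product functions -/

section Eval

variable {E' : Type*} [NormedAddCommGroup E'] [InnerProductSpace ℝ E']

/-- The pairs of corresponding activations that can occur below layer `k`. -/
noncomputable def pairs (M : Net Sg L H D q E) (M' : Net Sg L H D q E')
    (φ φ' : Src Sg L D → Src Sg L D) (X : Src Sg L D → Prop) (k : ℕ) : Submodule ℝ (E × E') :=
  Submodule.span ℝ {z | ∃ (S : Route L H) (v : Src Sg L D), (∀ l : Fin L, k ≤ l → S l = none) ∧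
    X v ∧ z = (M.prod S (M.vec (φ v)), M'.prod S (M'.vec (φ' v)))}

variable {M : Net Sg L H D q E} {M' : Net Sg L H D q E'} {φ φ' : Src Sg L D → Src Sg L D}
  {X : Src Sg L D → Prop}

theorem pairs_mono {k m : ℕ} (h : k ≤ m) : pairs M M' φ φ' X k ≤ pairs M M' φ φ' X m := by
  apply Submodule.span_mono
  rintro z ⟨S, v, h1, h2, h3⟩
  exact ⟨S, v, fun l hl => h1 l (h.trans hl), h2, h3⟩

theorem vec_mem_pairs {v : Src Sg L D} (hv : X v) (k : ℕ) :
    (M.vec (φ v), M'.vec (φ' v)) ∈ pairs M M' φ φ' X k :=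
  Submodule.subset_span ⟨fun _ => none, v, fun _ _ => rfl, hv, by simp [prod_none]⟩

/-- A generator at level `k` uses only layers below `k`, so a head of layer `k` may be appended to
its route. This is why the level rises by one with each layer. -/
theorem V_mem_pairs {k : Fin L} {h : Fin H} {z : E × E'} (hz : z ∈ pairs M M' φ φ' X k) :
    (M.V k h z.1, M'.V k h z.2) ∈ pairs M M' φ φ' X (k + 1) := by
  have : pairs M M' φ φ' X k ≤ (pairs M M' φ φ' X (k + 1)).comap
      ((M.V k h : E →ₗ[ℝ] E).prodMap (M'.V k h : E' →ₗ[ℝ] E')) := by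
    apply Submodule.span_le.2
    rintro z ⟨S, v, h1, h2, rfl⟩
    refine Submodule.subset_span ⟨Function.update S k (some h), v, ?_, h2, ?_⟩
    · intro l hl
      rw [Function.update_of_ne (by rintro rfl; omega)]
      exact h1 l (by omega)
    · rw [← V_comp_prod _ _ _ _ h1, ← V_comp_prod _ _ _ _ h1]
      rfl
  exact this hz

/-- On generators this is equality of attention products; both sides are bilinear, so it passes to
the span. -/
theorem inner_eq_of_mem_pairs {k : ℕ} {l : Fin L} {h : Fin H}
    (H1 : ∀ c v w, X v → X w → M.val c (φ v) (φ w) = M'.val c (φ' v) (φ' w))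
    {z w : E × E'} (hz : z ∈ pairs M M' φ φ' X k) (hw : w ∈ pairs M M' φ φ' X k) :
    inner ℝ (M.K l h z.1) (M.Q l h w.1) = inner ℝ (M'.K l h z.2) (M'.Q l h w.2) := by
  refine Submodule.span_induction (p := fun z _ => inner ℝ (M.K l h z.1) (M.Q l h w.1) =
    inner ℝ (M'.K l h z.2) (M'.Q l h w.2)) ?_ (by simp) ?_ ?_ hz
  · rintro z ⟨S, v, -, hv, rfl⟩
    refine Submodule.span_induction (p := fun w _ => inner ℝ (M.K l h (M.prod S (M.vec (φ v))))
      (M.Q l h w.1) = inner ℝ (M'.K l h (M'.prod S (M'.vec (φ' v)))) (M'.Q l h w.2)) ?_ (by simp)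
      ?_ ?_ hw
    · rintro w ⟨S', v', -, hv', rfl⟩
      exact H1 (.attn l h S S') v v' hv hv'
    · intro x y _ _ hx hy
      simp [inner_add_right, hx, hy]
    · intro a x _ hx
      simp [inner_smul_right, hx]
  · intro x y _ _ hx hy
    simp [inner_add_left, hx, hy]
  · intro a x _ hx
    simp [inner_smul_left, hx]

theorem A_eq_of_mem_pairs {k : ℕ} {l : Fin L} {s : Fin D}
    (H1 : ∀ c v w, X v → X w → M.val c (φ v) (φ w) = M'.val c (φ' v) (φ' w))
    (hX : X (.tok .start)) (hφ : φ (.tok .start) = .tok .start)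
    (hφ' : φ' (.tok .start) = .tok .start)
    {z : E × E'} (hz : z ∈ pairs M M' φ φ' X k) : M.A l z.1 s = M'.A l z.2 s := by
  refine Submodule.span_induction (p := fun z _ => M.A l z.1 s = M'.A l z.2 s) ?_ (by simp)
    ?_ ?_ hz
  · rintro z ⟨S, v, -, hv, rfl⟩
    have := H1 (.mlp S l s) (.tok .start) v hX hv
    rwa [hφ, hφ'] at this
  · intro x y _ _ hx hy
    simp [hx, hy]
  · intro a x _ hx
    simp [hx]

theorem U_eq_of_mem_pairs {k : ℕ} {ω ω₁ ω₂ : Token Sg}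
    (H1 : ∀ c v w, X v → X w → M.val c (φ v) (φ w) = M'.val c (φ' v) (φ' w))
    (hX : X (.tok ω)) (hφ : φ (.tok ω) = .tok ω₁)
    (hφ' : φ' (.tok ω) = .tok ω₂)
    {z : E × E'} (hz : z ∈ pairs M M' φ φ' X k) :
    inner ℝ (M.U ω₁) z.1 = inner ℝ (M'.U ω₂) z.2 := by
  refine Submodule.span_induction (p := fun z _ => inner ℝ (M.U ω₁) z.1 =
    inner ℝ (M'.U ω₂) z.2) ?_ (by simp) ?_ ?_ hz
  · rintro z ⟨S, v, -, hv, rfl⟩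
    have := H1 (.unembed S) (.tok ω) v hX hv
    rwa [hφ, hφ'] at this
  · intro x y _ _ hx hy
    simp [inner_add_right, hx, hy]
  · intro a x _ hx
    simp [inner_smul_right, hx]

/-- The two layers form linear combinations with the same coefficients: attention weights and hidden
activations are functions of product functions and biases, hence equal. Attention then adds images
under `V`, and the MLP adds columns of `B`, which are labelled vectors themselves. -/
theorem layer_mem_pairs (ε : ℝ) {N N' : ℕ∞} {m : ℕ} (l : Fin L)
    (H1 : ∀ c v w, X v → X w → M.val c (φ v) (φ w) = M'.val c (φ' v) (φ' w))
    (hX : X (.tok .start)) (hφ : φ (.tok .start) = .tok .start)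
    (hφ' : φ' (.tok .start) = .tok .start)
    (hXh : ∀ l s, X (.hid l s)) (hh : ∀ l s, φ (.hid l s) = .hid l s)
    (hh' : ∀ l s, φ' (.hid l s) = .hid l s)
    (hb : ∀ l s, M.b l s = M'.b l s) (ha : ∀ l s, M.act l s = M'.act l s)
    {y : Fin m → E} {y' : Fin m → E'} (hy : ∀ i, (y i, y' i) ∈ pairs M M' φ φ' X l) (i : Fin m) :
    ((M.toTransformer N).layer ε l y i, (M'.toTransformer N').layer ε l y' i) ∈
      pairs M M' φ φ' X (l + 1) := by
  have hw : ∀ h i j, (M.toTransformer N).attWeight l h y i j =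
      (M'.toTransformer N').attWeight l h y' i j := by
    intro h i j
    have := inner_eq_of_mem_pairs (l := l) (h := h) H1 (hy j) (hy i)
    simp only [attWeight] at this ⊢
    rw [this]
  have hatt : ((M.toTransformer N).attBlock l y i, (M'.toTransformer N').attBlock l y' i) ∈
      pairs M M' φ φ' X (l + 1) := by
    simp only [attBlock, hw]
    have : ∀ h : Fin H, ∀ c : Fin m → ℝ, ∀ s : Finset (Fin m),
        ((∑ j ∈ s, c j)⁻¹ • ∑ j ∈ s, c j • M.V l h (y j),
          (∑ j ∈ s, c j)⁻¹ • ∑ j ∈ s, c j • M'.V l h (y' j)) ∈ pairs M M' φ φ' X (l + 1) := by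
      intro h c s
      have := Submodule.smul_mem (pairs M M' φ φ' X (l + 1)) (∑ j ∈ s, c j)⁻¹
        (Submodule.sum_mem (pairs M M' φ φ' X (l + 1)) (t := s)
          (f := fun j => c j • (M.V l h (y j), M'.V l h (y' j)))
          (fun j _ => Submodule.smul_mem _ _ (V_mem_pairs (hy j))))
      convert this using 1
      ext <;> simp [Prod.fst_sum, Prod.snd_sum]
    have := Submodule.add_mem _ (pairs_mono (Nat.le_succ l) (hy i))
      (Submodule.sum_mem (pairs M M' φ φ' X (l + 1)) (t := Finset.univ)
          (fun h _ => this h (fun j => (M'.toTransformer N').attWeight l h y' i j)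
            (Finset.univ.filter (· ≤ i))))
    convert this using 1
    ext <;> simp [Prod.fst_sum, Prod.snd_sum]
  simp only [layer, mlp]
  set z := (M.toTransformer N).attBlock l y i
  set z' := (M'.toTransformer N').attBlock l y' i
  have hψ : ∀ s, ((M.act l s).apply ε (M.A l z s + M.b l s)) =
      ((M'.act l s).apply ε (M'.A l z' s + M'.b l s)) := by
    intro s
    rw [ha, hb, A_eq_of_mem_pairs (s := s) (l := l) H1 hX hφ hφ' hatt]
  have hB : ∀ ψ : Fin D → ℝ, (M.B l (WithLp.toLp 2 ψ), M'.B l (WithLp.toLp 2 ψ)) ∈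
      pairs M M' φ φ' X (l + 1) := by
    intro ψ
    have e : WithLp.toLp 2 ψ = ∑ s, ψ s • EuclideanSpace.single s (1 : ℝ) := by
      ext i
      simp [Finset.sum_apply, Pi.single_apply]
    have := Submodule.sum_mem (pairs M M' φ φ' X (l + 1)) (t := Finset.univ)
      (f := fun s => ψ s • (M.vec (φ (.hid l s)), M'.vec (φ' (.hid l s))))
      (fun s _ => Submodule.smul_mem _ _ (vec_mem_pairs (hXh l s) _))
    convert this using 1
    rw [e]
    ext <;> simp [Prod.fst_sum, Prod.snd_sum, hh, hh', vec]
  have := Submodule.add_mem _ hatt (hB fun s => (M.act l s).apply ε (M.A l z s + M.b l s))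
  convert this using 2 <;> simp only [hψ] <;> rfl

/-- The output of a transformer depends only on its product functions, biases and activation
functions. -/
theorem eval_eq (ε : ℝ) {N N' : ℕ∞} (M : Net Sg L H D q E) (M' : Net Sg L H D q E')
    (op oc op' oc' : ℕ) (X : Src Sg L D → Prop)
    (H1 : ∀ c v w, X v → X w →
      M.val c (v.shift op oc) (w.shift op oc) = M'.val c (v.shift op' oc') (w.shift op' oc'))
    (hXh : ∀ l s, X (.hid l s))
    (hb : ∀ l s, M.b l s = M'.b l s) (ha : ∀ l s, M.act l s = M'.act l s)
    (x : Input Sg) (hpos : ∀ i : Fin x.len, X (.pos i)) (htok : ∀ i, X (.tok (x.token i)))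
    (i : Fin x.len) (ω : Token Sg) (hω : X (.tok ω)) :
    (M.toTransformer N).eval ε x op oc i (ω.shift oc) =
      (M'.toTransformer N').eval ε x op' oc' i (ω.shift oc') := by
  have hX : X (.tok .start) := htok 0
  have key := foldl_finRange_rel (fun y l => (M.toTransformer N).layer ε l y)
    (fun y l => (M'.toTransformer N').layer ε l y)
    (fun k (y : Fin x.len → E) (y' : Fin x.len → E') => ∀ i, (y i, y' i) ∈
      pairs M M' (Src.shift op oc) (Src.shift op' oc') X k)
    ((M.toTransformer N).initial x op oc) ((M'.toTransformer N').initial x op' oc') ?_ ?_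
  · exact U_eq_of_mem_pairs H1 hω rfl rfl (key i)
  · intro i
    exact Submodule.add_mem _ (vec_mem_pairs (htok i) 0) (vec_mem_pairs (hpos i) 0)
  · intro l y y' hy i
    exact layer_mem_pairs ε l H1 hX rfl rfl hXh (fun _ _ => rfl) (fun _ _ => rfl) hb ha hy i

end Eval

end Net

end LengthGen

namespace LengthGen

open Transformer

/-! ## Sparse matrices as bounded operators -/

section Sparse

variable {ι κ E : Type*} [NormedAddCommGroup E] [InnerProductSpace ℝ E] {e : ι → E}

/-- A Schur-type bound. Cauchy–Schwarz in each row costs `r * a ^ 2`; after exchanging the sums each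
squared coefficient of `x` is counted at most `r` times, and Bessel's inequality bounds their total.
Rows have their own index type so that the bound also serves the unembedding matrix. -/
theorem sum_sq_rows_le (he : Orthonormal ℝ e) (nb : κ → Finset ι) {r : ℕ}
    (hrow : ∀ i, (nb i).card ≤ r) (s : Finset κ)
    (hcol : ∀ j, ∀ t ⊆ s, (∀ i ∈ t, j ∈ nb i) → t.card ≤ r) (c : κ → ι → ℝ) {a : ℝ}
    (ha : ∀ i j, |c i j| ≤ a) (x : E) :
    ∑ i ∈ s, (∑ j ∈ nb i, c i j * inner ℝ (e j) x) ^ 2 ≤ (r * a * ‖x‖) ^ 2 := by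
  classical
  have h1 : ∀ i, (∑ j ∈ nb i, c i j * inner ℝ (e j) x) ^ 2 ≤
      (r * a ^ 2) * ∑ j ∈ nb i, inner ℝ (e j) x ^ 2 := by
    intro i
    refine (Finset.sum_mul_sq_le_sq_mul_sq _ _ _).trans ?_
    refine mul_le_mul_of_nonneg_right ?_ (Finset.sum_nonneg fun _ _ => sq_nonneg _)
    calc ∑ j ∈ nb i, c i j ^ 2 ≤ ∑ j ∈ nb i, a ^ 2 := Finset.sum_le_sum fun j _ => by
          rw [← sq_abs]; exact pow_le_pow_left₀ (abs_nonneg _) (ha i j) 2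
      _ ≤ r * a ^ 2 := by
          rw [Finset.sum_const, nsmul_eq_mul]
          exact mul_le_mul_of_nonneg_right (by exact_mod_cast hrow i) (sq_nonneg _)
  have h2 : ∑ i ∈ s, ∑ j ∈ nb i, inner ℝ (e j) x ^ 2 ≤ r * ‖x‖ ^ 2 := by
    rw [Finset.sum_comm' (t' := s.biUnion nb) (s' := fun j => s.filter (fun i => j ∈ nb i))]
    · calc ∑ j ∈ s.biUnion nb, ∑ i ∈ s.filter (fun i => j ∈ nb i), inner ℝ (e j) x ^ 2
          ≤ ∑ j ∈ s.biUnion nb, r * inner ℝ (e j) x ^ 2 := Finset.sum_le_sum fun j _ => by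
            rw [Finset.sum_const, nsmul_eq_mul]
            refine mul_le_mul_of_nonneg_right ?_ (sq_nonneg _)
            exact_mod_cast hcol j _ (Finset.filter_subset _ _) (by simp)
        _ ≤ r * ‖x‖ ^ 2 := by
            rw [← Finset.mul_sum]
            refine mul_le_mul_of_nonneg_left ?_ (Nat.cast_nonneg _)
            simpa using he.sum_inner_products_le x (s := s.biUnion nb)
    · intro i j
      simp only [Finset.mem_biUnion, Finset.mem_filter]
      grind
  calc ∑ i ∈ s, (∑ j ∈ nb i, c i j * inner ℝ (e j) x) ^ 2
      ≤ ∑ i ∈ s, (r * a ^ 2) * ∑ j ∈ nb i, inner ℝ (e j) x ^ 2 :=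
        Finset.sum_le_sum fun i _ => h1 i
    _ ≤ (r * a ^ 2) * (r * ‖x‖ ^ 2) := by
        rw [← Finset.mul_sum]
        exact mul_le_mul_of_nonneg_left h2 (by positivity)
    _ = (r * a * ‖x‖) ^ 2 := by ring

/-- A matrix with bounded entries and boundedly many entries in each row and column acts as a
bounded operator along an orthonormal family. -/
theorem exists_sparse_operator [CompleteSpace E] (he : Orthonormal ℝ e) (nb : ι → Finset ι)
    {r : ℕ} (hcard : ∀ i, (nb i).card ≤ r) (hsymm : ∀ i j, j ∈ nb i → i ∈ nb j) (c : ι → ι → ℝ)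
    {a : ℝ} (ha0 : 0 ≤ a) (ha : ∀ i j, |c i j| ≤ a) :
    ∃ F : E →L[ℝ] E, ‖F‖ ≤ r * a ∧ ∀ j, F (e j) = ∑ i ∈ nb j, c i j • e i := by
  classical
  have hb : ∀ (x : E) (s : Finset ι),
      ∑ i ∈ s, ‖∑ j ∈ nb i, c i j * inner ℝ (e j) x‖ ^ (2 : ENNReal).toReal ≤
        (r * a * ‖x‖) ^ (2 : ENNReal).toReal := by
    intro x s
    have := sum_sq_rows_le he nb hcard s (fun j t _ ht =>
      (Finset.card_le_card fun i hi => hsymm _ _ (ht i hi)).trans (hcard j)) c ha x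
    simpa using this
  -- The image is first formed as a coefficient sequence in `ℓ²` and then carried to `E` by the
  -- isometry that the orthonormal family defines. Vectors orthogonal to the family are sent to `0`.
  let G : E →ₗ[ℝ] lp (fun _ : ι => ℝ) 2 :=
    { toFun := fun x => ⟨fun i => ∑ j ∈ nb i, c i j * inner ℝ (e j) x, memℓp_gen' (hb x)⟩
      map_add' := by
        intro x y
        ext i
        simp [inner_add_right, mul_add, Finset.sum_add_distrib]
        rfl
      map_smul' := by
        intro b x
        ext i
        simp [inner_smul_right, Finset.mul_sum, mul_left_comm] }
  have hG : ∀ x, ‖G x‖ ≤ r * a * ‖x‖ := fun x =>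
    lp.norm_le_of_forall_sum_le (by simp) (by positivity) (hb x)
  let F : E →L[ℝ] E := he.orthogonalFamily.linearIsometry.toContinuousLinearMap.comp
    (G.mkContinuous (r * a) hG)
  refine ⟨F, ContinuousLinearMap.opNorm_le_bound _ (by positivity) fun x => ?_, fun j => ?_⟩
  · simpa [F] using hG x
  · have h1 := he.orthogonalFamily.hasSum_linearIsometry (G (e j))
    have h2 : ∀ i, (G (e j) : ∀ _ : ι, ℝ) i = if i ∈ nb j then c i j else 0 := by
      intro i
      change ∑ k ∈ nb i, c i k * inner ℝ (e k) (e j) = _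
      simp only [orthonormal_iff_ite.1 he, mul_ite, mul_one, mul_zero]
      rw [Finset.sum_ite_eq']
      by_cases h : j ∈ nb i
      · simp [h, hsymm _ _ h]
      · have : i ∉ nb j := fun h' => h (hsymm _ _ h')
        simp [h, this]
    refine h1.unique ?_
    have h3 := hasSum_sum_of_ne_finset_zero (L := .unconditional ι) (f := fun i =>
      (LinearIsometry.toSpanSingleton ℝ E (he.1 i)) ((G (e j) : ∀ _ : ι, ℝ) i)) (s := nb j) ?_
    · convert h3 using 1
      refine Finset.sum_congr rfl fun i hi => ?_
      simp [h2, hi]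
    · intro i hi
      simp [h2, hi]

theorem inner_sparse (he : Orthonormal ℝ e) (s : Finset ι) (c : ι → ℝ) (hc : ∀ i, i ∉ s → c i = 0)
    (i : ι) : inner ℝ (e i) (∑ j ∈ s, c j • e j) = c i := by
  classical
  simp only [inner_sum, inner_smul_right, orthonormal_iff_ite.1 he, mul_ite, mul_one, mul_zero,
    Finset.sum_ite_eq]
  split_ifs with h
  · rfl
  · rw [hc i h]

end Sparse

end LengthGen

namespace LengthGen

open Transformer

/-! ## The pair of labels, up to shifts -/

namespace Src

variable {Sg : Type*} {L D : ℕ}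

/-- The label with number `t` among positions (`true`) or objects (`false`). -/
def movable : Bool → ℕ → Src Sg L D
  | true, t => .pos t
  | false, t => .tok (.obj t)

/-- The type of a label: all positions have one type, and all objects have one type. -/
def kind : Src Sg L D → Bool ⊕ (Option Sg ⊕ (Fin L × Fin D))
  | .pos _ => .inl true
  | .tok (.obj _) => .inl false
  | .tok .start => .inr (.inl none)
  | .tok (.sym σ) => .inr (.inl (some σ))
  | .hid l s => .inr (.inr (l, s))

/-- A label of a given type. -/
def ofKind : Bool ⊕ (Option Sg ⊕ (Fin L × Fin D)) → Src Sg L D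
  | .inl b => movable b 0
  | .inr (.inl none) => .tok .start
  | .inr (.inl (some σ)) => .tok (.sym σ)
  | .inr (.inr (l, s)) => .hid l s

/-- Numbers of positions and objects are at most `Δ`. -/
def InBox (Δ : ℕ) : Src Sg L D → Prop
  | .pos t => t ≤ Δ
  | .tok (.obj k) => k ≤ Δ
  | _ => True

theorem finite_inBox [Fintype Sg] (Δ : ℕ) : {v : Src Sg L D | v.InBox Δ}.Finite := by
  have h1 : ((fun b : Bool × ℕ => (movable b.1 b.2 : Src Sg L D)) ''
      (Set.univ ×ˢ Set.Iic Δ)).Finite :=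
    Set.Finite.image _ (Set.finite_univ.prod (Set.finite_Iic Δ))
  have h2 : (Set.range (ofKind : _ → Src Sg L D)).Finite := Set.finite_range _
  refine (h1.union h2).subset ?_
  rintro v hv
  rcases v with t | (_ | σ | k) | ⟨l, s⟩
  · exact .inl ⟨(true, t), ⟨trivial, hv⟩, rfl⟩
  · exact .inr ⟨.inr (.inl none), rfl⟩
  · exact .inr ⟨.inr (.inl (some σ)), rfl⟩
  · exact .inl ⟨(false, k), ⟨trivial, hv⟩, rfl⟩
  · exact .inr ⟨.inr (.inr (l, s)), rfl⟩

/-- Up to shifts, there are finitely many pairs of labels that are not far from each other. -/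
theorem far_or_exists_shift (Δ : ℕ) (v w : Src Sg L D) :
    v.Far Δ w ∨ ∃ dp dc v₀ w₀, InBox Δ v₀ ∧ InBox Δ w₀ ∧
      v = v₀.shift dp dc ∧ w = w₀.shift dp dc := by
  rcases v with t | (_ | σ | k) | ⟨l, s⟩ <;> rcases w with t' | (_ | σ' | k') | ⟨l', s'⟩
  case pos.pos =>
    by_cases h : (Δ : ℤ) < |(t : ℤ) - t'|
    · exact .inl h
    · refine .inr ⟨min t t', 0, .pos (t - min t t'), .pos (t' - min t t'), ?_, ?_, ?_, ?_⟩
      · simp only [InBox]; grind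
      · simp only [InBox]; grind
      · simp only [shift]; congr 1; omega
      · simp only [shift]; congr 1; omega
  case tok.obj.tok.obj =>
    by_cases h : (Δ : ℤ) < |(k : ℤ) - k'|
    · exact .inl h
    · refine .inr ⟨0, min k k', .tok (.obj (k - min k k')), .tok (.obj (k' - min k k')),
        ?_, ?_, ?_, ?_⟩
      · simp only [InBox]; grind
      · simp only [InBox]; grind
      · simp only [shift, Token.shift]; congr 2; omega
      · simp only [shift, Token.shift]; congr 2; omega
  case pos.tok.obj => exact .inr ⟨t, k', .pos 0, .tok (.obj 0), by simp [InBox, shift, Token.shift]⟩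
  case tok.obj.pos => exact .inr ⟨t', k, .tok (.obj 0), .pos 0, by simp [InBox, shift, Token.shift]⟩
  all_goals right
  case pos.tok.start => exact ⟨t, 0, .pos 0, .tok .start, by simp [InBox, shift, Token.shift]⟩
  case pos.tok.sym => exact ⟨t, 0, .pos 0, .tok (.sym σ'), by simp [InBox, shift, Token.shift]⟩
  case pos.hid => exact ⟨t, 0, .pos 0, .hid l' s', by simp [InBox, shift]⟩
  case tok.start.pos => exact ⟨t', 0, .tok .start, .pos 0, by simp [InBox, shift, Token.shift]⟩
  case tok.sym.pos => exact ⟨t', 0, .tok (.sym σ), .pos 0, by simp [InBox, shift, Token.shift]⟩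
  case hid.pos => exact ⟨t', 0, .hid l s, .pos 0, by simp [InBox, shift]⟩
  case tok.obj.tok.start =>
    exact ⟨0, k, .tok (.obj 0), .tok .start, by simp [InBox, shift, Token.shift]⟩
  case tok.obj.tok.sym =>
    exact ⟨0, k, .tok (.obj 0), .tok (.sym σ'), by simp [InBox, shift, Token.shift]⟩
  case tok.obj.hid =>
    exact ⟨0, k, .tok (.obj 0), .hid l' s', by simp [InBox, shift, Token.shift]⟩
  case tok.start.tok.obj =>
    exact ⟨0, k', .tok .start, .tok (.obj 0), by simp [InBox, shift, Token.shift]⟩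
  case tok.sym.tok.obj =>
    exact ⟨0, k', .tok (.sym σ), .tok (.obj 0), by simp [InBox, shift, Token.shift]⟩
  case hid.tok.obj =>
    exact ⟨0, k', .hid l s, .tok (.obj 0), by simp [InBox, shift, Token.shift]⟩
  all_goals
    refine ⟨0, 0, _, _, ?_, ?_, (Src.shift_zero _).symm, (Src.shift_zero _).symm⟩ <;> trivial

theorem InBox.inRange {Δ : ℕ} {N : ℕ∞} (h : (Δ : ℕ∞) < N) {v : Src Sg L D} (hv : v.InBox Δ) :
    v.InRange N := by
  rcases v with t | (_ | σ | k) | ⟨l, s⟩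
  · exact lt_of_le_of_lt (by exact_mod_cast hv) h
  · trivial
  · trivial
  · exact lt_of_le_of_lt (by exact_mod_cast hv) h
  · trivial

end Src

instance Slot.finite (L H D : ℕ) : Finite (Slot L H D) := by
  let f : Slot L H D → (Fin L × Fin H × Route L H × Route L H) ⊕ Route L H ⊕
      (Route L H × Fin L × Fin D) := fun c => match c with
    | .attn l h S₁ S₂ => .inl (l, h, S₁, S₂)
    | .unembed S => .inr (.inl S)
    | .mlp S l s => .inr (.inr (S, l, s))
  refine Finite.of_injective f ?_
  rintro (⟨l, h, S₁, S₂⟩ | S | ⟨S, l, s⟩) (⟨l', h', S₁', S₂'⟩ | S' | ⟨S', l', s'⟩) <;> simp [f]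

namespace Products.Regular

variable {Sg : Type*} {L H D : ℕ} {β β' : Products Sg L H D} {Δ P P' : ℕ} {N N' : ℕ∞}

/-- Product functions that agree for small numbers of positions and objects agree wherever both are
in range. -/
theorem eq_of_box (hβ : β.Regular N Δ P) (hβ' : β'.Regular N' Δ P')
    (h : ∀ c v w, v.InBox Δ → w.InBox Δ → β c v w = β' c v w) (c : Slot L H D) (v w : Src Sg L D)
    (hv : v.InRange N) (hw : w.InRange N) (hv' : v.InRange N') (hw' : w.InRange N') :
    β c v w = β' c v w := by
  rcases Src.far_or_exists_shift Δ v w with hf | ⟨dp, dc, v₀, w₀, h1, h2, rfl, rfl⟩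
  · rw [hβ.far c v w hv hw hf, hβ'.far c v w hv' hw' hf]
  · rw [hβ.shift _ _ _ _ _ hv hw, hβ'.shift _ _ _ _ _ hv' hw', h c _ _ h1 h2]

/-- Only finitely many values occur: far pairs give `0`, and every other pair is a shift of a pair
in the finite box. -/
theorem exists_bound [Fintype Sg] (hβ : β.Regular ⊤ Δ P) :
    ∃ a : ℝ, 0 ≤ a ∧ ∀ c v w, |β c v w| ≤ a := by
  have hfin : ((fun z : Slot L H D × Src Sg L D × Src Sg L D => |β z.1 z.2.1 z.2.2|) ''
      (Set.univ ×ˢ ({v | v.InBox Δ} ×ˢ {v | v.InBox Δ}))).Finite :=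
    (Set.finite_univ.prod ((Src.finite_inBox Δ).prod (Src.finite_inBox Δ))).image _
  obtain ⟨a, ha⟩ := hfin.bddAbove
  refine ⟨max a 0, le_max_right _ _, fun c v w => ?_⟩
  rcases Src.far_or_exists_shift Δ v w with hf | ⟨dp, dc, v₀, w₀, h1, h2, rfl, rfl⟩
  · rw [hβ.far c v w (Src.inRange_top v) (Src.inRange_top w) hf]
    simp
  · rw [hβ.shift _ _ _ _ _ (Src.inRange_top _) (Src.inRange_top _)]
    exact (ha ⟨(c, v₀, w₀), ⟨trivial, h1, h2⟩, rfl⟩).trans (le_max_left _ _)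

end Products.Regular

end LengthGen

namespace LengthGen

open Transformer

/-! ## An explicit realization of given product functions -/

/-- Basis vectors of the explicit residual stream: one for every type of labels, and one for every
position and every object. -/
abbrev Node (Sg : Type*) (L D : ℕ) (N : ℕ∞) : Type _ :=
  (Bool ⊕ (Option Sg ⊕ (Fin L × Fin D))) ⊕ (Bool × {t : ℕ // (t : ℕ∞) < N})

section Node

variable {Sg : Type*} {L H D : ℕ} {N : ℕ∞}

open Classical in
/-- The node of an individual position or object. -/
noncomputable def Src.own (N : ℕ∞) : Src Sg L D → Option (Bool × {t : ℕ // (t : ℕ∞) < N})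
  | .pos t => if h : (t : ℕ∞) < N then some (true, ⟨t, h⟩) else none
  | .tok (.obj t) => if h : (t : ℕ∞) < N then some (false, ⟨t, h⟩) else none
  | _ => none

theorem Src.kind_movable (b : Bool) (t : ℕ) : (movable b t : Src Sg L D).kind = .inl b := by
  cases b <;> rfl

theorem Src.inRange_movable {b : Bool} {t : ℕ} :
    (movable b t : Src Sg L D).InRange N ↔ (t : ℕ∞) < N := by
  cases b <;> rfl

theorem Src.own_movable {b : Bool} {t : ℕ} (h : (t : ℕ∞) < N) :
    (movable b t : Src Sg L D).own N = some (b, ⟨t, h⟩) := by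
  cases b <;> simp [movable, own, h]

theorem Src.movable_or_fixed (v : Src Sg L D) :
    (∃ b t, v = movable b t) ∨ (∃ κ, v.kind = .inr κ ∧ v = ofKind (.inr κ)) ∧ v.NotObj ∧
      (∀ dp dc, v.shift dp dc = v) ∧ ∀ N, v.own N = none := by
  rcases v with t | (_ | σ | k) | ⟨l, s⟩
  · exact .inl ⟨true, t, rfl⟩
  · exact .inr ⟨⟨_, rfl, rfl⟩, trivial, fun _ _ => rfl, fun _ => rfl⟩
  · exact .inr ⟨⟨_, rfl, rfl⟩, trivial, fun _ _ => rfl, fun _ => rfl⟩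
  · exact .inl ⟨false, k, rfl⟩
  · exact .inr ⟨⟨_, rfl, rfl⟩, trivial, fun _ _ => rfl, fun _ => rfl⟩

/-- The shift `u` of the other sort is free, so a position and an object can be brought to index `0`
by one joint shift. -/
theorem Src.movable_eq_shift (b : Bool) (t u : ℕ) : (movable b t : Src Sg L D) =
    (movable b 0).shift (if b then t else u) (if b then u else t) := by
  cases b <;> simp [movable, shift, Token.shift]

open Classical in
/-- The matrix entries that realize a translation-invariant family of products. -/
noncomputable def Node.coef (γ : Src Sg L D → Src Sg L D → ℝ) : Node Sg L D N → Node Sg L D N → ℝ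
  -- Products of two positions, or of two objects, vary with the indices and are carried by the
  -- individual nodes; the entry between their types must not contribute.
  | .inl κ, .inl κ' => if κ = κ' ∧ κ.isLeft then 0 else γ (.ofKind κ) (.ofKind κ')
  | .inr (b, t), .inr (b', t') => if b = b' then γ (.movable b t) (.movable b' t') else 0
  | _, _ => 0

theorem Node.abs_coef_le {γ : Src Sg L D → Src Sg L D → ℝ} {a : ℝ} (ha : 0 ≤ a)
    (h : ∀ v w, |γ v w| ≤ a) (n n' : Node Sg L D N) : |coef γ n n'| ≤ a := by
  rcases n with κ | ⟨b, t⟩ <;> rcases n' with κ' | ⟨b', t'⟩ <;> simp only [coef] <;>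
    (try split_ifs) <;> simp [h, ha]

theorem Dyadic.zero (P : ℕ) : Dyadic P 0 := ⟨0, by simp⟩

theorem Dyadic.one (P : ℕ) : Dyadic P 1 := ⟨2 ^ P, by simp⟩

theorem Node.dyadic_coef {γ : Src Sg L D → Src Sg L D → ℝ} {P : ℕ}
    (h : ∀ v w, Dyadic P (γ v w)) (n n' : Node Sg L D N) : Dyadic P (coef γ n n') := by
  rcases n with κ | ⟨b, t⟩ <;> rcases n' with κ' | ⟨b', t'⟩ <;> simp only [coef] <;>
    (try split_ifs) <;> simp [h, Dyadic.zero]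

open Classical in
/-- The nodes that can interact with a given one at bandwidth `Δ`. -/
noncomputable def Node.nbhd [Fintype Sg] (Δ : ℕ) : Node Sg L D N → Finset (Node Sg L D N)
  | .inl _ => Finset.univ.image .inl
  | .inr (b, t) => ((Finset.Icc (t.1 - Δ) (t.1 + Δ)).subtype (fun t : ℕ => (t : ℕ∞) < N)).image
      fun t' => .inr (b, t')

theorem Node.mem_nbhd_symm [Fintype Sg] {Δ : ℕ} {n n' : Node Sg L D N} (h : n' ∈ n.nbhd Δ) :
    n ∈ n'.nbhd Δ := by
  rcases n with κ | ⟨b, t⟩ <;> rcases n' with κ' | ⟨b', t'⟩ <;> simp [nbhd] at h ⊢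
  obtain ⟨h1, rfl⟩ := h
  exact ⟨by omega, rfl⟩

/-- A type meets only the finitely many types, and an individual node only a band of `2 * Δ + 1`
nodes of its sort. The bound does not involve `N`, which is the source of all uniform bounds below.
-/
theorem Node.card_nbhd_le [Fintype Sg] (Δ : ℕ) (n : Node Sg L D N) :
    (n.nbhd Δ).card ≤ Fintype.card (Bool ⊕ (Option Sg ⊕ (Fin L × Fin D))) + (2 * Δ + 1) := by
  classical
  rcases n with κ | ⟨b, t⟩
  · exact Finset.card_image_le.trans (Nat.le_add_right _ _)
  · refine Finset.card_image_le.trans (le_trans ?_ (Nat.le_add_left _ _))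
    rw [Finset.card_subtype]
    refine (Finset.card_filter_le _ _).trans ?_
    rw [Nat.card_Icc]
    omega

theorem Node.coef_eq_zero [Fintype Sg] {γ : Src Sg L D → Src Sg L D → ℝ} {Δ : ℕ}
    (h : ∀ v w, v.Far Δ w → γ v w = 0) {n n' : Node Sg L D N} (hn : n' ∉ n.nbhd Δ) :
    coef γ n n' = 0 := by
  rcases n with κ | ⟨b, t⟩ <;> rcases n' with κ' | ⟨b', t'⟩ <;> simp [nbhd, coef] at hn ⊢
  rintro rfl
  apply h
  have : (Δ : ℤ) < |((t : ℕ) : ℤ) - (t' : ℕ)| := by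
    by_contra h'
    apply hn <;> grind
  cases b <;> exact this

variable {E : Type*} [NormedAddCommGroup E] [InnerProductSpace ℝ E]

/-- The image of the vector with label `v` along the route `S`. -/
noncomputable def Src.point (e : Node Sg L D N × Route L H → E) (v : Src Sg L D) (S : Route L H) :
    E :=
  e (.inl v.kind, S) + (v.own N).elim 0 fun z => e (.inr z, S)

/-- The products on types of labels, for labels that do not have the same movable type. -/
theorem Src.eq_ofKind {γ : Src Sg L D → Src Sg L D → ℝ}
    (h : ∀ v w dp dc, γ (v.shift dp dc) (w.shift dp dc) = γ v w) (v w : Src Sg L D)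
    (hvw : ∀ b t t', v = movable b t → w ≠ movable b t') :
    γ v w = γ (ofKind v.kind) (ofKind w.kind) := by
  rcases v.movable_or_fixed with ⟨b, t, rfl⟩ | ⟨⟨κ, hκ, hv⟩, -, hs, -⟩ <;>
    rcases w.movable_or_fixed with ⟨b', t', rfl⟩ | ⟨⟨κ', hκ', hw⟩, -, hs', -⟩
  · have hb : b ≠ b' := by rintro rfl; exact hvw b t t' rfl rfl
    rw [kind_movable, kind_movable, movable_eq_shift b t t', movable_eq_shift b' t' t]
    obtain rfl : b' = !b := by cases b <;> cases b' <;> simp_all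
    cases b
    · exact h (movable false 0) (movable true 0) t' t
    · exact h (movable true 0) (movable false 0) t t'
  · conv_lhs => rw [movable_eq_shift b t 0, ← hs' (if b then t else 0) (if b then 0 else t), h]
    rw [kind_movable, hκ', ← hw]
    rfl
  · conv_lhs => rw [movable_eq_shift b' t' 0, ← hs (if b' then t' else 0) (if b' then 0 else t'), h]
    rw [kind_movable, hκ, ← hv]
    rfl
  · rw [hκ, hκ', ← hv, ← hw]

/-- A label is mapped to its type node plus its own node. Within one sort only the entry between own
nodes survives; in all other cases only the entry between types does, and translation invariance
makes that the right constant. -/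
theorem Src.inner_point {γ : Src Sg L D → Src Sg L D → ℝ}
    (h : ∀ v w dp dc, γ (v.shift dp dc) (w.shift dp dc) = γ v w)
    {e : Node Sg L D N × Route L H → E} {S₁ S₂ : Route L H} {F : E →L[ℝ] E}
    (hF : ∀ n n', inner ℝ (e (n, S₁)) (F (e (n', S₂))) = Node.coef γ n n')
    {v w : Src Sg L D} (hv : v.InRange N) (hw : w.InRange N) :
    inner ℝ (v.point e S₁) (F (w.point e S₂)) = γ v w := by
  have hg := eq_ofKind h v w
  rcases v.movable_or_fixed with ⟨b, t, rfl⟩ | ⟨⟨κ, hκ, hv'⟩, -, -, ho⟩ <;>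
    rcases w.movable_or_fixed with ⟨b', t', rfl⟩ | ⟨⟨κ', hκ', hw'⟩, -, -, ho'⟩
  · by_cases hb : b = b'
    · subst hb
      simp [point, kind_movable, own_movable (inRange_movable.1 hv),
        own_movable (inRange_movable.1 hw), inner_add_left, inner_add_right, hF, Node.coef]
    · rw [hg]
      · simp [point, kind_movable, own_movable (inRange_movable.1 hv),
          own_movable (inRange_movable.1 hw), inner_add_left, inner_add_right, hF, Node.coef, hb]
      · intro c u u' h1 h2
        apply hb
        have h3 := congrArg kind h1
        have h4 := congrArg kind h2
        simp only [kind_movable, Sum.inl.injEq] at h3 h4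
        rw [h3, h4]
  · rw [hg]
    · simp [point, kind_movable, own_movable (inRange_movable.1 hv), inner_add_left,
        hF, Node.coef, ho', hκ']
    · rintro c u u' - rfl
      simp [kind_movable] at hκ'
  · rw [hg]
    · simp [point, kind_movable, own_movable (inRange_movable.1 hw),
        inner_add_right, hF, Node.coef, ho, hκ]
    · rintro c u u' rfl -
      simp [kind_movable] at hκ
  · rw [hg]
    · simp [point, hF, Node.coef, ho, hκ, ho', hκ']
    · rintro c u u' rfl -
      simp [kind_movable] at hκ

/-- The node on which the row with label `v` of a matrix of products is placed. -/
noncomputable def Src.head (N : ℕ∞) (v : Src Sg L D) : Node Sg L D N :=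
  (v.own N).elim (.inl v.kind) .inr

/-- A row is placed on a single node. A row on an own node sees only own nodes of its sort, so its
products with all other labels have to vanish, as `h0` demands. Using the type node as well would
give all rows `U_{c_k}` a common entry, and `U` would not be bounded uniformly. -/
theorem Src.row_point {γ : Src Sg L D → Src Sg L D → ℝ}
    (h : ∀ v w dp dc, γ (v.shift dp dc) (w.shift dp dc) = γ v w)
    {e : Node Sg L D N × Route L H → E} {S : Route L H} {F : E →L[ℝ] ℝ} {v w : Src Sg L D}
    (hF : ∀ n', F (e (n', S)) = Node.coef γ (v.head N) n')
    (hv : v.InRange N) (hw : w.InRange N)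
    (h0 : ∀ b t, v = movable b t → (∀ t', w ≠ movable b t') → γ v w = 0) :
    F (w.point e S) = γ v w := by
  have hg := eq_ofKind h v w
  rcases v.movable_or_fixed with ⟨b, t, rfl⟩ | ⟨⟨κ, hκ, hv'⟩, -, -, ho⟩ <;>
    rcases w.movable_or_fixed with ⟨b', t', rfl⟩ | ⟨⟨κ', hκ', hw'⟩, -, -, ho'⟩
  · by_cases hb : b = b'
    · subst hb
      simp [point, kind_movable, own_movable (inRange_movable.1 hv), head,
        own_movable (inRange_movable.1 hw), hF, Node.coef]
    · rw [h0 b t rfl]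
      · simp [point, kind_movable, own_movable (inRange_movable.1 hv), head,
          own_movable (inRange_movable.1 hw), hF, Node.coef, hb]
      · intro u h2
        apply hb
        have h4 := congrArg kind h2
        simp only [kind_movable, Sum.inl.injEq] at h4
        rw [h4]
  · rw [h0 b t rfl]
    · simp [point, own_movable (inRange_movable.1 hv), head, hF, Node.coef, ho', hκ']
    · rintro u rfl
      simp [kind_movable] at hκ'
  · rw [hg]
    · simp [point, kind_movable, own_movable (inRange_movable.1 hw), head, hF, Node.coef, ho, hκ]
    · rintro c u u' rfl -
      simp [kind_movable] at hκ
  · rw [hg]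
    · simp [point, hF, Node.coef, head, ho, hκ, ho', hκ']
    · rintro c u u' rfl -
      simp [kind_movable] at hκ

end Node

end LengthGen

/-! ### Norms and precision of the explicit realization -/

namespace LengthGen

open Transformer

/-- `x` is a finite combination of the `e i` with coefficients of `P` fractional bits. -/
def IsDyadicComb {ι E : Type*} [NormedAddCommGroup E] [InnerProductSpace ℝ E] (e : ι → E) (P : ℕ)
    (x : E) : Prop :=
  ∃ (s : Finset ι) (c : ι → ℝ), (∀ i, Dyadic P (c i)) ∧ x = ∑ i ∈ s, c i • e i

section

variable {ι E : Type*} [NormedAddCommGroup E] [InnerProductSpace ℝ E] {e : ι → E} {P : ℕ}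

theorem Dyadic.add {x y : ℝ} (hx : Dyadic P x) (hy : Dyadic P y) : Dyadic P (x + y) := by
  obtain ⟨m, rfl⟩ := hx
  obtain ⟨n, rfl⟩ := hy
  exact ⟨m + n, by push_cast; ring⟩

theorem IsDyadicComb.zero : IsDyadicComb e P 0 := ⟨∅, fun _ => 0, fun _ => Dyadic.zero P, by simp⟩

theorem IsDyadicComb.single (i : ι) : IsDyadicComb e P (e i) :=
  ⟨{i}, fun _ => 1, fun _ => Dyadic.one P, by simp⟩

theorem IsDyadicComb.add {x y : E} (hx : IsDyadicComb e P x) (hy : IsDyadicComb e P y) :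
    IsDyadicComb e P (x + y) := by
  classical
  obtain ⟨s, c, hc, rfl⟩ := hx
  obtain ⟨t, d, hd, rfl⟩ := hy
  refine ⟨s ∪ t, fun i => (if i ∈ s then c i else 0) + if i ∈ t then d i else 0, ?_, ?_⟩
  · intro i
    exact Dyadic.add (by split_ifs <;> simp [hc, Dyadic.zero])
      (by split_ifs <;> simp [hd, Dyadic.zero])
  · simp only [add_smul, Finset.sum_add_distrib, ite_smul, zero_smul, Finset.sum_ite_mem]
    congr 2 <;> ext i <;> simp +contextual

end

/-- The properties of the explicit realization along the orthonormal family `e` that are used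
below. -/
structure Net.IsExplicit {Sg : Type*} [Fintype Sg] {L H D q : ℕ} {ι E : Type*}
    [NormedAddCommGroup E] [InnerProductSpace ℝ E] (M : Net Sg L H D q E) (N : ℕ∞) (e : ι → E)
    (P : ℕ) (C : ℝ) : Prop where
  K_eq : ∀ l h, M.K l h = ContinuousLinearMap.id ℝ E
  norm_Q : ∀ l h, ‖M.Q l h‖ ≤ C
  norm_V : ∀ l h, ‖M.V l h‖ ≤ C
  norm_pos : ∀ t, ‖M.pos t‖ ≤ C
  norm_emb : ∀ ω, ‖M.emb ω‖ ≤ C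
  unembed : ∀ n : ℕ, (n : ℕ∞) ≤ N → (M.toTransformer N).UnembedBound n C
  comb_pos : ∀ t, IsDyadicComb e P (M.pos t)
  comb_emb : ∀ ω, IsDyadicComb e P (M.emb ω)
  comb_U : ∀ ω, IsDyadicComb e P (M.U ω)
  comb_Q : ∀ l h i, IsDyadicComb e P (M.Q l h (e i))
  comb_V : ∀ l h i, IsDyadicComb e P (M.V l h (e i))
  B_single : ∀ l s, ∃ i, M.B l (EuclideanSpace.single s 1) = e i
  dyadic_A : ∀ l s i, Dyadic P (M.A l (e i) s)
  sum_A : ∀ l (t : Finset ι), ∑ s, ∑ i ∈ t, M.A l (e i) s ^ 2 ≤ C ^ 2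

section

variable {Sg : Type*} {L H D : ℕ}

/-- Different tokens occupy different nodes, so a column of the unembedding matrix meets at most as
many rows as its node has neighbours. -/
theorem head_tokenOf_injective {N : ℕ∞} {n : ℕ} (hn : (n : ℕ∞) ≤ N) :
    Function.Injective fun ω : Vocab Sg n => Src.head (L := L) (D := D) N (.tok (tokenOf ω)) := by
  have hk : ∀ k : Fin n, ((k : ℕ) : ℕ∞) < N := fun k =>
    lt_of_lt_of_le (by exact_mod_cast k.2) hn
  rintro ((_ | σ) | k) ((_ | σ') | k') h <;>
    simp_all [Src.head, tokenOf, Src.own, Src.kind, Fin.ext_iff]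

open Classical in
/-- The value matrix entries: the head `h` of layer `l` is appended to routes below layer `l`. -/
noncomputable def routeStep {N : ℕ∞} (l : Fin L) (h : Fin H)
    (z z' : Node Sg L D N × Route L H) : ℝ :=
  if z.1 = z'.1 ∧ (∀ k, l ≤ k → z'.2 k = none) ∧ z.2 = Function.update z'.2 l (some h)
    then 1 else 0

/-- There is a copy of the basis for every route, and each value matrix passes from one copy to the
copy with its head appended; from the empty route the product along `S` reaches the copy `S`.
Different routes stay orthogonal, so products for different routes can be prescribed independently.
-/
theorem prod_eq_of_step {N : ℕ∞} {q : ℕ} {E : Type*} [NormedAddCommGroup E]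
    [InnerProductSpace ℝ E] (M : Net Sg L H D q E) (e : Node Sg L D N × Route L H → E)
    (hV : ∀ l h n S, (∀ k, l ≤ k → S k = none) →
      M.V l h (e (n, S)) = e (n, Function.update S l (some h)))
    (n : Node Sg L D N) (S : Route L H) : M.prod S (e (n, fun _ => none)) = e (n, S) := by
  have := foldl_finRange_induction (fun (A : E →L[ℝ] E) l => match S l with
      | none => A
      | some h => (M.V l h).comp A)
    (fun i A => A (e (n, fun _ => none)) = e (n, fun l => if (l : ℕ) < i then S l else none))
    (ContinuousLinearMap.id ℝ E) (by simp) ?_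
  · refine Eq.trans this ?_
    simp
  · intro l A hA
    rcases hS : S l with _ | h
    · rw [hA]
      congr 2
      funext k
      rcases lt_trichotomy k l with hk | rfl | hk
      · have : (k : ℕ) < l := hk
        simp [this, Nat.lt_succ_of_lt this]
      · simp [hS]
      · have : (l : ℕ) < k := hk
        rw [if_neg (by omega), if_neg (by omega)]
    · change M.V l h (A _) = _
      rw [hA, hV]
      · congr 2
        funext k
        rcases lt_trichotomy k l with hk | rfl | hk
        · have : (k : ℕ) < l := hk
          rw [Function.update_of_ne hk.ne, if_pos this, if_pos (by omega)]
        · simp [hS]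
        · have : (l : ℕ) < k := hk
          rw [Function.update_of_ne hk.ne', if_neg (by omega), if_neg (by omega)]
      · intro k hk
        have : (l : ℕ) ≤ k := hk
        rw [if_neg (by omega)]

variable [Fintype Sg]

/-- The nodes with routes that can interact with a given one. -/
noncomputable def routeNbhd {N : ℕ∞} (H Δ : ℕ) (n : Node Sg L D N) :
    Finset (Node Sg L D N × Route L H) :=
  n.nbhd Δ ×ˢ Finset.univ

theorem mem_routeNbhd {N : ℕ∞} {Δ : ℕ} {n : Node Sg L D N} {z : Node Sg L D N × Route L H} :
    z ∈ routeNbhd H Δ n ↔ z.1 ∈ n.nbhd Δ := by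
  simp [routeNbhd]

theorem card_routeNbhd_le {N : ℕ∞} (Δ : ℕ) (n : Node Sg L D N) : (routeNbhd H Δ n).card ≤
    (Fintype.card (Bool ⊕ (Option Sg ⊕ (Fin L × Fin D))) + (2 * Δ + 1)) *
      Fintype.card (Route L H) := by
  rw [routeNbhd, Finset.card_product]
  exact Nat.mul_le_mul (Node.card_nbhd_le Δ n) le_rfl

/-- Translation-invariant local product functions of finite precision are realized at every context
width, along any orthonormal family with the right index set, with uniform bounds. -/
theorem exists_explicit {β : Products Sg L H D} {Δ P : ℕ} (hβ : β.Regular ⊤ Δ P) (q : ℕ)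
    (b : Fin L → EuclideanSpace ℝ (Fin D)) (act : Fin L → Fin D → Activation) :
    ∃ C : ℝ, ∀ (N : ℕ∞) (E : Type) [NormedAddCommGroup E] [InnerProductSpace ℝ E]
      [CompleteSpace E] (e : Node Sg L D N × Route L H → E), Orthonormal ℝ e →
      ∃ M : Net Sg L H D q E, M.IsExplicit N e P C ∧ M.b = b ∧ M.act = act ∧
        ∀ c v w, v.InRange N → w.InRange N → M.val c v w = β c v w := by
  classical
  obtain ⟨a, ha0, ha⟩ := hβ.exists_bound
  set r : ℕ := (Fintype.card (Bool ⊕ (Option Sg ⊕ (Fin L × Fin D))) + (2 * Δ + 1)) *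
      Fintype.card (Route L H) with hr
  have hr1 : (1 : ℝ) ≤ r := by
    have : 0 < r := Nat.mul_pos (by omega) Fintype.card_pos
    exact_mod_cast this
  -- The `Q` have norm at most `r * a` and the `V` at most `r`; the factor `D + 2` absorbs the norm
  -- `2` of the embeddings and the `D` rows of `A`.
  refine ⟨(D + 2) * (r * (a + 1)), ?_⟩
  intro N E _ _ _ e he
  have hshift : ∀ c v w dp dc, β c (v.shift dp dc) (w.shift dp dc) = β c v w :=
    fun c v w dp dc => hβ.shift c v w dp dc (Src.inRange_top _) (Src.inRange_top _)
  have hfar : ∀ c v w, v.Far Δ w → β c v w = 0 :=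
    fun c v w => hβ.far c v w (Src.inRange_top _) (Src.inRange_top _)
  have hdy : ∀ c v w, Dyadic P (β c v w) :=
    fun c v w => hβ.dyadic c v w (Src.inRange_top _) (Src.inRange_top _)
  have hnb : ∀ i j : Node Sg L D N × Route L H, j ∈ routeNbhd H Δ i.1 → i ∈ routeNbhd H Δ j.1 :=
    fun i j h => mem_routeNbhd.2 (Node.mem_nbhd_symm (mem_routeNbhd.1 h))
  have hQ : ∀ l h, ∃ F : E →L[ℝ] E, ‖F‖ ≤ r * a ∧ ∀ j : Node Sg L D N × Route L H, F (e j) =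
      ∑ i ∈ routeNbhd H Δ j.1, Node.coef (β (.attn l h i.2 j.2)) i.1 j.1 • e i := fun l h =>
    exists_sparse_operator he (fun i => routeNbhd H Δ i.1) (fun i => card_routeNbhd_le Δ i.1)
      hnb (fun i j => Node.coef (β (.attn l h i.2 j.2)) i.1 j.1) ha0
      (fun i j => Node.abs_coef_le ha0 (ha _) _ _)
  have hV : ∀ l h, ∃ F : E →L[ℝ] E, ‖F‖ ≤ r * 1 ∧ ∀ j : Node Sg L D N × Route L H, F (e j) =
      ∑ i ∈ routeNbhd H Δ j.1, routeStep l h i j • e i := fun l h =>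
    exists_sparse_operator he (fun i => routeNbhd H Δ i.1) (fun i => card_routeNbhd_le Δ i.1)
      hnb (fun i j => routeStep l h i j) zero_le_one
      (fun i j => by rw [routeStep]; split_ifs <;> simp)
  choose Q hQn hQe using hQ
  choose V hVn hVe using hV
  -- The vector that represents the functional with value `Node.coef (γ j.2) n j.1` at `e j`; by
  -- locality the sum over the neighbourhood is enough.
  let row (γ : Route L H → Src Sg L D → Src Sg L D → ℝ) (n : Node Sg L D N) : E :=
    ∑ j ∈ routeNbhd H Δ n, Node.coef (γ j.2) n j.1 • e j
  have hrow : ∀ γ : Route L H → Src Sg L D → Src Sg L D → ℝ,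
      (∀ S v w, v.Far Δ w → γ S v w = 0) → ∀ n j, inner ℝ (row γ n) (e j) =
      Node.coef (γ j.2) n j.1 := by
    intro γ hγ n j
    rw [real_inner_comm]
    refine inner_sparse he _ _ (fun i hi => ?_) j
    exact Node.coef_eq_zero (hγ _) fun h => hi (mem_routeNbhd.2 h)
  let M : Net Sg L H D q E :=
    { pos := fun t => Src.point e (.pos t) fun _ => none
      emb := fun ω => Src.point e (.tok ω) fun _ => none
      -- With `K` the identity, `Q` carries the whole bilinear form, and `KᵀQ` has the norm of `Q`.
      K := fun _ _ => ContinuousLinearMap.id ℝ E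
      Q := Q
      V := V
      A := fun l => ((EuclideanSpace.equiv (Fin D) ℝ).symm :
        (Fin D → ℝ) →L[ℝ] EuclideanSpace ℝ (Fin D)).comp (ContinuousLinearMap.pi fun s =>
          innerSL ℝ (row (fun S => β (.mlp S l s)) (.inl (.inr (.inl none)))))
      B := fun l => ∑ s, (EuclideanSpace.proj (𝕜 := ℝ) s : EuclideanSpace ℝ (Fin D) →L[ℝ] ℝ).smulRight
        (e (.inl (.inr (.inr (l, s))), fun _ => none))
      b := b
      act := act
      U := fun ω => row (fun S => β (.unembed S)) (Src.head N (.tok ω)) }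
  have hA : ∀ l s x, M.A l x s =
      inner ℝ (row (fun S => β (.mlp S l s)) (.inl (.inr (.inl none)))) x := fun l s x => rfl
  have hB : ∀ l s, M.B l (EuclideanSpace.single s 1) =
      e (.inl (.inr (.inr (l, s))), fun _ => none) := by
    intro l s
    simp [M, ite_smul]
  have hvec : ∀ v, M.vec v = v.point e fun _ => none := by
    rintro (t | ω | ⟨l, s⟩)
    · rfl
    · rfl
    · simp only [Net.vec, hB]
      simp [Src.point, Src.kind, Src.own]
  have hstep : ∀ l h n S, (∀ k, l ≤ k → S k = none) →
      M.V l h (e (n, S)) = e (n, Function.update S l (some h)) := by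
    intro l h n S hS
    refine (hVe l h (n, S)).trans ?_
    rw [Finset.sum_eq_single (n, Function.update S l (some h))]
    · rw [routeStep, if_pos ⟨rfl, hS, rfl⟩, one_smul]
    · rintro ⟨n', S'⟩ - hne
      rw [routeStep, if_neg, zero_smul]
      rintro ⟨h1, -, h3⟩
      exact hne (Prod.ext h1 h3)
    · intro hne
      refine absurd (mem_routeNbhd.2 ?_) hne
      rcases n with κ | ⟨b, t⟩ <;> simp [Node.nbhd]
  have hprod : ∀ S v, M.prod S (M.vec v) = v.point e S := by
    intro S v
    rw [hvec, Src.point, Src.point, map_add, prod_eq_of_step M e hstep]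
    congr 1
    rcases v.own N with _ | z
    · simp
    · exact prod_eq_of_step M e hstep _ S
  have hrR : (0 : ℝ) ≤ r := by positivity
  have hC2 : 2 ≤ (D + 2) * (r * (a + 1)) := by
    have : 1 ≤ r * (a + 1) := by nlinarith
    have hD : (0 : ℝ) ≤ D := Nat.cast_nonneg D
    nlinarith
  have hCr : r * (a + 1) ≤ (D + 2) * (r * (a + 1)) := by
    have hD : (0 : ℝ) ≤ D := Nat.cast_nonneg D
    have : 0 ≤ r * (a + 1) := by positivity
    nlinarith
  have hpoint : ∀ v S, ‖Src.point e v S‖ ≤ 2 := by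
    intro v S
    refine (norm_add_le _ _).trans ?_
    rw [he.1]
    rcases v.own N with _ | z
    · norm_num
    · simp only [Option.elim, he.1]; norm_num
  have hcomb : ∀ v S, IsDyadicComb e P (Src.point e v S) := by
    intro v S
    refine IsDyadicComb.add (IsDyadicComb.single _) ?_
    rcases v.own N with _ | z
    · exact IsDyadicComb.zero
    · exact IsDyadicComb.single _
  refine ⟨M, ?_, rfl, rfl, ?_⟩
  · constructor
    · intro l h
      rfl
    · intro l h
      refine (hQn l h).trans (le_trans ?_ hCr)
      nlinarith
    · intro l h
      refine (hVn l h).trans (le_trans ?_ hCr)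
      nlinarith
    · exact fun t => (hpoint _ _).trans hC2
    · exact fun t => (hpoint _ _).trans hC2
    · intro n hn
      refine ⟨by positivity, fun x => ?_⟩
      have hinj := head_tokenOf_injective (Sg := Sg) (L := L) (D := D) hn
      have h1 := sum_sq_rows_le he (fun ω : Vocab Sg n => routeNbhd H Δ
        (Src.head (L := L) (D := D) N (.tok (tokenOf ω)))) (fun ω => card_routeNbhd_le Δ _)
        Finset.univ ?_ (fun ω j => Node.coef (β (.unembed j.2))
          (Src.head (L := L) (D := D) N (.tok (tokenOf ω))) j.1)
        (fun i j => Node.abs_coef_le ha0 (ha _) _ _) x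
      · have h2 : ∀ ω : Vocab Sg n, inner ℝ ((M.toTransformer N).U (tokenOf ω)) x =
            ∑ j ∈ routeNbhd H Δ (Src.head (L := L) (D := D) N (.tok (tokenOf ω))),
              Node.coef (β (.unembed j.2))
                (Src.head (L := L) (D := D) N (.tok (tokenOf ω))) j.1 * inner ℝ (e j) x := by
          intro ω
          simp only [M, row, sum_inner, inner_smul_left]
          rfl
        simp only [h2]
        refine (Real.sqrt_le_sqrt h1).trans ?_
        rw [Real.sqrt_sq (by positivity)]
        refine mul_le_mul_of_nonneg_right (le_trans ?_ hCr) (norm_nonneg _)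
        rw [← hr]
        nlinarith
      · intro j t _ ht
        refine le_trans ?_ (Nat.le_mul_of_pos_right _ Fintype.card_pos)
        refine le_trans ?_ (Node.card_nbhd_le Δ j.1)
        exact Finset.card_le_card_of_injOn _
          (fun ω hω => Node.mem_nbhd_symm (mem_routeNbhd.1 (ht ω hω))) hinj.injOn
    · exact fun t => hcomb _ _
    · exact fun t => hcomb _ _
    · exact fun ω => ⟨_, _, fun j => Node.dyadic_coef (hdy _) _ _, rfl⟩
    · exact fun l h j => ⟨_, _, fun i => Node.dyadic_coef (hdy _) _ _, hQe l h j⟩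
    · refine fun l h j => ⟨_, _, fun i => ?_, hVe l h j⟩
      rw [routeStep]
      split_ifs
      · exact Dyadic.one P
      · exact Dyadic.zero P
    · exact fun l s => ⟨_, hB l s⟩
    · intro l s i
      rw [hA, hrow (fun S => β (.mlp S l s)) (fun S => hfar _)]
      exact Node.dyadic_coef (hdy _) _ _
    · intro l t
      have h1 : ∀ s, ∑ i ∈ t, M.A l (e i) s ^ 2 ≤ r * a ^ 2 := by
        intro s
        have h2 : ∀ i ∈ t, M.A l (e i) s ^ 2 ≤
            if i ∈ routeNbhd H Δ (.inl (.inr (.inl none))) then a ^ 2 else 0 := by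
          intro i _
          rw [hA, hrow (fun S => β (.mlp S l s)) (fun S => hfar _)]
          split_ifs with hi
          · rw [← sq_abs]
            exact pow_le_pow_left₀ (abs_nonneg _) (Node.abs_coef_le ha0 (ha _) _ _) 2
          · rw [Node.coef_eq_zero (hfar _) fun h => hi (mem_routeNbhd.2 h)]
            simp
        refine (Finset.sum_le_sum h2).trans ?_
        rw [Finset.sum_ite_mem, Finset.sum_const, nsmul_eq_mul]
        refine mul_le_mul_of_nonneg_right ?_ (sq_nonneg _)
        exact_mod_cast (Finset.card_le_card Finset.inter_subset_right).trans
          (card_routeNbhd_le Δ _)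
      refine (Finset.sum_le_sum fun s _ => h1 s).trans ?_
      rw [Finset.sum_const, Finset.card_univ, Fintype.card_fin, nsmul_eq_mul]
      have hD : (0 : ℝ) ≤ D := Nat.cast_nonneg D
      have e1 : (r : ℝ) * a ^ 2 ≤ (r * (a + 1)) ^ 2 := by
        have : (r : ℝ) ≤ r ^ 2 := by nlinarith
        calc (r : ℝ) * a ^ 2 ≤ r ^ 2 * (a + 1) ^ 2 := by
              apply mul_le_mul this _ (by positivity) (by positivity)
              exact pow_le_pow_left₀ ha0 (by linarith) 2
          _ = _ := by ring
      calc (D : ℝ) * (r * a ^ 2) ≤ (D + 2) ^ 2 * (r * (a + 1)) ^ 2 := by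
            apply mul_le_mul (by nlinarith) e1 (by positivity) (by positivity)
        _ = _ := by ring
  · intro c v w hv hw
    by_cases hc : c.Admits v
    swap
    · rw [Net.val_eq_zero _ _ _ _ hc, hβ.eq_zero _ _ _ hc]
    rcases c with ⟨l, h, S₁, S₂⟩ | S | ⟨S, l, s⟩
    · simp only [Net.val, hprod]
      refine Src.inner_point (hshift _) (F := M.Q l h) ?_ hv hw
      intro n n'
      refine (congrArg (inner ℝ (e (n, S₁))) (hQe l h (n', S₂))).trans ?_
      refine inner_sparse he _ (fun i => Node.coef (β (.attn l h i.2 S₂)) i.1 n') ?_ (n, S₁)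
      intro i hi
      exact Node.coef_eq_zero (hfar _) fun h => hi (mem_routeNbhd.2 (Node.mem_nbhd_symm h))
    · rcases v with t | ω | _
      · exact hc.elim
      · simp only [Net.val, hprod]
        refine Src.row_point (hshift _) (F := innerSL ℝ (M.U ω)) ?_ hv hw ?_
        · intro n'
          exact hrow _ (fun S => hfar _) _ (n', S)
        · intro b t hb hw'
          cases b
          · cases hb
            refine hβ.unembed_obj S t w (by exact_mod_cast ENat.natCast_lt_top t) (Src.inRange_top _) ?_
            rcases w with t' | (_ | σ | k) | ⟨l, s⟩ <;> first | trivial | exact hw' k rfl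
          · cases hb
      · exact hc.elim
    · rcases v with t | (_ | σ | k) | ⟨l, s⟩
      · exact hc.elim
      · simp only [Net.val, hprod]
        refine Src.row_point (hshift _)
          (F := innerSL ℝ (row (fun S => β (.mlp S l s)) (.inl (.inr (.inl none))))) ?_ hv hw ?_
        · intro n'
          exact hrow (fun S => β (.mlp S l s)) (fun S => hfar _) _ (n', S)
        · intro b t hb
          cases b <;> cases hb
      all_goals exact hc.elim

end

end LengthGen

namespace LengthGen

open Transformer FiniteTransformer

/-! ## Product functions in the two labellings -/

section Bridge

variable {Sg : Type*} {L H D q : ℕ} {E : Type*} [NormedAddCommGroup E] [InnerProductSpace ℝ E]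

/-- Forget the transformer in the type of a label. -/
def Src.ofSource {T : Transformer Sg E} : T.Source → Src Sg T.L T.dff
  | .pos t => .pos t
  | .tok ω => .tok ω
  | .hid l s => .hid l s

theorem Src.ofSource_shift {T : Transformer Sg E} (v : T.Source) (dp dc : ℕ) :
    ofSource (v.shift dp dc) = (ofSource v).shift dp dc := by
  cases v <;> rfl

theorem Src.inRange_ofSource {T : Transformer Sg E} {v : T.Source} :
    (ofSource v).InRange T.N ↔ v.InRange := by
  cases v <;> rfl

namespace Net

variable (M : Net Sg L H D q E) (N : ℕ∞)

theorem vec_ofSource (v : (M.toTransformer N).Source) :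
    M.vec (Src.ofSource v) = (M.toTransformer N).vec v := by
  cases v <;> rfl

theorem pathProd_eq (S : Route L H) : (M.toTransformer N).pathProd S = M.prod S := by
  refine foldl_finRange_rel _ _ (fun _ A B => A = B) _ _ rfl ?_
  rintro l A B rfl
  rcases hS : S l with _ | h
  · rfl
  · rfl

theorem attnProd_eq (l : Fin L) (h : Fin H) (S₁ S₂ : Route L H) (v w : (M.toTransformer N).Source) :
    (M.toTransformer N).attnProd l h S₁ S₂ v w =
      M.val (.attn l h S₁ S₂) (Src.ofSource v) (Src.ofSource w) := by
  rw [val, vec_ofSource, vec_ofSource, attnProd, pathProd_eq, pathProd_eq]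

theorem unembedProd_eq (S : Route L H) (ω : Token Sg) (w : (M.toTransformer N).Source) :
    (M.toTransformer N).unembedProd S ω w = M.val (.unembed S) (.tok ω) (Src.ofSource w) := by
  rw [val, vec_ofSource, unembedProd, pathProd_eq]

theorem mlpProd_eq (S : Route L H) (l : Fin L) (s : Fin D) (w : (M.toTransformer N).Source) :
    (M.toTransformer N).mlpProd S l s w = M.val (.mlp S l s) (.tok .start) (Src.ofSource w) := by
  rw [val, vec_ofSource, mlpProd, pathProd_eq]

variable {M N} {β : Products Sg L H D} {Δ P : ℕ}

theorem translationInvariant_of_val (hβ : β.Regular ⊤ Δ P)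
    (hM : ∀ c v w, v.InRange N → w.InRange N → M.val c v w = β c v w) :
    (M.toTransformer N).TranslationInvariant := by
  have key : ∀ c v w dp dc, (v.shift dp dc).InRange N → (w.shift dp dc).InRange N →
      M.val c (v.shift dp dc) (w.shift dp dc) = M.val c v w := by
    intro c v w dp dc hv hw
    rw [hM _ _ _ hv hw, hM _ _ _ hv.of_shift hw.of_shift,
      hβ.shift _ _ _ _ _ (Src.inRange_top _) (Src.inRange_top _)]
  constructor
  · intro l h S₁ S₂ v w dp dc hv hw
    rw [attnProd_eq, attnProd_eq, Src.ofSource_shift, Src.ofSource_shift]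
    refine key _ _ _ _ _ ?_ ?_
    · rw [← Src.ofSource_shift]; exact Src.inRange_ofSource.2 hv
    · rw [← Src.ofSource_shift]; exact Src.inRange_ofSource.2 hw
  · intro S ω w dp dc hv hw
    rw [unembedProd_eq, unembedProd_eq, Src.ofSource_shift]
    refine key (.unembed S) (.tok ω) _ dp dc hv ?_
    rw [← Src.ofSource_shift]; exact Src.inRange_ofSource.2 hw
  · intro S l s w dp dc hw
    rw [mlpProd_eq, mlpProd_eq, Src.ofSource_shift]
    refine key (.mlp S l s) (.tok .start) _ dp dc trivial ?_
    rw [← Src.ofSource_shift]; exact Src.inRange_ofSource.2 hw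

theorem local_of_val (hβ : β.Regular ⊤ Δ P)
    (hM : ∀ c v w, v.InRange N → w.InRange N → M.val c v w = β c v w) :
    (M.toTransformer N).Local Δ := by
  constructor
  · intro l h S₁ S₂ k m hk hm hkm
    rw [attnProd_eq]
    refine (hM (.attn l h S₁ S₂) (.pos k) (.pos m) hk hm).trans
      (hβ.far _ _ _ (Src.inRange_top _) (Src.inRange_top _) hkm)
  · intro l h S₁ S₂ k m hk hm hkm
    rw [attnProd_eq]
    refine (hM (.attn l h S₁ S₂) (.tok (.obj k)) (.tok (.obj m)) hk hm).trans
      (hβ.far _ _ _ (Src.inRange_top _) (Src.inRange_top _) hkm)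
  · intro S k m hk hm hkm
    rw [unembedProd_eq]
    exact (hM (.unembed S) (.tok (.obj k)) (.tok (.obj m)) hk hm).trans
      (hβ.far _ _ _ (Src.inRange_top _) (Src.inRange_top _) hkm)

theorem isSymbolicLimit_of_val [Fintype Sg] {ι : Type*} {e : ι → E} {C : ℝ}
    (hβ : β.Regular ⊤ Δ P) (hM : ∀ c v w, v.InRange ⊤ → w.InRange ⊤ → M.val c v w = β c v w)
    (he : M.IsExplicit ⊤ e P C) (hb : ∀ l s, Dyadic P (M.b l s)) :
    (M.toTransformer ⊤).IsSymbolicLimit := by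
  have hd : ∀ c v w, Dyadic P (M.val c v w) := by
    intro c v w
    rw [hM _ _ _ (Src.inRange_top _) (Src.inRange_top _)]
    exact hβ.dyadic _ _ _ (Src.inRange_top _) (Src.inRange_top _)
  constructor
  · rfl
  · exact ⟨C, he.norm_pos, fun k => he.norm_emb _⟩
  · exact ⟨C, fun n => he.unembed n le_top⟩
  · refine ⟨P, fun l h S₁ S₂ v w => ?_, fun S ω w => ?_, fun S l s w => ?_, hb⟩
    · rw [attnProd_eq]; exact hd _ _ _
    · rw [unembedProd_eq]; exact hd _ _ _
    · rw [mlpProd_eq]; exact hd _ _ _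
  · exact translationInvariant_of_val hβ hM
  · exact ⟨Δ, local_of_val hβ hM⟩

end Net

end Bridge

theorem Input.hasObj_of_token {Sg : Type*} {x : Input Sg} {i : Fin x.len} {k : ℕ}
    (h : x.token i = .obj k) : x.HasObj k := by
  revert h
  refine Fin.cases (by simp [token]) (fun j h => ?_) i
  have h' : Sum.elim Token.sym Token.obj (List.get x j) = Token.obj k := h
  have := List.get_mem x j
  rcases hx : List.get x j with σ | m
  · rw [hx] at h'; cases h'
  · rw [hx] at h' this
    cases h'
    exact this

/-- The tokens of an input are in range when its objects are. -/
theorem Input.token_inRange {Sg : Type*} {L D : ℕ} {x : Input Sg} {N : ℕ∞} {oc dp : ℕ}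
    (h : ∀ k, x.HasObj k → ((k + oc : ℕ) : ℕ∞) < N) (i : Fin x.len) :
    ((.tok (x.token i) : Src Sg L D).shift dp oc).InRange N := by
  rcases hi : x.token i with _ | σ | k
  · trivial
  · trivial
  · exact h k (hasObj_of_token hi)

/-! ### A symbolic limit with given regular product functions -/

section Limit

variable {Sg : Type*} [Fintype Sg] {L H D q : ℕ} {β : Products Sg L H D} {Δ P : ℕ}

/-- The limit is realized at infinite width. One of its outputs involves only labels in some window,
where a net with the same products, biases and activations gives the same value. Window and net may
therefore depend on `x`, `i` and `ω`. -/
theorem expressible_of_regular (ε : ℝ) (f : LogitMap Sg) (hβ : β.Regular ⊤ Δ P) (q : ℕ)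
    (b : Fin L → EuclideanSpace ℝ (Fin D)) (act : Fin L → Fin D → Activation)
    (hb : ∀ l s, Dyadic P (b l s))
    (hf : ∀ (x : Input Sg) (i : Fin x.len) (ω : Token Sg), ∃ (N : ℕ∞) (d : ℕ)
      (M : Net Sg L H D q (EuclideanSpace ℝ (Fin d))), (∀ l s, M.b l s = b l s) ∧
      (∀ l s, M.act l s = act l s) ∧ (∀ i : Fin x.len, ((i : ℕ) : ℕ∞) < N) ∧
      (∀ k, x.HasObj k → (k : ℕ∞) < N) ∧ ω.InVocab N ∧
      (∀ c v w, v.InRange N → w.InRange N → M.val c v w = β c v w) ∧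
      (M.toTransformer N).eval ε x 0 0 i ω = f x i ω) :
    ExpressibleBySymbolicLimit ε f := by
  classical
  obtain ⟨C, hC⟩ := exists_explicit hβ q b act
  have : Countable (Node Sg L D ⊤ × Route L H) := inferInstance
  -- The alphabet may live in any universe, but the Hilbert space must lie in `Type`. The index set
  -- is countable, hence has a copy there.
  let ι := Shrink.{0} (Node Sg L D ⊤ × Route L H)
  let e : Node Sg L D ⊤ × Route L H → lp (fun _ : ι => ℝ) 2 := fun z =>
    lp.single 2 (equivShrink _ z) (1 : ℝ)
  have he : Orthonormal ℝ e := by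
    rw [orthonormal_iff_ite]
    intro z z'
    rw [lp.inner_single_left, lp.single_apply]
    by_cases h : z = z'
    · subst h; simp
    · simp [h]
  obtain ⟨M, hM, rfl, rfl, hval⟩ := hC ⊤ _ e he
  refine ⟨_, _, _, inferInstance, M.toTransformer ⊤, Net.isSymbolicLimit_of_val hβ hval hM hb, ?_⟩
  intro x i ω
  obtain ⟨N, d, M', hb', ha', hx, hobj, hω, hval', hev⟩ := hf x i ω
  rw [← hev]
  have key := Net.eval_eq ε (N := ⊤) (N' := N) M M' 0 0 0 0 (fun v => v.InRange N) ?_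
    (fun _ _ => trivial) (fun l s => (hb' l s).symm) (fun l s => (ha' l s).symm) x hx
    (fun i => by simpa using Input.token_inRange (oc := 0) (dp := 0) (by simpa using hobj) i) i ω hω
  · have h0 : ω.shift 0 = ω := by cases ω <;> rfl
    rwa [h0] at key
  · intro c v w hv hw
    simp only [Src.shift_zero]
    rw [hval _ _ _ (Src.inRange_top _) (Src.inRange_top _), hval' _ _ _ hv hw]

end Limit

end LengthGen

namespace LengthGen

open Transformer FiniteTransformer

/-! ## Finite transformers of bounded complexity from a symbolic limit -/

theorem sum_le_of_eq_zero_of_lt {Δ : ℕ} {A : ℝ} (s : Finset ℕ) (g : ℕ → ℝ) (hA : 0 ≤ A)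
    (h1 : ∀ j ∈ s, g j ≤ A) (h2 : ∀ j ∈ s, Δ < j → g j = 0) :
    ∑ j ∈ s, g j ≤ (Δ + 1) * A := by
  have h3 : ∀ j ∈ s, g j ≤ if j ∈ Finset.range (Δ + 1) then A else 0 := by
    intro j hj
    split_ifs with h
    · exact h1 j hj
    · exact (h2 j hj (by simpa using h)).le
  refine (Finset.sum_le_sum h3).trans ?_
  rw [Finset.sum_ite_mem, Finset.sum_const, nsmul_eq_mul]
  refine mul_le_mul_of_nonneg_right ?_ hA
  have : (s ∩ Finset.range (Δ + 1)).card ≤ Δ + 1 :=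
    (Finset.card_le_card Finset.inter_subset_right).trans (by simp)
  exact_mod_cast this

theorem sum_vocab_le {Sg : Type*} [Fintype Sg] {Δ n : ℕ} {A : ℝ} (g : Token Sg → ℝ) (hA : 0 ≤ A)
    (h1 : ∀ ω : Vocab Sg n, g (tokenOf ω) ≤ A) (h2 : ∀ j < n, Δ < j → g (.obj j) = 0) :
    ∑ ω : Vocab Sg n, g (tokenOf ω) ≤ (Fintype.card (Option Sg) + (Δ + 1)) * A := by
  rw [Fintype.sum_sum_type, add_mul]
  refine add_le_add ?_ ?_
  · refine (Finset.sum_le_sum fun ω _ => h1 (.inl ω)).trans ?_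
    simp
  · have : ∑ k : Fin n, g (tokenOf (.inr k)) = ∑ j ∈ Finset.range n, g (.obj j) :=
      Fin.sum_univ_eq_sum_range (fun j => g (.obj j)) n
    rw [this]
    refine sum_le_of_eq_zero_of_lt _ _ hA (fun j hj => ?_) fun j hj => h2 j (by simpa using hj)
    exact h1 (.inr ⟨j, by simpa using hj⟩)

section

variable {Sg : Type*} {L H D q : ℕ} {Δ P : ℕ}

/-- In its window `M` has the products of `M₀`, and translation invariance of the latter removes the
offsets; so `M` at any offsets computes what `M₀` computes at offsets `0`. -/
theorem matchesOn_of_val {E₀ : Type*} [NormedAddCommGroup E₀] [InnerProductSpace ℝ E₀] {ε : ℝ}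
    {f : LogitMap Sg} {M₀ : Net Sg L H D q E₀} (hβ : M₀.val.Regular ⊤ Δ P)
    (hf : ∀ x i ω, (M₀.toTransformer ⊤).eval ε x 0 0 i ω = f x i ω) {E : Type*}
    [NormedAddCommGroup E] [InnerProductSpace ℝ E] {N : ℕ∞} {M : Net Sg L H D q E}
    (hM : ∀ c v w, v.InRange N → w.InRange N → M.val c v w = M₀.val c v w)
    (hb : M.b = M₀.b) (ha : M.act = M₀.act) (x : Input Sg) :
    (M.toTransformer N).MatchesOn ε f x := by
  intro op oc hlen hobj i ω hω
  rw [← hf]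
  have key := Net.eval_eq ε (N := N) (N' := ⊤) M M₀ op oc 0 0
    (fun v => (v.shift op oc).InRange N) ?_
    (fun _ _ => trivial) (fun l s => by rw [hb]) (fun l s => by rw [ha]) x (fun i => ?_)
    (fun i => Input.token_inRange hobj i) i ω hω
  · have h0 : ω.shift 0 = ω := by cases ω <;> rfl
    rwa [h0] at key
  · intro c v w hv hw
    rw [hM _ _ _ hv hw, hβ.shift _ _ _ _ _ (Src.inRange_top _) (Src.inRange_top _), Src.shift_zero,
      Src.shift_zero]
  · refine lt_of_lt_of_le ?_ hlen
    have := i.2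
    exact_mod_cast (by omega : (i : ℕ) + op < x.len + op)

end

section

variable {Sg : Type*} [Fintype Sg] {L H D q : ℕ} {β : Products Sg L H D} {Δ P : ℕ}

variable (Sg L H Δ) in
/-- A bound for the penalty `zeta` of local product functions bounded by `a`. -/
noncomputable def zetaBound (a : ℝ) : ℝ :=
  (∑ _l : Fin L, ∑ _h : Fin H, ∑ _S₁ : Route L H, ∑ _S₂ : Route L H,
    ((Δ + 1) * a ^ 2 + (Fintype.card (Option Sg) + (Δ + 1)) * a ^ 2 + (Δ + 1) * a ^ 2 +
      (Δ + 1) * a ^ 2)) +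
  ∑ _S : Route L H, ((Fintype.card (Option Sg) + (Δ + 1)) * a ^ 2 + (Δ + 1) * a ^ 2)

/-- By locality at most `Δ + 1` indices contribute to each sum, whatever `n` is. -/
theorem zeta_le_of_val {d n : ℕ} (hn : 1 ≤ n) (M : Net Sg L H D q (EuclideanSpace ℝ (Fin d)))
    (hβ : β.Regular ⊤ Δ P) (hM : ∀ c v w, v.InRange n → w.InRange n → M.val c v w = β c v w)
    {a : ℝ} (ha : ∀ c v w, |β c v w| ≤ a) :
    zeta ⟨d, M.toTransformer n⟩ n ≤ zetaBound Sg L H Δ a := by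
  have hsq : ∀ c v w, β c v w ^ 2 ≤ a ^ 2 := fun c v w => by
    rw [← sq_abs]; exact pow_le_pow_left₀ (abs_nonneg _) (ha c v w) 2
  have hfar : ∀ c v w, v.Far Δ w → β c v w = 0 :=
    fun c v w => hβ.far c v w (Src.inRange_top _) (Src.inRange_top _)
  have h0 : ((0 : ℕ) : ℕ∞) < n := by exact_mod_cast hn
  have hr : ∀ {s : Finset ℕ}, s ⊆ Finset.range n → ∀ j ∈ s, ((j : ℕ) : ℕ∞) < n := by
    intro s hs j hj
    exact_mod_cast Finset.mem_range.1 (hs hj)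
  have hIco : Finset.Ico 1 n ⊆ Finset.range n := by
    intro j hj
    simp only [Finset.mem_Ico] at hj
    simpa using hj.2
  have hvoc : ∀ ω : Vocab Sg n, (tokenOf ω).InVocab n := by
    rintro ((_ | σ) | k)
    · trivial
    · trivial
    · exact Nat.cast_lt.2 k.2
  have f1 : ∀ j : ℕ, Δ < j → (Δ : ℤ) < |((0 : ℕ) : ℤ) - j| := fun j hj => by
    have : (Δ : ℤ) < j := by exact_mod_cast hj
    simpa using this
  have f2 : ∀ j : ℕ, Δ < j → (Δ : ℤ) < |(j : ℤ) - (0 : ℕ)| := fun j hj => by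
    have : (Δ : ℤ) < j := by exact_mod_cast hj
    simpa using this
  have key : ∀ c v w, v.InRange n → w.InRange n → M.val c v w ^ 2 ≤ a ^ 2 := fun c v w hv hw => by
    rw [hM _ _ _ hv hw]; exact hsq _ _ _
  have key0 : ∀ c v w, v.InRange n → w.InRange n → v.Far Δ w → M.val c v w ^ 2 = 0 :=
    fun c v w hv hw hvw => by rw [hM _ _ _ hv hw, hfar _ _ _ hvw]; simp
  rw [zeta, zetaBound]
  refine add_le_add ?_ ?_
  · refine Finset.sum_le_sum fun l _ => Finset.sum_le_sum fun h _ => Finset.sum_le_sum fun S₁ _ =>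
      Finset.sum_le_sum fun S₂ _ => add_le_add (add_le_add (add_le_add ?_ ?_) ?_) ?_
    · simp only [Net.attnProd_eq]
      refine sum_le_of_eq_zero_of_lt _ _ (sq_nonneg _) (fun j hj => ?_) fun j hj hjΔ => ?_
      · exact key (.attn l h S₁ S₂) (.pos 0) (.pos j) h0 (hr (Finset.Subset.refl _) j hj)
      · exact key0 (.attn l h S₁ S₂) (.pos 0) (.pos j) h0 (hr (Finset.Subset.refl _) j hj) (f1 j hjΔ)
    · simp only [Net.attnProd_eq]
      refine sum_vocab_le (fun ω => M.val (.attn l h S₁ S₂) (.tok (.obj 0)) (.tok ω) ^ 2)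
        (sq_nonneg _) (fun ω => ?_) fun j hj hjΔ => ?_
      · exact key (.attn l h S₁ S₂) (.tok (.obj 0)) (.tok (tokenOf ω)) h0 (hvoc ω)
      · exact key0 (.attn l h S₁ S₂) (.tok (.obj 0)) (.tok (.obj j)) h0 (Nat.cast_lt.2 hj)
          (f1 j hjΔ)
    · simp only [Net.attnProd_eq]
      refine sum_le_of_eq_zero_of_lt _ _ (sq_nonneg _) (fun j hj => ?_) fun j hj hjΔ => ?_
      · exact key (.attn l h S₁ S₂) (.pos j) (.pos 0) (hr hIco j hj) h0
      · exact key0 (.attn l h S₁ S₂) (.pos j) (.pos 0) (hr hIco j hj) h0 (f2 j hjΔ)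
    · simp only [Net.attnProd_eq]
      refine sum_le_of_eq_zero_of_lt _ _ (sq_nonneg _) (fun j hj => ?_) fun j hj hjΔ => ?_
      · exact key (.attn l h S₁ S₂) (.tok (.obj j)) (.tok (.obj 0)) (hr hIco j hj) h0
      · exact key0 (.attn l h S₁ S₂) (.tok (.obj j)) (.tok (.obj 0)) (hr hIco j hj) h0 (f2 j hjΔ)
  · refine Finset.sum_le_sum fun S _ => add_le_add ?_ ?_
    · simp only [Net.unembedProd_eq]
      refine sum_vocab_le (fun ω => M.val (.unembed S) (.tok (.obj 0)) (.tok ω) ^ 2)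
        (sq_nonneg _) (fun ω => ?_) fun j hj hjΔ => ?_
      · exact key (.unembed S) (.tok (.obj 0)) (.tok (tokenOf ω)) h0 (hvoc ω)
      · exact key0 (.unembed S) (.tok (.obj 0)) (.tok (.obj j)) h0 (Nat.cast_lt.2 hj) (f1 j hjΔ)
    · simp only [Net.unembedProd_eq]
      refine sum_le_of_eq_zero_of_lt _ _ (sq_nonneg _) (fun j hj => ?_) fun j hj hjΔ => ?_
      · exact key (.unembed S) (.tok (.obj j)) (.tok (.obj 0)) (hr hIco j hj) h0
      · exact key0 (.unembed S) (.tok (.obj j)) (.tok (.obj 0)) (hr hIco j hj) h0 (f2 j hjΔ)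

/-- The orthonormal family of coordinate vectors, indexed through an equivalence. -/
noncomputable def coordFamily {ι : Type*} {d : ℕ} (φ : ι ≃ Fin d) (i : ι) :
    EuclideanSpace ℝ (Fin d) :=
  EuclideanSpace.single (φ i) 1

theorem orthonormal_coordFamily {ι : Type*} {d : ℕ} (φ : ι ≃ Fin d) :
    Orthonormal ℝ (coordFamily φ) :=
  EuclideanSpace.orthonormal_single.comp φ φ.injective

theorem IsDyadicComb.dyadic_apply {ι : Type*} {d : ℕ} {φ : ι ≃ Fin d}
    {x : EuclideanSpace ℝ (Fin d)} (h : IsDyadicComb (coordFamily φ) P x) (i : Fin d) :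
    Dyadic P (x i) := by
  classical
  obtain ⟨s, c, hc, rfl⟩ := h
  have : (∑ j ∈ s, c j • coordFamily φ j) i = if φ.symm i ∈ s then c (φ.symm i) else 0 := by
    simp only [coordFamily, WithLp.ofLp_sum, Finset.sum_apply, PiLp.smul_apply,
      PiLp.single_apply, smul_eq_mul, mul_ite, mul_one, mul_zero]
    simp only [← Equiv.symm_apply_eq, Finset.sum_ite_eq]
  rw [this]
  split_ifs
  · exact hc _
  · exact Dyadic.zero P

variable {ι : Type*} {d n : ℕ} {φ : ι ≃ Fin d} {M : Net Sg L H D q (EuclideanSpace ℝ (Fin d))}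
  {C : ℝ}

theorem Net.IsExplicit.hasPrecision (hM : M.IsExplicit n (coordFamily φ) P C)
    (hb : ∀ l s, Dyadic P (M.b l s)) : HasPrecision ⟨d, M.toTransformer n⟩ P := by
  have hs : ∀ j : Fin d, EuclideanSpace.single j (1 : ℝ) = coordFamily φ (φ.symm j) := by
    intro j; simp [coordFamily]
  constructor
  · exact fun t _ i => (hM.comb_pos t).dyadic_apply i
  · exact fun ω _ i => (hM.comb_emb ω).dyadic_apply i
  · exact fun ω _ i => (hM.comb_U ω).dyadic_apply i
  · intro l h i j
    change Dyadic P (M.K l h _ i)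
    rw [hM.K_eq, hs]
    exact (IsDyadicComb.single _).dyadic_apply i
  · intro l h i j
    change Dyadic P (M.Q l h _ i)
    rw [hs]
    exact (hM.comb_Q l h _).dyadic_apply i
  · intro l h i j
    change Dyadic P (M.V l h _ i)
    rw [hs]
    exact (hM.comb_V l h _).dyadic_apply i
  · intro l s j
    change Dyadic P (M.A l _ s)
    rw [hs]
    exact hM.dyadic_A l s _
  · intro l i s
    change Dyadic P (M.B l _ i)
    obtain ⟨j, hj⟩ := hM.B_single l s
    rw [hj]
    exact (IsDyadicComb.single _).dyadic_apply i
  · exact hb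

theorem Net.IsExplicit.regularizer_le (hM : M.IsExplicit n (coordFamily φ) P C)
    (hb : ∀ l s, Dyadic P (M.b l s)) {Z : ℝ} (hZ : zeta ⟨d, M.toTransformer n⟩ n ≤ Z) :
    regularizer n ⟨d, M.toTransformer n⟩ ≤
      (L + H) + (P + q) + (C + C + C + √D + C) + (C + C + ⨆ l, ‖M.b l‖) + Z := by
  have hC : 0 ≤ C := (hM.unembed n le_rfl).1
  have hφ : ∀ g : Fin d → ℝ, ∑ j, g j = ∑ i ∈ Finset.univ.map φ.symm.toEmbedding, g (φ i) := by
    intro g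
    rw [Finset.sum_map]
    simp
  have hA : ∀ l, FiniteTransformer.frobenius (M.A l) ≤ C := by
    intro l
    have h1 := hM.sum_A l (Finset.univ.map φ.symm.toEmbedding)
    rw [FiniteTransformer.frobenius]
    refine (Real.sqrt_le_sqrt (y := C ^ 2) ?_).trans (by rw [Real.sqrt_sq hC])
    simp only [hφ]
    exact h1
  -- Each of the `D` columns is a unit vector.
  have hB : ∀ l, FiniteTransformer.frobenius (M.B l) ≤ √D := by
    intro l
    rw [FiniteTransformer.frobenius]
    refine Real.sqrt_le_sqrt ?_
    rw [Finset.sum_comm]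
    have : ∀ s : Fin D, ∑ i, M.B l (EuclideanSpace.single s 1) i ^ 2 = 1 := by
      intro s
      obtain ⟨j, hj⟩ := hM.B_single l s
      rw [hj]
      have h1 := EuclideanSpace.norm_sq_eq (coordFamily φ j)
      rw [(orthonormal_coordFamily φ).1] at h1
      simpa using h1.symm
    simp [this]
  have hprec : (precision ⟨d, M.toTransformer n⟩ : ℝ) ≤ P := by
    exact_mod_cast Nat.sInf_le (hM.hasPrecision hb)
  have hU : unembedNorm ⟨d, M.toTransformer n⟩ n ≤ C :=
    csInf_le ⟨0, fun x hx => hx.1⟩ (hM.unembed n le_rfl)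
  rw [regularizer]
  refine add_le_add (add_le_add (add_le_add (add_le_add le_rfl (add_le_add hprec le_rfl)) ?_) ?_) hZ
  · refine add_le_add (add_le_add (add_le_add (add_le_add ?_ ?_) ?_) ?_) hU
    · refine Real.iSup_le (fun l => Real.iSup_le (fun h => ?_) hC) hC
      have : (M.toTransformer n).K l h = ContinuousLinearMap.id ℝ _ := hM.K_eq l h
      rw [this]
      have h2 : ContinuousLinearMap.adjoint (ContinuousLinearMap.id ℝ (EuclideanSpace ℝ (Fin d))) =
          ContinuousLinearMap.id ℝ _ := ContinuousLinearMap.adjoint_id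
      rw [h2]
      exact hM.norm_Q l h
    · exact Real.iSup_le (fun l => Real.iSup_le (fun h => hM.norm_V l h) hC) hC
    · exact Real.iSup_le hA hC
    · exact Real.iSup_le hB (Real.sqrt_nonneg _)
  · refine add_le_add (add_le_add ?_ ?_) le_rfl
    · exact Real.iSup_le (fun t => hM.norm_pos t) hC
    · exact Real.iSup_le (fun t => hM.norm_emb _) hC

/-- A function expressed by a symbolic limit transformer is computed at every context width by a
transformer of bounded complexity. -/
theorem exists_fitting_le {E₀ : Type*} [NormedAddCommGroup E₀] [InnerProductSpace ℝ E₀] (ε : ℝ)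
    (f : LogitMap Sg) (M₀ : Net Sg L H D q E₀) (hβ : M₀.val.Regular ⊤ Δ P)
    (hb : ∀ l s, Dyadic P (M₀.b l s))
    (hf : ∀ x i ω, (M₀.toTransformer ⊤).eval ε x 0 0 i ω = f x i ω) :
    ∃ C : ℝ, ∀ n : ℕ, 1 ≤ n → ∃ F ∈ fitting ε f n, regularizer n F ≤ C := by
  classical
  obtain ⟨C, hC⟩ := exists_explicit hβ q M₀.b M₀.act
  obtain ⟨a, -, ha⟩ := hβ.exists_bound
  refine ⟨(L + H) + (P + q) + (C + C + C + √D + C) + (C + C + ⨆ l, ‖M₀.b l‖) +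
    zetaBound Sg L H Δ a, fun n hn => ?_⟩
  have : Finite {t : ℕ // ((t : ℕ) : ℕ∞) < n} := by
    have : {t : ℕ | ((t : ℕ) : ℕ∞) < n}.Finite := by
      refine (Set.finite_Iio n).subset fun t ht => ?_
      simpa using ht
    exact this.to_subtype
  -- At finite width there are finitely many nodes, so coordinate vectors serve as the orthonormal
  -- family and dyadic combinations become vectors with dyadic entries.
  let φ := Finite.equivFin (Node Sg L D n × Route L H)
  obtain ⟨M, hM, hMb, hMa, hval⟩ := hC n _ (coordFamily φ) (orthonormal_coordFamily φ)
  have hb' : ∀ l s, Dyadic P (M.b l s) := by rw [hMb]; exact hb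
  refine ⟨⟨_, M.toTransformer n⟩, ⟨⟨rfl, ⟨P, hM.hasPrecision hb'⟩,
    Net.translationInvariant_of_val hβ hval⟩, fun x _ => matchesOn_of_val hβ hf hval hMb hMa x⟩, ?_⟩
  refine (hM.regularizer_le hb' (zeta_le_of_val hn M hβ hval ha)).trans ?_
  rw [hMb]

end

end LengthGen

namespace LengthGen

open Transformer FiniteTransformer

/-! ## From a transformer to its product functions -/

section

variable {Sg : Type*} {D : ℕ} {E : Type*} [NormedAddCommGroup E] [InnerProductSpace ℝ E]

/-- The parameters of a transformer, where only the hidden units in the range of `g` are kept. -/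
noncomputable def Transformer.toNet (T : Transformer Sg E) (g : Fin D → Fin T.dff) :
    Net Sg T.L T.H D T.attPrec E where
  pos := T.pos
  emb := T.emb
  K := T.K
  Q := T.Q
  V := T.V
  A := fun l => (((EuclideanSpace.equiv (Fin D) ℝ).symm :
    (Fin D → ℝ) →L[ℝ] EuclideanSpace ℝ (Fin D)).comp
      (ContinuousLinearMap.pi fun s => EuclideanSpace.proj (g s))).comp (T.A l)
  B := fun l => ∑ s, (EuclideanSpace.proj (𝕜 := ℝ) s : EuclideanSpace ℝ (Fin D) →L[ℝ] ℝ).smulRight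
    (T.B l (EuclideanSpace.single (g s) 1))
  b := fun l => WithLp.toLp 2 fun s => T.b l (g s)
  act := fun l s => T.act l (g s)
  U := T.U

/-- The label in a transformer of which only the hidden units in the range of `g` are kept. -/
def Src.toSource (T : Transformer Sg E) (g : Fin D → Fin T.dff) : Src Sg T.L D → T.Source
  | .pos t => .pos t
  | .tok ω => .tok ω
  | .hid l s => .hid l (g s)

theorem Src.toSource_shift (T : Transformer Sg E) (g : Fin D → Fin T.dff) (v : Src Sg T.L D)
    (dp dc : ℕ) : (v.shift dp dc).toSource T g = (v.toSource T g).shift dp dc := by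
  cases v <;> rfl

theorem Src.toSource_inRange {T : Transformer Sg E} {g : Fin D → Fin T.dff} {v : Src Sg T.L D}
    (h : v.InRange T.N) : (v.toSource T g).InRange := by
  cases v <;> exact h

/-- The label is not an object. -/
def Transformer.Source.NotObj {T : Transformer Sg E} : T.Source → Prop
  | .tok (.obj _) => False
  | _ => True

theorem Src.toSource_notObj {T : Transformer Sg E} {g : Fin D → Fin T.dff} {v : Src Sg T.L D}
    (h : v.NotObj) : (v.toSource T g).NotObj := by
  rcases v with t | (_ | σ | k) | ⟨l, s⟩ <;> trivial

variable (T : Transformer Sg E) (g : Fin D → Fin T.dff)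

theorem Transformer.toNet_B (l : Fin T.L) (ψ : EuclideanSpace ℝ (Fin D)) :
    (T.toNet g).B l ψ = ∑ s, ψ s • T.B l (EuclideanSpace.single (g s) 1) := by
  simp [toNet]

theorem Transformer.toNet_vec (v : Src Sg T.L D) :
    (T.toNet g).vec v = T.vec (v.toSource T g) := by
  rcases v with t | ω | ⟨l, s⟩
  · rfl
  · rfl
  · simp [Net.vec, toNet_B, vec, Src.toSource]

theorem Transformer.toNet_prod (S : Route T.L T.H) : (T.toNet g).prod S = T.pathProd S := by
  refine foldl_finRange_rel _ _ (fun _ A B => A = B) _ _ rfl ?_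
  rintro l A B rfl
  rcases hS : S l with _ | h
  · rfl
  · rfl

theorem Transformer.toNet_val_attn (l : Fin T.L) (h : Fin T.H) (S₁ S₂ : Route T.L T.H)
    (v w : Src Sg T.L D) : (T.toNet g).val (.attn l h S₁ S₂) v w =
      T.attnProd l h S₁ S₂ (v.toSource T g) (w.toSource T g) := by
  rw [Net.val, toNet_vec, toNet_vec, toNet_prod, toNet_prod]
  rfl

theorem Transformer.toNet_val_unembed (S : Route T.L T.H) (ω : Token Sg) (w : Src Sg T.L D) :
    (T.toNet g).val (.unembed S) (.tok ω) w = T.unembedProd S ω (w.toSource T g) := by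
  rw [Net.val, toNet_vec, toNet_prod]
  rfl

theorem Transformer.toNet_val_mlp (S : Route T.L T.H) (l : Fin T.L) (s : Fin D)
    (w : Src Sg T.L D) :
    (T.toNet g).val (.mlp S l s) (.tok .start) w = T.mlpProd S l (g s) (w.toSource T g) := by
  rw [Net.val, toNet_vec, toNet_prod]
  rfl

variable {T g}

/-- The units left out have zero columns in every `B_l`, so they feed nothing back into the residual
stream. -/
theorem Transformer.toNet_mlp (ε : ℝ) (N : ℕ∞) (hg : Function.Injective g)
    (hB : ∀ l s, s ∉ Set.range g → T.B l (EuclideanSpace.single s 1) = 0) (l : Fin T.L) (z : E) :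
    ((T.toNet g).toTransformer N).mlp ε l z = T.mlp ε l z := by
  rw [mlp, mlp]
  congr 1
  refine (toNet_B T g l _).trans ?_
  have e : ∀ ψ : Fin T.dff → ℝ, WithLp.toLp 2 ψ = ∑ s, ψ s • EuclideanSpace.single s (1 : ℝ) := by
    intro ψ
    ext i
    simp [Finset.sum_apply, Pi.single_apply]
  rw [e, map_sum]
  refine Finset.sum_of_injOn g hg.injOn (fun _ _ => Finset.mem_coe.2 (Finset.mem_univ _)) ?_ ?_
  · intro s _ hs
    rw [map_smul, hB l s (by simpa using hs), smul_zero]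
  · intro s _
    rw [map_smul]
    rfl

theorem Transformer.toNet_eval (ε : ℝ) (N : ℕ∞) (hg : Function.Injective g)
    (hB : ∀ l s, s ∉ Set.range g → T.B l (EuclideanSpace.single s 1) = 0) (x : Input Sg)
    (op oc : ℕ) (i : Fin x.len) (ω : Token Sg) :
    ((T.toNet g).toTransformer N).eval ε x op oc i ω = T.eval ε x op oc i ω := by
  have h : ((T.toNet g).toTransformer N).final ε x op oc = T.final ε x op oc := by
    refine foldl_finRange_rel (fun y l => ((T.toNet g).toTransformer N).layer ε l y)
      (fun y l => T.layer ε l y) (fun _ A B => A = B) _ _ rfl ?_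
    rintro l y y' rfl
    funext i
    exact toNet_mlp ε N hg hB l _
  rw [eval, eval, h]
  rfl

/-- The vanishing `h4` enters as a hypothesis because it stems from the bound on `U`: in a symbolic
limit by letting the width grow, in a finite transformer by precision at large width. -/
theorem Transformer.toNet_regular {Δ P : ℕ} (hT : T.TranslationInvariant) (hΔ : T.Local Δ)
    (h1 : ∀ l h S₁ S₂ v w, v.InRange → w.InRange → Dyadic P (T.attnProd l h S₁ S₂ v w))
    (h2 : ∀ S ω w, ω.InVocab T.N → w.InRange → Dyadic P (T.unembedProd S ω w))
    (h3 : ∀ S l s w, w.InRange → Dyadic P (T.mlpProd S l s w))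
    (h4 : ∀ S (k : ℕ) w, (k : ℕ∞) < T.N → w.InRange → w.NotObj →
      T.unembedProd S (.obj k) w = 0) :
    (T.toNet g).val.Regular T.N Δ P := by
  constructor
  · intro c v w dp dc hv hw
    by_cases hc : c.Admits v
    · rcases c with ⟨l, h, S₁, S₂⟩ | S | ⟨S, l, s⟩
      · simp only [toNet_val_attn, Src.toSource_shift]
        refine hT.attn _ _ _ _ _ _ _ _ ?_ ?_ <;> rw [← Src.toSource_shift] <;>
          apply Src.toSource_inRange <;> assumption
      · rcases v with t | ω | _
        · exact hc.elim
        · rw [toNet_val_unembed]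
          refine (toNet_val_unembed T g S _ _).trans ?_
          rw [Src.toSource_shift]
          refine hT.unembed S ω _ dp dc hv ?_
          rw [← Src.toSource_shift]
          exact Src.toSource_inRange hw
        · exact hc.elim
      · rcases v with t | (_ | σ | k) | ⟨l, s⟩
        · exact hc.elim
        · rw [toNet_val_mlp]
          refine (toNet_val_mlp T g S l s _).trans ?_
          rw [Src.toSource_shift]
          refine hT.mlp S l _ _ dp dc ?_
          rw [← Src.toSource_shift]
          exact Src.toSource_inRange hw
        all_goals exact hc.elim
    · rw [Net.val_eq_zero _ _ _ _ hc, Net.val_eq_zero]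
      rcases c with ⟨l, h, S₁, S₂⟩ | S | ⟨S, l, s⟩ <;> rcases v with t | (_ | σ | k) | ⟨l, s⟩ <;>
        exact hc
  · intro c v w hv hw hvw
    rcases v with t | (_ | σ | k) | ⟨l, s⟩ <;> rcases w with t' | (_ | σ' | k') | ⟨l', s'⟩ <;>
      try exact hvw.elim
    · rcases c with ⟨l, h, S₁, S₂⟩ | S | ⟨S, l, s⟩
      · rw [toNet_val_attn]
        exact hΔ.attn_pos _ _ _ _ _ _ hv hw hvw
      · rfl
      · rfl
    · rcases c with ⟨l, h, S₁, S₂⟩ | S | ⟨S, l, s⟩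
      · rw [toNet_val_attn]
        exact hΔ.attn_obj _ _ _ _ _ _ hv hw hvw
      · rw [toNet_val_unembed]
        exact hΔ.unembed_obj _ _ _ hv hw hvw
      · rfl
  · intro c v w hv hw
    by_cases hc : c.Admits v
    · rcases c with ⟨l, h, S₁, S₂⟩ | S | ⟨S, l, s⟩
      · rw [toNet_val_attn]
        exact h1 _ _ _ _ _ _ (Src.toSource_inRange hv) (Src.toSource_inRange hw)
      · rcases v with t | ω | _
        · exact hc.elim
        · rw [toNet_val_unembed]
          exact h2 _ _ _ hv (Src.toSource_inRange hw)
        · exact hc.elim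
      · rcases v with t | (_ | σ | k) | ⟨l, s⟩
        · exact hc.elim
        · rw [toNet_val_mlp]
          exact h3 _ _ _ _ (Src.toSource_inRange hw)
        all_goals exact hc.elim
    · rw [Net.val_eq_zero _ _ _ _ hc]
      exact Dyadic.zero P
  · intro S k w hk hw hwo
    rw [toNet_val_unembed]
    exact h4 _ _ _ hk (Src.toSource_inRange hw) (Src.toSource_notObj hwo)
  · exact fun c v w => Net.val_eq_zero _ c v w

/-- Products of the rows `U_{c_k}` with a vector that is not an object are small, as they do not
depend on `k`. -/
theorem unembedProd_obj_sq_le [Fintype Sg] (hT : T.TranslationInvariant) {n : ℕ} {C : ℝ}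
    (hU : T.UnembedBound n C) (hn : (n : ℕ∞) ≤ T.N) (S : T.Path) {k : ℕ} (hk : (k : ℕ∞) < T.N)
    {w : T.Source} (hw : w.InRange) (hwo : w.NotObj) :
    n * T.unembedProd S (.obj k) w ^ 2 ≤ (C * ‖T.pathProd S (T.vec w)‖) ^ 2 := by
  have hshift : ∀ j, w.shift 0 j = w := by
    intro j
    rcases w with t | (_ | σ | k) | ⟨l, s⟩ <;> first | rfl | exact hwo.elim
  have hconst : ∀ j : ℕ, (j : ℕ∞) < T.N →
      T.unembedProd S (.obj j) w = T.unembedProd S (.obj 0) w := by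
    intro j hj
    have := hT.unembed S (.obj 0) w 0 j (by simpa [Token.shift, Token.InVocab] using hj)
      (by rw [hshift]; exact hw)
    rw [hshift] at this
    simpa [Token.shift] using this
  have h1 := hU.2 (T.pathProd S (T.vec w))
  rw [Real.sqrt_le_iff] at h1
  refine le_trans ?_ h1.2
  rw [Fintype.sum_sum_type]
  refine le_trans ?_ (le_add_of_nonneg_left (Finset.sum_nonneg fun _ _ => sq_nonneg _))
  have h2 : ∀ j : Fin n, inner ℝ (T.U (tokenOf (.inr j))) (T.pathProd S (T.vec w)) ^ 2 =
      T.unembedProd S (.obj k) w ^ 2 := by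
    intro j
    rw [hconst k hk, ← hconst j (lt_of_lt_of_le (Nat.cast_lt.2 j.2) hn)]
    rfl
  simp [h2]

/-- What is not part of the definition is the vanishing of the products of `U_{c_k}` with
non-objects: `n` times the square of such a product is bounded by a constant for all `n`. -/
theorem Transformer.IsSymbolicLimit.toNet_regular [Fintype Sg] (hT : T.IsSymbolicLimit) :
    ∃ Δ P, (T.toNet id).val.Regular ⊤ Δ P ∧ ∀ l s, Dyadic P ((T.toNet id).b l s) := by
  obtain ⟨Δ, hΔ⟩ := hT.isLocal
  obtain ⟨P, h1, h2, h3, h4⟩ := hT.precision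
  obtain ⟨C, hC⟩ := hT.bounded_unembed
  refine ⟨Δ, P, ?_, h4⟩
  have := Transformer.toNet_regular (g := id) hT.translationInvariant hΔ
    (fun l h S₁ S₂ v w _ _ => h1 l h S₁ S₂ v w) (fun S ω w _ _ => h2 S ω w)
    (fun S l s w _ => h3 S l s w) ?_
  · rwa [hT.N_eq] at this
  · intro S k w hk hw hwo
    by_contra hne
    have hpos : 0 < T.unembedProd S (.obj k) w ^ 2 := by positivity
    obtain ⟨n, hn⟩ := exists_nat_gt
      ((C * ‖T.pathProd S (T.vec w)‖) ^ 2 / T.unembedProd S (.obj k) w ^ 2)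
    rw [div_lt_iff₀ hpos] at hn
    exact absurd (unembedProd_obj_sq_le hT.translationInvariant (hC n)
      (by rw [hT.N_eq]; exact le_top) S hk hw hwo) (not_le.2 hn)

end

/-- A function expressed by a symbolic limit transformer is matched by transformers of bounded
complexity at all context widths. -/
theorem exists_fitting_le_of_expressible {Sg : Type*} [Fintype Sg] {ε : ℝ} {f : LogitMap Sg}
    (hf : ExpressibleBySymbolicLimit ε f) :
    ∃ C : ℝ, ∀ n : ℕ, 1 ≤ n → ∃ F ∈ fitting ε f n, regularizer n F ≤ C := by
  obtain ⟨E, _, _, _, T, hT, hev⟩ := hf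
  obtain ⟨Δ, P, hreg, hb⟩ := hT.toNet_regular
  refine exists_fitting_le ε f (T.toNet id) hreg hb fun x i ω => ?_
  rw [← hev]
  exact toNet_eval ε ⊤ Function.injective_id (fun l s hs => (hs ⟨s, rfl⟩).elim) x 0 0 i ω

end LengthGen

namespace LengthGen

open Transformer FiniteTransformer

/-! ## Precision and size of the product functions of a finite transformer -/

section Dyadic

variable {p p' : ℕ} {x y : ℝ}

theorem Dyadic.mono (h : p ≤ p') (hx : Dyadic p x) : Dyadic p' x := by
  obtain ⟨m, rfl⟩ := hx
  refine ⟨m * 2 ^ (p' - p), ?_⟩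
  rw [div_eq_div_iff (by positivity) (by positivity)]
  push_cast
  rw [mul_assoc, ← pow_add, Nat.sub_add_cancel h]

theorem Dyadic.mul (hx : Dyadic p x) (hy : Dyadic p' y) : Dyadic (p + p') (x * y) := by
  obtain ⟨m, rfl⟩ := hx
  obtain ⟨n, rfl⟩ := hy
  exact ⟨m * n, by push_cast; rw [pow_add, div_mul_div_comm]⟩

theorem Dyadic.sum {ι : Type*} {s : Finset ι} {f : ι → ℝ} (h : ∀ i ∈ s, Dyadic p (f i)) :
    Dyadic p (∑ i ∈ s, f i) :=
  Finset.sum_induction f (Dyadic p) (fun _ _ => Dyadic.add) (Dyadic.zero p) h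

/-- The numerator is a nonzero integer. This gap makes small contributions vanish: far products in
`ζ`, unembedding products, and columns of `B_l`. -/
theorem Dyadic.le_sq (hx : Dyadic p x) (h0 : x ≠ 0) : 1 / 4 ^ p ≤ x ^ 2 := by
  obtain ⟨m, rfl⟩ := hx
  have hm : m ≠ 0 := by rintro rfl; simp at h0
  have h1 : (1 : ℝ) ≤ (m : ℝ) ^ 2 := by
    have : 1 ≤ m ^ 2 := by have := sq_pos_of_ne_zero hm; omega
    exact_mod_cast this
  rw [div_pow, ← pow_mul, mul_comm p 2, pow_mul]
  norm_num
  rw [le_div_iff₀ (by positivity), inv_mul_cancel₀ (by positivity)]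
  exact h1

theorem finite_dyadic_abs_le (p : ℕ) (a : ℝ) : {x : ℝ | Dyadic p x ∧ |x| ≤ a}.Finite := by
  have h : ((fun m : ℤ => (m : ℝ) / 2 ^ p) '' Set.Icc (-⌈a * 2 ^ p⌉) ⌈a * 2 ^ p⌉).Finite :=
    (Set.finite_Icc _ _).image _
  refine h.subset ?_
  rintro x ⟨⟨m, rfl⟩, hm⟩
  refine ⟨m, ?_, rfl⟩
  rw [abs_div, abs_of_pos (show (0 : ℝ) < 2 ^ p by positivity), div_le_iff₀ (by positivity)] at hm
  have h1 : |(m : ℝ)| ≤ (⌈a * 2 ^ p⌉ : ℤ) := hm.trans (Int.le_ceil _)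
  have h2 : |m| ≤ ⌈a * 2 ^ p⌉ := by exact_mod_cast h1
  exact abs_le.1 h2

end Dyadic

section Euclidean

variable {a b : ℕ} (M : EuclideanSpace ℝ (Fin a) →L[ℝ] EuclideanSpace ℝ (Fin b))

theorem clm_apply_eq_sum (x : EuclideanSpace ℝ (Fin a)) (i : Fin b) :
    M x i = ∑ j, x j * M (EuclideanSpace.single j 1) i := by
  have e : x = ∑ j, x j • EuclideanSpace.single j (1 : ℝ) := by
    ext i
    simp [Finset.sum_apply, Pi.single_apply]
  conv_lhs => rw [e, map_sum]
  simp

theorem Dyadic.clm_apply {M : EuclideanSpace ℝ (Fin a) →L[ℝ] EuclideanSpace ℝ (Fin b)} {p p' : ℕ}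
    (hM : ∀ i j, Dyadic p (M (EuclideanSpace.single j 1) i)) {x : EuclideanSpace ℝ (Fin a)}
    (hx : ∀ j, Dyadic p' (x j)) (i : Fin b) : Dyadic (p' + p) (M x i) := by
  rw [clm_apply_eq_sum]
  exact Dyadic.sum fun j _ => (hx j).mul (hM i j)

theorem Dyadic.inner {x y : EuclideanSpace ℝ (Fin a)} {p p' : ℕ} (hx : ∀ j, Dyadic p (x j))
    (hy : ∀ j, Dyadic p' (y j)) : Dyadic (p + p') (Inner.inner ℝ x y) := by
  rw [PiLp.inner_apply]
  refine Dyadic.sum fun j _ => ?_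
  have := (hx j).mul (hy j)
  simpa [mul_comm] using this

theorem frobenius_nonneg : 0 ≤ FiniteTransformer.frobenius M := Real.sqrt_nonneg _

theorem sq_frobenius :
    FiniteTransformer.frobenius M ^ 2 = ∑ i, ∑ j, M (EuclideanSpace.single j 1) i ^ 2 :=
  Real.sq_sqrt (Finset.sum_nonneg fun _ _ => Finset.sum_nonneg fun _ _ => sq_nonneg _)

theorem abs_apply_le_frobenius (x : EuclideanSpace ℝ (Fin a)) (i : Fin b) :
    |M x i| ≤ FiniteTransformer.frobenius M * ‖x‖ := by
  refine abs_le_of_sq_le_sq ?_ (mul_nonneg (frobenius_nonneg M) (norm_nonneg _))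
  rw [clm_apply_eq_sum, mul_pow, sq_frobenius, EuclideanSpace.norm_sq_eq, mul_comm]
  refine (Finset.sum_mul_sq_le_sq_mul_sq _ _ _).trans ?_
  refine mul_le_mul ?_ ?_ (Finset.sum_nonneg fun _ _ => sq_nonneg _)
    (Finset.sum_nonneg fun _ _ => sq_nonneg _)
  · simp
  · exact Finset.single_le_sum (f := fun i => ∑ j, M (EuclideanSpace.single j 1) i ^ 2)
      (fun _ _ => Finset.sum_nonneg fun _ _ => sq_nonneg _) (Finset.mem_univ i)

theorem norm_column_le_frobenius (j : Fin a) :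
    ‖M (EuclideanSpace.single j 1)‖ ≤ FiniteTransformer.frobenius M := by
  refine le_of_sq_le_sq ?_ (frobenius_nonneg M)
  rw [sq_frobenius, EuclideanSpace.norm_sq_eq, Finset.sum_comm]
  simp only [Real.norm_eq_abs, sq_abs]
  exact Finset.single_le_sum (f := fun j => ∑ i, M (EuclideanSpace.single j 1) i ^ 2)
    (fun _ _ => Finset.sum_nonneg fun _ _ => sq_nonneg _) (Finset.mem_univ j)

/-- A nonzero column has a nonzero entry, which contributes at least `1 / 4 ^ p` to the squared
Frobenius norm. -/
theorem card_column_ne_zero_le {M : EuclideanSpace ℝ (Fin a) →L[ℝ] EuclideanSpace ℝ (Fin b)}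
    {p : ℕ} (hM : ∀ i j, Dyadic p (M (EuclideanSpace.single j 1) i)) (s : Finset (Fin a))
    (hs : ∀ j ∈ s, M (EuclideanSpace.single j 1) ≠ 0) :
    (s.card : ℝ) ≤ FiniteTransformer.frobenius M ^ 2 * 4 ^ p := by
  rw [← div_le_iff₀ (by positivity), sq_frobenius, Finset.sum_comm]
  calc (s.card : ℝ) / 4 ^ p = ∑ j ∈ s, 1 / 4 ^ p := by
        rw [Finset.sum_const, nsmul_eq_mul, mul_one_div]
    _ ≤ ∑ j ∈ s, ∑ i, M (EuclideanSpace.single j 1) i ^ 2 := by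
        refine Finset.sum_le_sum fun j hj => ?_
        have : ∃ i, M (EuclideanSpace.single j 1) i ≠ 0 := by
          by_contra! h
          exact hs j hj (by ext i; simpa using h i)
        obtain ⟨i, hi⟩ := this
        exact ((hM i j).le_sq hi).trans (Finset.single_le_sum
          (f := fun i => M (EuclideanSpace.single j 1) i ^ 2) (fun _ _ => sq_nonneg _)
          (Finset.mem_univ i))
    _ ≤ _ := Finset.sum_le_univ_sum_of_nonneg fun _ => Finset.sum_nonneg fun _ _ => sq_nonneg _

end Euclidean

theorem exists_tokenOf {Sg : Type*} {n : ℕ} {ω : Token Sg} (h : ω.InVocab n) :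
    ∃ ω' : Vocab Sg n, tokenOf ω' = ω := by
  rcases ω with _ | σ | k
  · exact ⟨.inl none, rfl⟩
  · exact ⟨.inl (some σ), rfl⟩
  · exact ⟨.inr ⟨k, Nat.cast_lt.1 h⟩, rfl⟩

namespace FiniteTransformer

variable {Sg : Type*} {F : FiniteTransformer Sg}

theorem HasPrecision.dyadic_vec {p : ℕ} (hF : F.HasPrecision p) {w : F.T.Source} (hw : w.InRange)
    (i : Fin F.d) : Dyadic p (F.T.vec w i) := by
  cases w with
  | pos t => exact hF.pos t hw i
  | tok ω => exact hF.emb ω hw i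
  | hid l s => exact hF.B l i s

/-- Every value matrix costs at most `p` further fractional bits, and a skipped layer costs none. -/
theorem HasPrecision.dyadic_pathProd {p p' : ℕ} (hF : F.HasPrecision p) (S : F.T.Path)
    {x : EuclideanSpace ℝ (Fin F.d)} (hx : ∀ i, Dyadic p' (x i)) (i : Fin F.d) :
    Dyadic (p' + F.T.L * p) (F.T.pathProd S x i) := by
  suffices H : (fun (k : ℕ) (A : EuclideanSpace ℝ (Fin F.d) →L[ℝ] EuclideanSpace ℝ (Fin F.d)) =>
      ∀ i, Dyadic (p' + k * p) (A x i)) F.T.L (F.T.pathProd S) from H i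
  refine foldl_finRange_induction _
    (fun (k : ℕ) (A : EuclideanSpace ℝ (Fin F.d) →L[ℝ] EuclideanSpace ℝ (Fin F.d)) =>
      ∀ i, Dyadic (p' + k * p) (A x i)) _ (by simpa using hx) ?_
  intro l A hA i
  rcases hS : S l with _ | h
  · exact (hA i).mono (by rw [Nat.add_mul]; omega)
  · have h1 := Dyadic.clm_apply (hF.V l h) hA i
    rw [Nat.add_mul, one_mul, ← Nat.add_assoc]
    exact h1

/-- The precision of the product functions. -/
theorem HasPrecision.dyadic_attnProd {p P : ℕ} (hF : F.HasPrecision p)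
    (hP : 2 * (p * (F.T.L + 2)) ≤ P) (l : Fin F.T.L) (h : Fin F.T.H) (S₁ S₂ : F.T.Path)
    {v w : F.T.Source} (hv : v.InRange) (hw : w.InRange) :
    Dyadic P (F.T.attnProd l h S₁ S₂ v w) := by
  have h1 := Dyadic.clm_apply (hF.K l h) (hF.dyadic_pathProd S₁ (hF.dyadic_vec hv))
  have h2 := Dyadic.clm_apply (hF.Q l h) (hF.dyadic_pathProd S₂ (hF.dyadic_vec hw))
  exact (Dyadic.inner h1 h2).mono (le_trans (by ring_nf; rfl) hP)

theorem HasPrecision.dyadic_unembedProd {p P : ℕ} (hF : F.HasPrecision p)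
    (hP : 2 * (p * (F.T.L + 2)) ≤ P) (S : F.T.Path) {ω : Token Sg} (hω : ω.InVocab F.T.N)
    {w : F.T.Source} (hw : w.InRange) : Dyadic P (F.T.unembedProd S ω w) := by
  have h2 := hF.dyadic_pathProd S (hF.dyadic_vec hw)
  exact (Dyadic.inner (hF.U ω hω) h2).mono (le_trans (by ring_nf; nlinarith) hP)

theorem HasPrecision.dyadic_mlpProd {p P : ℕ} (hF : F.HasPrecision p)
    (hP : 2 * (p * (F.T.L + 2)) ≤ P) (S : F.T.Path) (l : Fin F.T.L) (s : Fin F.T.dff)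
    {w : F.T.Source} (hw : w.InRange) : Dyadic P (F.T.mlpProd S l s w) := by
  have h2 := hF.dyadic_pathProd S (hF.dyadic_vec hw)
  exact (Dyadic.clm_apply (hF.A l) h2 s).mono (le_trans (by ring_nf; nlinarith) hP)

theorem hasPrecision_precision (h : ∃ p, F.HasPrecision p) : F.HasPrecision F.precision :=
  Nat.sInf_mem (s := {p | F.HasPrecision p}) h

variable [Fintype Sg]

/-- Every summand of the regularizer is at most `C`. -/
structure BoundedBy (F : FiniteTransformer Sg) (n : ℕ) (C : ℝ) : Prop where
  L_le : (F.T.L : ℝ) ≤ C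
  H_le : (F.T.H : ℝ) ≤ C
  precision_le : (F.precision : ℝ) ≤ C
  attPrec_le : (F.T.attPrec : ℝ) ≤ C
  norm_KQ : ∀ l h, ‖(ContinuousLinearMap.adjoint (F.T.K l h)).comp (F.T.Q l h)‖ ≤ C
  norm_V : ∀ l h, ‖F.T.V l h‖ ≤ C
  frobenius_A : ∀ l, FiniteTransformer.frobenius (F.T.A l) ≤ C
  frobenius_B : ∀ l, FiniteTransformer.frobenius (F.T.B l) ≤ C
  unembedNorm_le : F.unembedNorm n ≤ C
  norm_pos : ∀ t < n, ‖F.T.pos t‖ ≤ C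
  norm_emb : ∀ ω : Vocab Sg n, ‖F.T.emb (tokenOf ω)‖ ≤ C
  norm_b : ∀ l, ‖F.T.b l‖ ≤ C

theorem zeta_nonneg (F : FiniteTransformer Sg) (n : ℕ) : 0 ≤ F.zeta n := by
  rw [zeta]
  positivity

theorem unembedNorm_nonneg (F : FiniteTransformer Sg) (n : ℕ) : 0 ≤ F.unembedNorm n :=
  Real.sInf_nonneg fun _ h => h.1

/-- All summands, `ζ` included, are nonnegative, so each is at most the total. -/
theorem boundedBy_of_regularizer_le {n : ℕ} {C : ℝ} (h : regularizer n F ≤ C) :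
    F.BoundedBy n C := by
  rw [regularizer] at h
  have a1 : (0 : ℝ) ≤ F.T.L := Nat.cast_nonneg _
  have a2 : (0 : ℝ) ≤ F.T.H := Nat.cast_nonneg _
  have a3 : (0 : ℝ) ≤ F.precision := Nat.cast_nonneg _
  have a4 : (0 : ℝ) ≤ F.T.attPrec := Nat.cast_nonneg _
  have a5 : 0 ≤ ⨆ l, ⨆ h, ‖(ContinuousLinearMap.adjoint (F.T.K l h)).comp (F.T.Q l h)‖ :=
    Real.iSup_nonneg fun _ => Real.iSup_nonneg fun _ => norm_nonneg _
  have a6 : 0 ≤ ⨆ l, ⨆ h, ‖F.T.V l h‖ :=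
    Real.iSup_nonneg fun _ => Real.iSup_nonneg fun _ => norm_nonneg _
  have a7 : 0 ≤ ⨆ l, FiniteTransformer.frobenius (F.T.A l) :=
    Real.iSup_nonneg fun _ => frobenius_nonneg _
  have a8 : 0 ≤ ⨆ l, FiniteTransformer.frobenius (F.T.B l) :=
    Real.iSup_nonneg fun _ => frobenius_nonneg _
  have a9 := F.unembedNorm_nonneg n
  have a10 : 0 ≤ ⨆ t : Fin n, ‖F.T.pos t‖ := Real.iSup_nonneg fun _ => norm_nonneg _
  have a11 : 0 ≤ ⨆ ω : Vocab Sg n, ‖F.T.emb (tokenOf ω)‖ := Real.iSup_nonneg fun _ => norm_nonneg _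
  have a12 : 0 ≤ ⨆ l, ‖F.T.b l‖ := Real.iSup_nonneg fun _ => norm_nonneg _
  have a13 := F.zeta_nonneg n
  have le1 : ∀ {ι : Type} [Finite ι] (g : ι → ℝ) (i : ι), g i ≤ ⨆ i, g i := fun g i =>
    le_ciSup (Set.finite_range g).bddAbove i
  constructor
  · linarith
  · linarith
  · linarith
  · linarith
  · intro l h
    have := (le1 _ h).trans
      (le1 (fun l => ⨆ h, ‖(ContinuousLinearMap.adjoint (F.T.K l h)).comp (F.T.Q l h)‖) l)
    linarith
  · intro l h
    have := (le1 _ h).trans (le1 (fun l => ⨆ h, ‖F.T.V l h‖) l)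
    linarith
  · intro l
    have := le1 (fun l => FiniteTransformer.frobenius (F.T.A l)) l
    linarith
  · intro l
    have := le1 (fun l => FiniteTransformer.frobenius (F.T.B l)) l
    linarith
  · linarith
  · intro t ht
    have := le1 (fun t : Fin n => ‖F.T.pos t‖) ⟨t, ht⟩
    simp only at this
    linarith
  · intro ω
    have : ‖F.T.emb (tokenOf ω)‖ ≤ ⨆ ω : Vocab Sg n, ‖F.T.emb (tokenOf ω)‖ :=
      le_ciSup (Set.finite_range fun ω : Vocab Sg n => ‖F.T.emb (tokenOf ω)‖).bddAbove ω
    linarith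
  · intro l
    have := le1 (fun l => ‖F.T.b l‖) l
    linarith

theorem regularizer_nonneg (n : ℕ) (F : FiniteTransformer Sg) : 0 ≤ regularizer n F :=
  (Nat.cast_nonneg _).trans (boundedBy_of_regularizer_le le_rfl).L_le

/-- This keeps `unembedNorm` from being an infimum over the empty set, which would be `0` by
default. -/
theorem exists_unembedBound (F : FiniteTransformer Sg) (n : ℕ) :
    ∃ C, F.T.UnembedBound n C := by
  refine ⟨√(∑ ω : Vocab Sg n, ‖F.T.U (tokenOf ω)‖ ^ 2), Real.sqrt_nonneg _, fun v => ?_⟩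
  refine (Real.sqrt_le_sqrt (y := (∑ ω : Vocab Sg n, ‖F.T.U (tokenOf ω)‖ ^ 2) * ‖v‖ ^ 2) ?_).trans
    (by rw [Real.sqrt_mul' _ (sq_nonneg _), Real.sqrt_sq (norm_nonneg _)])
  rw [Finset.sum_mul]
  refine Finset.sum_le_sum fun ω _ => ?_
  rw [← sq_abs, ← mul_pow]
  exact pow_le_pow_left₀ (abs_nonneg _) (abs_real_inner_le_norm _ _) 2

namespace BoundedBy

variable {n : ℕ} {C : ℝ}

theorem nonneg (h : F.BoundedBy n C) : 0 ≤ C := (Nat.cast_nonneg _).trans h.L_le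

/-- The spectral norm is defined as an infimum of admissible constants; the extra `1` leaves room to
pick one. -/
theorem unembedBound (h : F.BoundedBy n C) : F.T.UnembedBound n (C + 1) := by
  have h0 := h.nonneg
  obtain ⟨C', hC', hlt⟩ := exists_lt_of_csInf_lt (F.exists_unembedBound n)
    (show sInf {C | F.T.UnembedBound n C} < C + 1 from
      lt_of_le_of_lt h.unembedNorm_le (lt_add_one C))
  exact ⟨by linarith, fun v => (hC'.2 v).trans
    (mul_le_mul_of_nonneg_right hlt.le (norm_nonneg _))⟩

theorem norm_vec (h : F.BoundedBy n C) (hN : F.T.N = n) {w : F.T.Source} (hw : w.InRange) :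
    ‖F.T.vec w‖ ≤ C := by
  cases w with
  | pos t =>
    have ht : (t : ℕ∞) < F.T.N := hw
    rw [hN] at ht
    exact h.norm_pos t (Nat.cast_lt.1 ht)
  | tok ω =>
    have hω : ω.InVocab F.T.N := hw
    rw [hN] at hω
    obtain ⟨ω', rfl⟩ := exists_tokenOf hω
    exact h.norm_emb ω'
  | hid l s => exact (norm_column_le_frobenius _ s).trans (h.frobenius_B l)

/-- A layer costs a factor at most `1 + C`. As this base is at least `1`, skipped layers and the
passage from the depth to `⌈C⌉₊` only weaken the bound. -/
theorem norm_pathProd (h : F.BoundedBy n C) (S : F.T.Path) (x : EuclideanSpace ℝ (Fin F.d)) :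
    ‖F.T.pathProd S x‖ ≤ (1 + C) ^ ⌈C⌉₊ * ‖x‖ := by
  have h0 := h.nonneg
  have key : (fun (k : ℕ) (A : EuclideanSpace ℝ (Fin F.d) →L[ℝ] EuclideanSpace ℝ (Fin F.d)) =>
      ‖A x‖ ≤ (1 + C) ^ k * ‖x‖) F.T.L (F.T.pathProd S) := by
    refine foldl_finRange_induction _
      (fun (k : ℕ) (A : EuclideanSpace ℝ (Fin F.d) →L[ℝ] EuclideanSpace ℝ (Fin F.d)) =>
        ‖A x‖ ≤ (1 + C) ^ k * ‖x‖) _ (by simp) ?_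
    intro l A hA
    have h1 : 0 ≤ (1 + C) ^ (l : ℕ) * ‖x‖ := by positivity
    rcases hS : S l with _ | k
    · refine hA.trans ?_
      rw [pow_succ]
      nlinarith
    · refine ((F.T.V l k).le_opNorm (A x)).trans ?_
      refine (mul_le_mul (h.norm_V l k) hA (norm_nonneg _) h0).trans ?_
      rw [pow_succ]
      nlinarith
  refine le_trans key (mul_le_mul_of_nonneg_right ?_ (norm_nonneg _))
  refine pow_le_pow_right₀ (by linarith) ?_
  exact_mod_cast h.L_le.trans (Nat.le_ceil C)

/-- A bound for the images of embeddings under products of value matrices. -/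
theorem norm_pathProd_vec (h : F.BoundedBy n C) (hN : F.T.N = n) (S : F.T.Path) {w : F.T.Source}
    (hw : w.InRange) : ‖F.T.pathProd S (F.T.vec w)‖ ≤ (1 + C) ^ ⌈C⌉₊ * C :=
  (h.norm_pathProd S _).trans (mul_le_mul_of_nonneg_left (h.norm_vec hN hw)
    (pow_nonneg (by linarith [h.nonneg]) _))

theorem abs_attnProd_le (h : F.BoundedBy n C) (hN : F.T.N = n) (l : Fin F.T.L) (k : Fin F.T.H)
    (S₁ S₂ : F.T.Path) {v w : F.T.Source} (hv : v.InRange) (hw : w.InRange) :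
    |F.T.attnProd l k S₁ S₂ v w| ≤ (C + 1) * ((1 + C) ^ ⌈C⌉₊ * C + 1) ^ 2 := by
  have h0 := h.nonneg
  have h1 := h.norm_pathProd_vec hN S₁ hv
  have h2 := h.norm_pathProd_vec hN S₂ hw
  -- The regularizer bounds `KᵀQ` but not `K` and `Q` separately.
  rw [attnProd, ← ContinuousLinearMap.adjoint_inner_right]
  refine (abs_real_inner_le_norm _ _).trans ?_
  have h3 := ((ContinuousLinearMap.adjoint (F.T.K l k)).comp (F.T.Q l k)).le_opNorm
    (F.T.pathProd S₂ (F.T.vec w))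
  have h4 := h3.trans (mul_le_mul (h.norm_KQ l k) h2 (norm_nonneg _) h0)
  set W := (1 + C) ^ ⌈C⌉₊ * C with hW
  have hW0 : 0 ≤ W := by positivity
  calc _ ≤ W * (C * W) := mul_le_mul h1 h4 (norm_nonneg _) hW0
    _ ≤ (C + 1) * (W + 1) ^ 2 := by nlinarith [mul_nonneg h0 hW0]

theorem abs_unembedProd_le (h : F.BoundedBy n C) (hN : F.T.N = n) (S : F.T.Path) {ω : Token Sg}
    (hω : ω.InVocab F.T.N) {w : F.T.Source} (hw : w.InRange) :
    |F.T.unembedProd S ω w| ≤ (C + 1) * ((1 + C) ^ ⌈C⌉₊ * C + 1) ^ 2 := by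
  have h0 := h.nonneg
  have h2 := h.norm_pathProd_vec hN S hw
  rw [hN] at hω
  obtain ⟨ω', rfl⟩ := exists_tokenOf hω
  have h1 := h.unembedBound.2 (F.T.pathProd S (F.T.vec w))
  have h3 : |F.T.unembedProd S (tokenOf ω') w| ≤
      √(∑ ω : Vocab Sg n, inner ℝ (F.T.U (tokenOf ω)) (F.T.pathProd S (F.T.vec w)) ^ 2) := by
    refine Real.abs_le_sqrt ?_
    exact Finset.single_le_sum (f := fun ω : Vocab Sg n =>
      inner ℝ (F.T.U (tokenOf ω)) (F.T.pathProd S (F.T.vec w)) ^ 2)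
      (fun _ _ => sq_nonneg _) (Finset.mem_univ ω')
  refine h3.trans (h1.trans ?_)
  set W := (1 + C) ^ ⌈C⌉₊ * C with hW
  have hW0 : 0 ≤ W := by positivity
  exact mul_le_mul_of_nonneg_left (by nlinarith) (by linarith)

theorem abs_mlpProd_le (h : F.BoundedBy n C) (hN : F.T.N = n) (S : F.T.Path) (l : Fin F.T.L)
    (s : Fin F.T.dff) {w : F.T.Source} (hw : w.InRange) :
    |F.T.mlpProd S l s w| ≤ (C + 1) * ((1 + C) ^ ⌈C⌉₊ * C + 1) ^ 2 := by
  have h0 := h.nonneg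
  have h2 := h.norm_pathProd_vec hN S hw
  refine (abs_apply_le_frobenius _ _ s).trans ?_
  refine (mul_le_mul (h.frobenius_A l) h2 (norm_nonneg _) h0).trans ?_
  set W := (1 + C) ^ ⌈C⌉₊ * C with hW
  have hW0 : 0 ≤ W := by positivity
  nlinarith [mul_nonneg h0 hW0]

theorem two_mul_precision_le (h : F.BoundedBy n C) :
    2 * (F.precision * (F.T.L + 2)) ≤ 2 * (⌈C⌉₊ * (⌈C⌉₊ + 2)) := by
  have h1 : F.precision ≤ ⌈C⌉₊ := by exact_mod_cast h.precision_le.trans (Nat.le_ceil C)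
  have h2 : F.T.L ≤ ⌈C⌉₊ := by exact_mod_cast h.L_le.trans (Nat.le_ceil C)
  gcongr

/-- The number of hidden units that are connected to the residual stream is bounded. -/
theorem card_hidden_le (h : F.BoundedBy n C) (hF : ∃ p, F.HasPrecision p)
    (s : Finset (Fin F.T.dff)) (hs : ∀ j ∈ s, ∃ l, F.T.B l (EuclideanSpace.single j 1) ≠ 0) :
    (s.card : ℝ) ≤ C * (C ^ 2 * 4 ^ ⌈C⌉₊) := by
  classical
  have h0 := h.nonneg
  have hp := hasPrecision_precision hF
  have h1 : F.precision ≤ ⌈C⌉₊ := by exact_mod_cast h.precision_le.trans (Nat.le_ceil C)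
  let t (l : Fin F.T.L) : Finset (Fin F.T.dff) :=
    s.filter fun j => F.T.B l (EuclideanSpace.single j 1) ≠ 0
  have hst : s ⊆ Finset.univ.biUnion t := by
    intro j hj
    obtain ⟨l, hl⟩ := hs j hj
    simp only [Finset.mem_biUnion, t, Finset.mem_filter]
    exact ⟨l, Finset.mem_univ _, hj, hl⟩
  have h2 : ∀ l, ((t l).card : ℝ) ≤ C ^ 2 * 4 ^ ⌈C⌉₊ := by
    intro l
    refine (card_column_ne_zero_le (hp.B l) (t l) (by simp [t])).trans ?_
    gcongr
    · exact frobenius_nonneg _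
    · exact h.frobenius_B l
    · norm_num
  calc (s.card : ℝ) ≤ ∑ l, ((t l).card : ℝ) := by
        exact_mod_cast (Finset.card_le_card hst).trans Finset.card_biUnion_le
    _ ≤ ∑ _l : Fin F.T.L, C ^ 2 * 4 ^ ⌈C⌉₊ := Finset.sum_le_sum fun l _ => h2 l
    _ ≤ C * (C ^ 2 * 4 ^ ⌈C⌉₊) := by
        rw [Finset.sum_const, Finset.card_univ, Fintype.card_fin, nsmul_eq_mul]
        exact mul_le_mul_of_nonneg_right h.L_le (by positivity)

end BoundedBy

end FiniteTransformer

end LengthGen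

namespace LengthGen

open Transformer FiniteTransformer

/-! ## Restriction to a smaller context width -/

namespace FiniteTransformer

variable {Sg : Type*}

/-- The same parameters at context width `m`. -/
def restrict (F : FiniteTransformer Sg) (m : ℕ) : FiniteTransformer Sg where
  d := F.d
  T := { F.T with N := m }

/-- Labels do not depend on the context width. -/
def castSource {F : FiniteTransformer Sg} {m : ℕ} : (F.restrict m).T.Source → F.T.Source
  | .pos t => .pos t
  | .tok ω => .tok ω
  | .hid l s => .hid l s

variable {F : FiniteTransformer Sg} {m n : ℕ}

theorem castSource_shift (v : (F.restrict m).T.Source) (dp dc : ℕ) :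
    castSource (v.shift dp dc) = (castSource v).shift dp dc := by
  cases v <;> rfl

theorem inVocab_mono {N N' : ℕ∞} (h : N ≤ N') {ω : Token Sg} (hω : ω.InVocab N) :
    ω.InVocab N' := by
  rcases ω with _ | σ | k
  · trivial
  · trivial
  · exact lt_of_lt_of_le hω h

theorem castSource_inRange (h : (m : ℕ∞) ≤ F.T.N) {v : (F.restrict m).T.Source} (hv : v.InRange) :
    (castSource v).InRange := by
  cases v with
  | pos t => exact lt_of_lt_of_le hv h
  | tok ω => exact inVocab_mono h hv
  | hid l s => trivial

theorem vec_castSource (v : (F.restrict m).T.Source) :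
    F.T.vec (castSource v) = (F.restrict m).T.vec v := by
  cases v <;> rfl

theorem pathProd_restrict (S : F.T.Path) : (F.restrict m).T.pathProd S = F.T.pathProd S := by
  refine foldl_finRange_rel _ _ (fun _ A B => A = B) _ _ rfl ?_
  rintro l A B rfl
  rcases hS : S l with _ | h
  · rfl
  · rfl

theorem attnProd_castSource (l : Fin F.T.L) (h : Fin F.T.H) (S₁ S₂ : F.T.Path)
    (v w : (F.restrict m).T.Source) : (F.restrict m).T.attnProd l h S₁ S₂ v w =
      F.T.attnProd l h S₁ S₂ (castSource v) (castSource w) := by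
  change inner ℝ (F.T.K l h ((F.restrict m).T.pathProd S₁ ((F.restrict m).T.vec v)))
    (F.T.Q l h ((F.restrict m).T.pathProd S₂ ((F.restrict m).T.vec w))) = _
  rw [← vec_castSource, ← vec_castSource, pathProd_restrict, pathProd_restrict]
  rfl

theorem unembedProd_castSource (S : F.T.Path) (ω : Token Sg) (w : (F.restrict m).T.Source) :
    (F.restrict m).T.unembedProd S ω w = F.T.unembedProd S ω (castSource w) := by
  change inner ℝ (F.T.U ω) ((F.restrict m).T.pathProd S ((F.restrict m).T.vec w)) = _
  rw [← vec_castSource, pathProd_restrict]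
  rfl

theorem mlpProd_castSource (S : F.T.Path) (l : Fin F.T.L) (s : Fin F.T.dff)
    (w : (F.restrict m).T.Source) :
    (F.restrict m).T.mlpProd S l s w = F.T.mlpProd S l s (castSource w) := by
  change F.T.A l ((F.restrict m).T.pathProd S ((F.restrict m).T.vec w)) s = _
  rw [← vec_castSource, pathProd_restrict]
  rfl

theorem translationInvariant_restrict (h : (m : ℕ∞) ≤ F.T.N) (hF : F.T.TranslationInvariant) :
    (F.restrict m).T.TranslationInvariant := by
  constructor
  · intro l k S₁ S₂ v w dp dc hv hw
    have := hF.attn l k S₁ S₂ (castSource v) (castSource w) dp dc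
      (by rw [← castSource_shift]; exact castSource_inRange h hv)
      (by rw [← castSource_shift]; exact castSource_inRange h hw)
    rw [← castSource_shift, ← castSource_shift] at this
    exact (attnProd_castSource (F := F) l k S₁ S₂ _ _).trans
      (this.trans (attnProd_castSource (F := F) l k S₁ S₂ _ _).symm)
  · intro S ω w dp dc hv hw
    have := hF.unembed S ω (castSource w) dp dc (inVocab_mono h hv)
      (by rw [← castSource_shift]; exact castSource_inRange h hw)
    rw [← castSource_shift] at this
    exact (unembedProd_castSource (F := F) S _ _).trans
      (this.trans (unembedProd_castSource (F := F) S _ _).symm)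
  · intro S l s w dp dc hw
    have := hF.mlp S l s (castSource w) dp dc
      (by rw [← castSource_shift]; exact castSource_inRange h hw)
    rw [← castSource_shift] at this
    exact (mlpProd_castSource (F := F) S l s _).trans
      (this.trans (mlpProd_castSource (F := F) S l s _).symm)

theorem hasPrecision_restrict (h : (m : ℕ∞) ≤ F.T.N) {p : ℕ} (hF : F.HasPrecision p) :
    (F.restrict m).HasPrecision p where
  pos := fun t ht => hF.pos t (lt_of_lt_of_le ht h)
  emb := fun ω hω => hF.emb ω (inVocab_mono h hω)
  U := fun ω hω => hF.U ω (inVocab_mono h hω)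
  K := hF.K
  Q := hF.Q
  V := hF.V
  A := hF.A
  B := hF.B
  b := hF.b

/-- Training inputs at width `m` are training inputs at width `n`, and offsets that fit into the
small window fit into the large one. -/
theorem restrict_mem_fitting {ε : ℝ} {f : LogitMap Sg} (hmn : m ≤ n) (hF : F ∈ fitting ε f n) :
    F.restrict m ∈ fitting ε f m := by
  obtain ⟨⟨hN, ⟨p, hp⟩, hT⟩, hM⟩ := hF
  have h : (m : ℕ∞) ≤ F.T.N := by rw [hN]; exact_mod_cast hmn
  refine ⟨⟨rfl, ⟨p, hasPrecision_restrict h hp⟩, translationInvariant_restrict h hT⟩, ?_⟩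
  intro x hx op oc hlen hobj i ω hω
  refine hM x ⟨hx.1.trans hmn, fun k hk => lt_of_lt_of_le (hx.2.1 k hk) hmn, fun k k' hk hk' =>
    (hx.2.2 k k' hk hk').trans (by exact_mod_cast hmn)⟩ op oc (le_trans hlen h)
    (fun k hk => lt_of_lt_of_le (hobj k hk) h) i ω (inVocab_mono h hω)

/-! ## Monotonicity of the regularizer -/

theorem sum_add_le_of_subset {s t : Finset ℕ} {g : ℕ → ℝ} (hst : s ⊆ t) (hg : ∀ j, 0 ≤ g j) {j : ℕ}
    (hs : j ∉ s) (ht : j ∈ t) : ∑ i ∈ s, g i + g j ≤ ∑ i ∈ t, g i := by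
  rw [add_comm, ← Finset.sum_insert hs]
  exact Finset.sum_le_sum_of_subset_of_nonneg (Finset.insert_subset ht hst) fun i _ _ => hg i

/-- The products that `zeta` penalizes at width `n`, but not at width `m`. -/
inductive IsTail (F : FiniteTransformer Sg) (m n : ℕ) : ℝ → Prop
  | posRight (l h S₁ S₂ j) (hm : m ≤ j) (hn : j < n) :
    IsTail F m n (F.T.attnProd l h S₁ S₂ (.pos 0) (.pos j))
  | posLeft (l h S₁ S₂ j) (hm : m ≤ j) (hn : j < n) :
    IsTail F m n (F.T.attnProd l h S₁ S₂ (.pos j) (.pos 0))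
  | objRight (l h S₁ S₂ j) (hm : m ≤ j) (hn : j < n) :
    IsTail F m n (F.T.attnProd l h S₁ S₂ (.tok (.obj 0)) (.tok (.obj j)))
  | objLeft (l h S₁ S₂ j) (hm : m ≤ j) (hn : j < n) :
    IsTail F m n (F.T.attnProd l h S₁ S₂ (.tok (.obj j)) (.tok (.obj 0)))
  | unembedRight (S j) (hm : m ≤ j) (hn : j < n) :
    IsTail F m n (F.T.unembedProd S (.obj 0) (.tok (.obj j)))
  | unembedLeft (S j) (hm : m ≤ j) (hn : j < n) :
    IsTail F m n (F.T.unembedProd S (.obj j) (.tok (.obj 0)))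

/-- If the tail of the penalty vanishes, then the transformer is local. -/
theorem local_of_tail (hN : F.T.N = n) (hT : F.T.TranslationInvariant)
    (h : ∀ z, F.IsTail m n z → z = 0) : F.T.Local m := by
  have hlt : ∀ {k : ℕ}, (k : ℕ∞) < F.T.N → k < n := by
    intro k hk; rw [hN] at hk; exact Nat.cast_lt.1 hk
  constructor
  · intro l hd S₁ S₂ k j hk hj hkj
    -- A shift brings the smaller index to `0`. The order of the indices decides which of the two
    -- tails the product belongs to, which is why `ζ` penalizes both.
    rcases le_total k j with hle | hle
    · have := hT.attn l hd S₁ S₂ (.pos 0) (.pos (j - k)) k 0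
        (by simpa [Source.shift, Source.InRange] using hk)
        (by simpa [Source.shift, Source.InRange, Nat.sub_add_cancel hle] using hj)
      simp only [Source.shift, zero_add, Nat.sub_add_cancel hle] at this
      rw [this]
      exact h _ (.posRight _ _ _ _ _ (by grind) (by have := hlt hj; omega))
    · have := hT.attn l hd S₁ S₂ (.pos (k - j)) (.pos 0) j 0
        (by simpa [Source.shift, Source.InRange, Nat.sub_add_cancel hle] using hk)
        (by simpa [Source.shift, Source.InRange] using hj)
      simp only [Source.shift, zero_add, Nat.sub_add_cancel hle] at this
      rw [this]
      exact h _ (.posLeft _ _ _ _ _ (by grind) (by have := hlt hk; omega))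
  · intro l hd S₁ S₂ k j hk hj hkj
    rcases le_total k j with hle | hle
    · have := hT.attn l hd S₁ S₂ (.tok (.obj 0)) (.tok (.obj (j - k))) 0 k
        (by simpa [Source.shift, Source.InRange, Token.shift, Token.InVocab] using hk)
        (by simpa [Source.shift, Source.InRange, Token.shift, Token.InVocab,
          Nat.sub_add_cancel hle] using hj)
      simp only [Source.shift, Token.shift, zero_add, Nat.sub_add_cancel hle] at this
      rw [this]
      exact h _ (.objRight _ _ _ _ _ (by grind) (by have := hlt hj; omega))
    · have := hT.attn l hd S₁ S₂ (.tok (.obj (k - j))) (.tok (.obj 0)) 0 j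
        (by simpa [Source.shift, Source.InRange, Token.shift, Token.InVocab,
          Nat.sub_add_cancel hle] using hk)
        (by simpa [Source.shift, Source.InRange, Token.shift, Token.InVocab] using hj)
      simp only [Source.shift, Token.shift, zero_add, Nat.sub_add_cancel hle] at this
      rw [this]
      exact h _ (.objLeft _ _ _ _ _ (by grind) (by have := hlt hk; omega))
  · intro S k j hk hj hkj
    rcases le_total k j with hle | hle
    · have := hT.unembed S (.obj 0) (.tok (.obj (j - k))) 0 k
        (by simpa [Token.shift, Token.InVocab] using hk)
        (by simpa [Source.shift, Source.InRange, Token.shift, Token.InVocab,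
          Nat.sub_add_cancel hle] using hj)
      simp only [Source.shift, Token.shift, zero_add, Nat.sub_add_cancel hle] at this
      rw [this]
      exact h _ (.unembedRight _ _ (by grind) (by have := hlt hj; omega))
    · have := hT.unembed S (.obj (k - j)) (.tok (.obj 0)) 0 j
        (by simpa [Token.shift, Token.InVocab, Nat.sub_add_cancel hle] using hk)
        (by simpa [Source.shift, Source.InRange, Token.shift, Token.InVocab] using hj)
      simp only [Source.shift, Token.shift, zero_add, Nat.sub_add_cancel hle] at this
      rw [this]
      exact h _ (.unembedLeft _ _ (by grind) (by have := hlt hk; omega))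

theorem IsTail.dyadic {p P : ℕ} (hF : F.HasPrecision p) (hP : 2 * (p * (F.T.L + 2)) ≤ P)
    (hN : F.T.N = n) (hmn : m ≤ n) (hm : 1 ≤ m) {z : ℝ} (hz : F.IsTail m n z) : Dyadic P z := by
  have hlt : ∀ {k : ℕ}, k < n → (k : ℕ∞) < F.T.N := by
    intro k hk; rw [hN]; exact Nat.cast_lt.2 hk
  have h0 : ((0 : ℕ) : ℕ∞) < F.T.N := hlt (by omega)
  cases hz with
  | posRight l h S₁ S₂ j hmj hjn => exact hF.dyadic_attnProd hP _ _ _ _ h0 (hlt hjn)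
  | posLeft l h S₁ S₂ j hmj hjn => exact hF.dyadic_attnProd hP _ _ _ _ (hlt hjn) h0
  | objRight l h S₁ S₂ j hmj hjn => exact hF.dyadic_attnProd hP _ _ _ _ h0 (hlt hjn)
  | objLeft l h S₁ S₂ j hmj hjn => exact hF.dyadic_attnProd hP _ _ _ _ (hlt hjn) h0
  | unembedRight S j hmj hjn => exact hF.dyadic_unembedProd hP _ (ω := .obj 0) h0 (hlt hjn)
  | unembedLeft S j hmj hjn => exact hF.dyadic_unembedProd hP _ (ω := .obj j) (hlt hjn) h0

variable [Fintype Sg]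

theorem sum_vocab_eq (n : ℕ) (g : Token Sg → ℝ) : ∑ ω : Vocab Sg n, g (tokenOf ω) =
    (∑ ω : Option Sg, g (tokenOf (n := 0) (.inl ω))) + ∑ j ∈ Finset.range n, g (.obj j) := by
  rw [Fintype.sum_sum_type]
  congr 1
  · refine Finset.sum_congr rfl fun ω _ => ?_
    cases ω <;> rfl
  · exact Fin.sum_univ_eq_sum_range (fun j => g (.obj j)) n

/-- The part of the penalty for an attention slot. -/
noncomputable def zetaAttn (F : FiniteTransformer Sg) (n : ℕ) (l : Fin F.T.L) (h : Fin F.T.H)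
    (S₁ S₂ : F.T.Path) : ℝ :=
  (∑ j ∈ Finset.range n, F.T.attnProd l h S₁ S₂ (.pos 0) (.pos j) ^ 2) +
      (∑ ω : Vocab Sg n, F.T.attnProd l h S₁ S₂ (.tok (.obj 0)) (.tok (tokenOf ω)) ^ 2) +
      (∑ j ∈ Finset.Ico 1 n, F.T.attnProd l h S₁ S₂ (.pos j) (.pos 0) ^ 2) +
      ∑ k ∈ Finset.Ico 1 n, F.T.attnProd l h S₁ S₂ (.tok (.obj k)) (.tok (.obj 0)) ^ 2

/-- The part of the penalty for an unembedding slot. -/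
noncomputable def zetaUnembed (F : FiniteTransformer Sg) (n : ℕ) (S : F.T.Path) : ℝ :=
  (∑ ω : Vocab Sg n, F.T.unembedProd S (.obj 0) (.tok (tokenOf ω)) ^ 2) +
      ∑ k ∈ Finset.Ico 1 n, F.T.unembedProd S (.obj k) (.tok (.obj 0)) ^ 2

theorem zeta_eq (F : FiniteTransformer Sg) (n : ℕ) : F.zeta n =
    (∑ z : Fin F.T.L × Fin F.T.H × F.T.Path × F.T.Path, F.zetaAttn n z.1 z.2.1 z.2.2.1 z.2.2.2) +
      ∑ S, F.zetaUnembed n S := by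
  simp only [Fintype.sum_prod_type]
  rfl

theorem zetaAttn_mono (hmn : m ≤ n) (l : Fin F.T.L) (h : Fin F.T.H) (S₁ S₂ : F.T.Path) :
    F.zetaAttn m l h S₁ S₂ ≤ F.zetaAttn n l h S₁ S₂ := by
  simp only [zetaAttn, sum_vocab_eq _ (fun ω =>
    F.T.attnProd l h S₁ S₂ (.tok (.obj 0)) (.tok ω) ^ 2)]
  gcongr

theorem zetaUnembed_mono (hmn : m ≤ n) (S : F.T.Path) :
    F.zetaUnembed m S ≤ F.zetaUnembed n S := by
  simp only [zetaUnembed, sum_vocab_eq _ (fun ω => F.T.unembedProd S (.obj 0) (.tok ω) ^ 2)]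
  gcongr

theorem zeta_add_sq_le_of_attn (hmn : m ≤ n) {z : ℝ} (l : Fin F.T.L) (h : Fin F.T.H)
    (S₁ S₂ : F.T.Path) (hz : F.zetaAttn m l h S₁ S₂ + z ^ 2 ≤ F.zetaAttn n l h S₁ S₂) :
    F.zeta m + z ^ 2 ≤ F.zeta n := by
  rw [zeta_eq, zeta_eq]
  have h1 : ∑ S, F.zetaUnembed m S ≤ ∑ S, F.zetaUnembed n S :=
    Finset.sum_le_sum fun S _ => zetaUnembed_mono hmn S
  have h2 := Finset.single_le_sum
    (f := fun z : Fin F.T.L × Fin F.T.H × F.T.Path × F.T.Path =>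
      F.zetaAttn n z.1 z.2.1 z.2.2.1 z.2.2.2 - F.zetaAttn m z.1 z.2.1 z.2.2.1 z.2.2.2)
    (fun z _ => sub_nonneg.2 (zetaAttn_mono hmn _ _ _ _)) (Finset.mem_univ (l, h, S₁, S₂))
  rw [Finset.sum_sub_distrib] at h2
  simp only at h2
  linarith

theorem zeta_add_sq_le_of_unembed (hmn : m ≤ n) {z : ℝ} (S : F.T.Path)
    (hz : F.zetaUnembed m S + z ^ 2 ≤ F.zetaUnembed n S) :
    F.zeta m + z ^ 2 ≤ F.zeta n := by
  rw [zeta_eq, zeta_eq]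
  have h1 := Finset.sum_le_sum (s := Finset.univ)
    (fun (z : Fin F.T.L × Fin F.T.H × F.T.Path × F.T.Path) _ =>
    zetaAttn_mono (F := F) hmn z.1 z.2.1 z.2.2.1 z.2.2.2)
  have h2 := Finset.single_le_sum (f := fun S => F.zetaUnembed n S - F.zetaUnembed m S)
    (fun z _ => sub_nonneg.2 (zetaUnembed_mono hmn _)) (Finset.mem_univ S)
  rw [Finset.sum_sub_distrib] at h2
  linarith

/-- The square of a tail product is a summand at width `n` whose index lies outside the range at
width `m`, and all summands at width `m` persist. The condition `1 ≤ m` keeps its index in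
`Finset.Ico 1 n`. -/
theorem IsTail.zeta_add_sq_le (hm : 1 ≤ m) (hmn : m ≤ n) {z : ℝ} (hz : F.IsTail m n z) :
    F.zeta m + z ^ 2 ≤ F.zeta n := by
  have hR : Finset.range m ⊆ Finset.range n := Finset.range_subset_range.2 hmn
  have hI : Finset.Ico 1 m ⊆ Finset.Ico 1 n := Finset.Ico_subset_Ico_right hmn
  have a1 : ∀ (g : ℕ → ℝ), (∀ j, 0 ≤ g j) → ∑ j ∈ Finset.range m, g j ≤
      ∑ j ∈ Finset.range n, g j := fun g hg =>
    Finset.sum_le_sum_of_subset_of_nonneg hR fun i _ _ => hg i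
  have a2 : ∀ (g : ℕ → ℝ), (∀ j, 0 ≤ g j) → ∑ j ∈ Finset.Ico 1 m, g j ≤
      ∑ j ∈ Finset.Ico 1 n, g j := fun g hg =>
    Finset.sum_le_sum_of_subset_of_nonneg hI fun i _ _ => hg i
  have b1 : ∀ (g : ℕ → ℝ), (∀ j, 0 ≤ g j) → ∀ j, m ≤ j → j < n →
      ∑ j ∈ Finset.range m, g j + g j ≤ ∑ j ∈ Finset.range n, g j := fun g hg j h1 h2 =>
    sum_add_le_of_subset hR hg (by simpa using h1) (by simpa using h2)
  have b2 : ∀ (g : ℕ → ℝ), (∀ j, 0 ≤ g j) → ∀ j, m ≤ j → j < n →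
      ∑ j ∈ Finset.Ico 1 m, g j + g j ≤ ∑ j ∈ Finset.Ico 1 n, g j := fun g hg j h1 h2 =>
    sum_add_le_of_subset hI hg (by simp only [Finset.mem_Ico]; omega)
      (by simp only [Finset.mem_Ico]; omega)
  have c1 := fun l h S₁ S₂ => a1 (fun j => F.T.attnProd l h S₁ S₂ (.pos 0) (.pos j) ^ 2)
    fun _ => sq_nonneg _
  have c2 := fun l h S₁ S₂ => a1 (fun j => F.T.attnProd l h S₁ S₂ (.tok (.obj 0)) (.tok (.obj j)) ^ 2)
    fun _ => sq_nonneg _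
  have c3 := fun l h S₁ S₂ => a2 (fun j => F.T.attnProd l h S₁ S₂ (.pos j) (.pos 0) ^ 2)
    fun _ => sq_nonneg _
  have c4 := fun l h S₁ S₂ => a2 (fun j => F.T.attnProd l h S₁ S₂ (.tok (.obj j)) (.tok (.obj 0)) ^ 2)
    fun _ => sq_nonneg _
  have d1 := fun S => a1 (fun j => F.T.unembedProd S (.obj 0) (.tok (.obj j)) ^ 2)
    fun _ => sq_nonneg _
  have d2 := fun S => a2 (fun j => F.T.unembedProd S (.obj j) (.tok (.obj 0)) ^ 2)
    fun _ => sq_nonneg _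
  cases hz with
  | posRight l h S₁ S₂ j hmj hjn =>
    refine zeta_add_sq_le_of_attn hmn l h S₁ S₂ ?_
    simp only [zetaAttn, sum_vocab_eq _ (fun ω =>
      F.T.attnProd l h S₁ S₂ (.tok (.obj 0)) (.tok ω) ^ 2)]
    linarith [c2 l h S₁ S₂, c3 l h S₁ S₂, c4 l h S₁ S₂,
      b1 (fun j => F.T.attnProd l h S₁ S₂ (.pos 0) (.pos j) ^ 2) (fun _ => sq_nonneg _) j hmj hjn]
  | posLeft l h S₁ S₂ j hmj hjn =>
    refine zeta_add_sq_le_of_attn hmn l h S₁ S₂ ?_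
    simp only [zetaAttn, sum_vocab_eq _ (fun ω =>
      F.T.attnProd l h S₁ S₂ (.tok (.obj 0)) (.tok ω) ^ 2)]
    linarith [c1 l h S₁ S₂, c2 l h S₁ S₂, c4 l h S₁ S₂,
      b2 (fun j => F.T.attnProd l h S₁ S₂ (.pos j) (.pos 0) ^ 2) (fun _ => sq_nonneg _) j hmj hjn]
  | objRight l h S₁ S₂ j hmj hjn =>
    refine zeta_add_sq_le_of_attn hmn l h S₁ S₂ ?_
    simp only [zetaAttn, sum_vocab_eq _ (fun ω =>
      F.T.attnProd l h S₁ S₂ (.tok (.obj 0)) (.tok ω) ^ 2)]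
    linarith [c1 l h S₁ S₂, c3 l h S₁ S₂, c4 l h S₁ S₂,
      b1 (fun j => F.T.attnProd l h S₁ S₂ (.tok (.obj 0)) (.tok (.obj j)) ^ 2)
        (fun _ => sq_nonneg _) j hmj hjn]
  | objLeft l h S₁ S₂ j hmj hjn =>
    refine zeta_add_sq_le_of_attn hmn l h S₁ S₂ ?_
    simp only [zetaAttn, sum_vocab_eq _ (fun ω =>
      F.T.attnProd l h S₁ S₂ (.tok (.obj 0)) (.tok ω) ^ 2)]
    linarith [c1 l h S₁ S₂, c2 l h S₁ S₂, c3 l h S₁ S₂,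
      b2 (fun j => F.T.attnProd l h S₁ S₂ (.tok (.obj j)) (.tok (.obj 0)) ^ 2)
        (fun _ => sq_nonneg _) j hmj hjn]
  | unembedRight S j hmj hjn =>
    refine zeta_add_sq_le_of_unembed hmn S ?_
    simp only [zetaUnembed, sum_vocab_eq _ (fun ω => F.T.unembedProd S (.obj 0) (.tok ω) ^ 2)]
    linarith [d2 S, b1 (fun j => F.T.unembedProd S (.obj 0) (.tok (.obj j)) ^ 2)
        (fun _ => sq_nonneg _) j hmj hjn]
  | unembedLeft S j hmj hjn =>
    refine zeta_add_sq_le_of_unembed hmn S ?_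
    simp only [zetaUnembed, sum_vocab_eq _ (fun ω => F.T.unembedProd S (.obj 0) (.tok ω) ^ 2)]
    linarith [d1 S, b2 (fun j => F.T.unembedProd S (.obj j) (.tok (.obj 0)) ^ 2)
        (fun _ => sq_nonneg _) j hmj hjn]

theorem zeta_mono (hmn : m ≤ n) : F.zeta m ≤ F.zeta n := by
  rw [zeta_eq, zeta_eq]
  exact add_le_add (Finset.sum_le_sum fun z _ => zetaAttn_mono hmn _ _ _ _)
    (Finset.sum_le_sum fun z _ => zetaUnembed_mono hmn _)

theorem unembedBound_anti (hmn : m ≤ n) {C : ℝ} (h : F.T.UnembedBound n C) :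
    F.T.UnembedBound m C := by
  refine ⟨h.1, fun v => (Real.sqrt_le_sqrt ?_).trans (h.2 v)⟩
  rw [sum_vocab_eq m (fun ω => inner ℝ (F.T.U ω) v ^ 2),
    sum_vocab_eq n (fun ω => inner ℝ (F.T.U ω) v ^ 2)]
  gcongr

theorem zeta_restrict (F : FiniteTransformer Sg) (m k : ℕ) : (F.restrict m).zeta k = F.zeta k := by
  refine congrArg₂ (· + ·) ?_ ?_
  · refine Finset.sum_congr rfl fun l _ => Finset.sum_congr rfl fun h _ =>
      Finset.sum_congr rfl fun S₁ _ => Finset.sum_congr rfl fun S₂ _ => ?_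
    have key := attnProd_castSource (F := F) (m := m) l h S₁ S₂
    refine congrArg₂ (· + ·) (congrArg₂ (· + ·) (congrArg₂ (· + ·) ?_ ?_) ?_) ?_
    · exact Finset.sum_congr rfl fun j _ => congrArg (· ^ 2) (key (.pos 0) (.pos j))
    · exact Finset.sum_congr rfl fun ω _ =>
        congrArg (· ^ 2) (key (.tok (.obj 0)) (.tok (tokenOf ω)))
    · exact Finset.sum_congr rfl fun j _ => congrArg (· ^ 2) (key (.pos j) (.pos 0))
    · exact Finset.sum_congr rfl fun j _ =>
        congrArg (· ^ 2) (key (.tok (.obj j)) (.tok (.obj 0)))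
  · refine Finset.sum_congr rfl fun S _ => ?_
    have key := unembedProd_castSource (F := F) (m := m) S
    refine congrArg₂ (· + ·) ?_ ?_
    · exact Finset.sum_congr rfl fun ω _ => congrArg (· ^ 2) (key (.obj 0) (.tok (tokenOf ω)))
    · exact Finset.sum_congr rfl fun j _ => congrArg (· ^ 2) (key (.obj j) (.tok (.obj 0)))

/-- For fixed parameters every term is monotone in the width, so a saving `z` in the penalty is a
saving in the whole regularizer. -/
theorem regularizer_restrict_add_le (hmn : m ≤ n) (hN : F.T.N = n)
    (hF : ∃ p, F.HasPrecision p) {z : ℝ} (hz : F.zeta m + z ≤ F.zeta n) :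
    regularizer m (F.restrict m) + z ≤ regularizer n F := by
  have hN' : (m : ℕ∞) ≤ F.T.N := by rw [hN]; exact_mod_cast hmn
  have h1 : ((F.restrict m).precision : ℝ) ≤ F.precision := by
    exact_mod_cast Nat.sInf_le (hasPrecision_restrict hN' (hasPrecision_precision hF))
  have h2 : (F.restrict m).unembedNorm m ≤ F.unembedNorm n :=
    csInf_le_csInf ⟨0, fun _ h => h.1⟩ (F.exists_unembedBound n)
      fun C hC => unembedBound_anti hmn hC
  have h3 : (⨆ t : Fin m, ‖(F.restrict m).T.pos t‖) ≤ ⨆ t : Fin n, ‖F.T.pos t‖ := by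
    refine Real.iSup_le (fun t => ?_) (Real.iSup_nonneg fun _ => norm_nonneg _)
    exact le_ciSup (f := fun t : Fin n => ‖F.T.pos t‖) (Set.finite_range _).bddAbove
      ⟨t, lt_of_lt_of_le t.2 hmn⟩
  have h4 : (⨆ ω : Vocab Sg m, ‖(F.restrict m).T.emb (tokenOf ω)‖) ≤
      ⨆ ω : Vocab Sg n, ‖F.T.emb (tokenOf ω)‖ := by
    have hb : BddAbove (Set.range fun ω : Vocab Sg n => ‖F.T.emb (tokenOf ω)‖) :=
      (Set.finite_range _).bddAbove
    refine Real.iSup_le (fun ω => ?_) (Real.iSup_nonneg fun _ => norm_nonneg _)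
    rcases ω with (_ | σ) | k
    · exact le_ciSup hb (.inl none)
    · exact le_ciSup hb (.inl (some σ))
    · exact le_ciSup hb (.inr ⟨k, lt_of_lt_of_le k.2 hmn⟩)
  have h5 : (F.restrict m).zeta m = F.zeta m := zeta_restrict F m m
  have h6 : (F.restrict m).T.attPrec = F.T.attPrec := rfl
  have h7 : (F.restrict m).T.L = F.T.L := rfl
  have h8 : (F.restrict m).T.H = F.T.H := rfl
  have h9 : (⨆ l, ⨆ h, ‖(ContinuousLinearMap.adjoint ((F.restrict m).T.K l h)).comp
      ((F.restrict m).T.Q l h)‖) =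
      ⨆ l, ⨆ h, ‖(ContinuousLinearMap.adjoint (F.T.K l h)).comp (F.T.Q l h)‖ := rfl
  have h10 : (⨆ l, ⨆ h, ‖(F.restrict m).T.V l h‖) = ⨆ l, ⨆ h, ‖F.T.V l h‖ := rfl
  have h11 : (⨆ l, FiniteTransformer.frobenius ((F.restrict m).T.A l)) =
    ⨆ l, FiniteTransformer.frobenius (F.T.A l) := rfl
  have h12 : (⨆ l, FiniteTransformer.frobenius ((F.restrict m).T.B l)) =
    ⨆ l, FiniteTransformer.frobenius (F.T.B l) := rfl
  have h13 : (⨆ l, ‖(F.restrict m).T.b l‖) = ⨆ l, ‖F.T.b l‖ := rfl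
  simp only [regularizer, h5, h6, h7, h8, h9, h10, h11, h12, h13]
  linarith

end FiniteTransformer

/-- In a run with bounded regularizer, the transformers are eventually local with the same
bandwidth. -/
theorem IsRun.exists_local {Sg : Type*} [Fintype Sg] {ε : ℝ} {f : LogitMap Sg}
    {F : ℕ → FiniteTransformer Sg} (hF : IsRun ε f F) {C : ℝ}
    (hC : ∀ n : ℕ, 1 ≤ n → regularizer n (F n) ≤ C) :
    ∃ Δ : ℕ, ∀ n : ℕ, Δ ≤ n → (F n).T.Local Δ := by
  set I : ℕ → ℝ := fun n => sInf (regularizer n '' fitting ε f n) with hI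
  have hbdd : ∀ n, BddBelow (regularizer n '' fitting ε f n) := by
    intro n
    refine ⟨0, ?_⟩
    rintro _ ⟨G, -, rfl⟩
    exact regularizer_nonneg n G
  have hIle : ∀ n G, G ∈ fitting ε f n → I n ≤ regularizer n G := fun n G hG =>
    csInf_le (hbdd n) ⟨G, hG, rfl⟩
  -- A fitting transformer at width `n` restricts to one at width `m` with no larger regularizer.
  have hmono : ∀ m n, 1 ≤ m → m ≤ n → I m ≤ I n := by
    intro m n hm hmn
    refine le_csInf ⟨_, F n, (hF n (hm.trans hmn)).1, rfl⟩ ?_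
    rintro _ ⟨G, hG, rfl⟩
    refine (hIle m _ (restrict_mem_fitting hmn hG)).trans ?_
    have := regularizer_restrict_add_le hmn hG.1.1 hG.1.2.1 (z := 0)
      (by simpa using zeta_mono hmn)
    simpa using this
  set P := 2 * (⌈C⌉₊ * (⌈C⌉₊ + 2)) with hP
  set S := {r | ∃ n, 1 ≤ n ∧ r = I n} with hS
  have hSb : BddAbove S := by
    refine ⟨C, ?_⟩
    rintro _ ⟨n, hn, rfl⟩
    exact (hIle n _ (hF n hn).1).trans (hC n hn)
  -- Half of the least square of a nonzero product: one half pays for the remaining growth of the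
  -- infima `I`, the other for the slack `1 / n`.
  have hδ : (0 : ℝ) < 1 / 4 ^ P / 2 := by positivity
  obtain ⟨_, ⟨n₁, hn₁, rfl⟩, hlt⟩ := exists_lt_of_lt_csSup (s := S) ⟨_, 1, le_rfl, rfl⟩
    (sub_lt_self (sSup S) hδ)
  obtain ⟨n₂, hn₂⟩ := exists_nat_one_div_lt hδ
  refine ⟨max n₁ (n₂ + 1), fun n hn => ?_⟩
  set m := max n₁ (n₂ + 1) with hm
  have hm1 : 1 ≤ m := hn₁.trans (le_max_left _ _)
  have hn1 : 1 ≤ n := hm1.trans hn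
  obtain ⟨hfit, hrun⟩ := hF n hn1
  refine local_of_tail hfit.1.1 hfit.1.2.2 fun z hz => ?_
  -- Otherwise `I m + z ^ 2 ≤ regularizer n (F n) ≤ 1 / n + I n` with `z ^ 2 ≥ 1 / 4 ^ P`, although
  -- `I m` and `I n` differ by less than half of that and `1 / n` is less than the other half.
  by_contra hne
  have hB := boundedBy_of_regularizer_le (hC n hn1)
  have hz2 := (hz.dyadic (hasPrecision_precision hfit.1.2.1) hB.two_mul_precision_le hfit.1.1 hn
    hm1).le_sq hne
  have h1 := regularizer_restrict_add_le hn hfit.1.1 hfit.1.2.1 (hz.zeta_add_sq_le hm1 hn)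
  have h2 := hIle m _ (restrict_mem_fitting hn hfit)
  have h3 : I n ≤ sSup S := le_csSup hSb ⟨n, hn1, rfl⟩
  have h4 := hmono n₁ m hn₁ (le_max_left _ _)
  have h5 : (1 : ℝ) / n ≤ 1 / (n₂ + 1) := by
    apply one_div_le_one_div_of_le (by positivity)
    exact_mod_cast (le_max_right _ _).trans hn
  have h6 : regularizer n (F n) ≤ 1 / n + I n := hrun
  rw [← hP] at hz2
  linarith

end LengthGen

namespace LengthGen

open Transformer FiniteTransformer

/-! ## Finitely many possibilities for the product functions -/

instance Activation.finite : Finite Activation := by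
  refine Finite.of_injective (fun a : Activation => match a with
    | .relu => (0 : Fin 3)
    | .heaviside => 1
    | .reciprocal => 2) ?_
  rintro (_ | _ | _) (_ | _ | _) <;> simp

/-- `M` computes the same as `F` at context width `n`, with regular product functions, and
product functions and biases bounded by `a`. -/
structure Net.Represents {Sg : Type*} {L H D q d : ℕ}
    (M : Net Sg L H D q (EuclideanSpace ℝ (Fin d))) (ε : ℝ) (F : FiniteTransformer Sg) (n Δ P : ℕ)
    (a : ℝ) : Prop where
  regular : M.val.Regular n Δ P
  bias : ∀ l s, Dyadic P (M.b l s) ∧ |M.b l s| ≤ a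
  bound : ∀ c v w, v.InRange n → w.InRange n → |M.val c v w| ≤ a
  eval_eq : ∀ x op oc i ω, (M.toTransformer n).eval ε x op oc i ω = F.T.eval ε x op oc i ω

/-- A transformer of bounded complexity is represented by a net with sizes, precision and product
functions in a fixed finite range. -/
theorem FiniteTransformer.BoundedBy.exists_represents {Sg : Type*} [Fintype Sg] {C : ℝ} (ε : ℝ)
    (Δ : ℕ) : ∃ B P n₀ : ℕ, ∃ a : ℝ, ∀ (F : FiniteTransformer Sg) (n : ℕ), n₀ ≤ n →
      F ∈ Theta Sg n → F.BoundedBy n C → F.T.Local Δ →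
      ∃ L ≤ B, ∃ H ≤ B, ∃ D ≤ B, ∃ q ≤ B, ∃ (d : ℕ) (M : Net Sg L H D q (EuclideanSpace ℝ (Fin d))),
        M.Represents ε F n Δ P a := by
  classical
  set P := 2 * (⌈C⌉₊ * (⌈C⌉₊ + 2)) with hPdef
  -- For `n > R`, `n` equal squares of at least `1 / 4 ^ P` exceed the bound on `U`; so the products
  -- of `U_{c_k}` with non-objects vanish.
  set R := ((C + 1) * ((1 + C) ^ ⌈C⌉₊ * C)) ^ 2 * 4 ^ P with hR
  set a := (C + 1) * ((1 + C) ^ ⌈C⌉₊ * C + 1) ^ 2 with ha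
  refine ⟨⌈C⌉₊ + ⌈C * (C ^ 2 * 4 ^ ⌈C⌉₊)⌉₊, P, ⌈R⌉₊ + 1, max a C, ?_⟩
  rintro F n hn ⟨hN, hprec, hT⟩ hB hΔ
  have h0 := hB.nonneg
  have hp := hasPrecision_precision hprec
  have hP := hB.two_mul_precision_le
  have hnat : ∀ k : ℕ, (k : ℝ) ≤ C → k ≤ ⌈C⌉₊ + ⌈C * (C ^ 2 * 4 ^ ⌈C⌉₊)⌉₊ := by
    intro k hk
    exact le_add_right (by exact_mod_cast hk.trans (Nat.le_ceil C))
  -- The MLP width is not penalized. Only units with a nonzero column in some `B_l` are kept, and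
  -- their number is bounded.
  set s : Finset (Fin F.T.dff) :=
    Finset.univ.filter fun j => ∃ l, F.T.B l (EuclideanSpace.single j 1) ≠ 0 with hs
  have hD : s.card ≤ ⌈C⌉₊ + ⌈C * (C ^ 2 * 4 ^ ⌈C⌉₊)⌉₊ := by
    refine le_add_left ?_
    exact_mod_cast (hB.card_hidden_le hprec s (by simp [hs])).trans (Nat.le_ceil _)
  let g : Fin s.card → Fin F.T.dff := s.orderEmbOfFin rfl
  refine ⟨F.T.L, hnat _ hB.L_le, F.T.H, hnat _ hB.H_le, s.card, hD, F.T.attPrec,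
    hnat _ hB.attPrec_le, F.d, F.T.toNet g, ?_⟩
  constructor
  · rw [← hN]
    refine toNet_regular hT hΔ (fun l h S₁ S₂ v w hv hw => hp.dyadic_attnProd hP _ _ _ _ hv hw)
      (fun S ω w hω hw => hp.dyadic_unembedProd hP _ hω hw)
      (fun S l s w hw => hp.dyadic_mlpProd hP _ _ _ hw) ?_
    intro S k w hk hw hwo
    by_contra hne
    have h1 := (hp.dyadic_unembedProd (ω := .obj k) hP S hk hw).le_sq hne
    have h2 := unembedProd_obj_sq_le hT hB.unembedBound hN.ge S hk hw hwo
    have h3 : ((C + 1) * ‖F.T.pathProd S (F.T.vec w)‖) ^ 2 ≤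
        ((C + 1) * ((1 + C) ^ ⌈C⌉₊ * C)) ^ 2 := by
      have := hB.norm_pathProd_vec hN S hw
      gcongr
    have h4 : R < n := by
      refine lt_of_le_of_lt (Nat.le_ceil R) ?_
      exact_mod_cast hn
    have h5 : (n : ℝ) * (1 / 4 ^ P) ≤ ((C + 1) * ((1 + C) ^ ⌈C⌉₊ * C)) ^ 2 :=
      (mul_le_mul_of_nonneg_left h1 (Nat.cast_nonneg _)).trans (h2.trans h3)
    rw [mul_one_div, div_le_iff₀ (by positivity)] at h5
    exact absurd h5 (not_le.2 h4)
  · intro l t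
    refine ⟨(hp.b l (g t)).mono ?_, le_max_of_le_right ?_⟩
    · refine le_trans ?_ hP
      nlinarith [Nat.zero_le (F.precision * F.T.L)]
    · exact (PiLp.norm_apply_le (F.T.b l) (g t)).trans (hB.norm_b l)
  · intro c v w hv hw
    refine le_max_of_le_left ?_
    rw [← hN] at hv hw
    have hw' := Src.toSource_inRange (g := g) hw
    have hv' := Src.toSource_inRange (g := g) hv
    by_cases hc : c.Admits v
    · rcases c with ⟨l, h, S₁, S₂⟩ | S | ⟨S, l, t⟩
      · rw [toNet_val_attn]
        exact hB.abs_attnProd_le hN _ _ _ _ hv' hw'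
      · rcases v with _ | ω | _
        · exact hc.elim
        · rw [toNet_val_unembed]
          exact hB.abs_unembedProd_le hN _ hv hw'
        · exact hc.elim
      · rcases v with _ | (_ | σ | k) | _
        · exact hc.elim
        · rw [toNet_val_mlp]
          exact hB.abs_mlpProd_le hN _ _ _ hw'
        all_goals exact hc.elim
    · rw [Net.val_eq_zero _ _ _ _ hc, abs_zero]
      positivity
  · intro x op oc i ω
    refine toNet_eval ε n (s.orderEmbOfFin rfl).injective ?_ x op oc i ω
    intro l t ht
    by_contra hne
    refine ht ?_
    change t ∈ Set.range (s.orderEmbOfFin rfl)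
    rw [Finset.range_orderEmbOfFin]
    simpa [hs] using ⟨l, hne⟩

theorem exists_infinite_of_finite {κ : Type*} {S : Set κ} (hS : S.Finite) {I : Set ℕ}
    (hI : I.Infinite) (R : ℕ → κ → Prop) (h : ∀ n ∈ I, ∃ c ∈ S, R n c) :
    ∃ c, {n | n ∈ I ∧ R n c}.Infinite := by
  by_contra! hc
  refine hI ((hS.biUnion (t := fun c => {n | n ∈ I ∧ R n c}) fun c _ => ?_).subset fun n hn => ?_)
  · exact hc c
  · obtain ⟨c, hcS, hcR⟩ := h n hn
    exact Set.mem_biUnion hcS ⟨hn, hcR⟩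

/-- Infinitely many nets of the same sizes with product functions in a fixed finite range contain
infinitely many that agree on their common window. -/
theorem Net.exists_infinite_agree {Sg : Type*} [Fintype Sg] {L H D q Δ P : ℕ} {a ε : ℝ}
    {F : ℕ → FiniteTransformer Sg} {I : Set ℕ} (hI : I.Infinite)
    (h : ∀ n ∈ I, ∃ (d : ℕ) (M : Net Sg L H D q (EuclideanSpace ℝ (Fin d))),
      M.Represents ε (F n) n Δ P a) :
    ∃ J ⊆ I, J.Infinite ∧ ∃ (b : Fin L → EuclideanSpace ℝ (Fin D)) (act : Fin L → Fin D → Activation)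
      (d : ℕ → ℕ) (M : (n : ℕ) → Net Sg L H D q (EuclideanSpace ℝ (Fin (d n)))),
      (∀ n ∈ J, (M n).Represents ε (F n) n Δ P a ∧ (∀ l s, (M n).b l s = b l s) ∧
        ∀ l s, (M n).act l s = act l s) ∧
      ∀ n ∈ J, ∀ m ∈ J, ∀ c v w, v.InRange n → w.InRange n → v.InRange m → w.InRange m →
        (M n).val c v w = (M m).val c v w := by
  let Box := {v : Src Sg L D // v.InBox Δ}
  have : Finite Box := (Src.finite_inBox Δ).to_subtype
  let κ := (((Slot L H D × Box × Box) ⊕ (Fin L × Fin D)) → ℝ) × (Fin L → Fin D → Activation)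
  -- Values on the box, biases and activation types: by regularity they determine the products on
  -- the whole window.
  let code {d : ℕ} (M : Net Sg L H D q (EuclideanSpace ℝ (Fin d))) : κ :=
    (Sum.elim (fun z => M.val z.1 z.2.1 z.2.2) (fun z => M.b z.1 z.2), M.act)
  have hS : ({g : ((Slot L H D × Box × Box) ⊕ (Fin L × Fin D)) → ℝ |
      ∀ i, g i ∈ {x : ℝ | Dyadic P x ∧ |x| ≤ a}} ×ˢ
      (Set.univ : Set (Fin L → Fin D → Activation))).Finite :=
    (Set.Finite.pi' fun _ => finite_dyadic_abs_le P a).prod Set.finite_univ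
  -- Beyond `Δ` the box lies inside the window, where precision and bounds are available.
  have hI' : {n | n ∈ I ∧ Δ < n}.Infinite := by
    refine (hI.sdiff (Set.finite_Iic Δ)).mono ?_
    rintro n ⟨h1, h2⟩
    exact ⟨h1, not_le.1 h2⟩
  obtain ⟨c, hc⟩ := exists_infinite_of_finite hS hI' (fun n c => ∃ (d : ℕ)
    (M : Net Sg L H D q (EuclideanSpace ℝ (Fin d))), M.Represents ε (F n) n Δ P a ∧ code M = c) (by
      rintro n ⟨hn, hΔ⟩
      obtain ⟨d, M, hM⟩ := h n hn
      refine ⟨code M, ⟨?_, trivial⟩, d, M, hM, rfl⟩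
      rintro (⟨s, v, w⟩ | ⟨l, s⟩)
      · have hv := v.2.inRange (N := n) (by exact_mod_cast hΔ)
        have hw := w.2.inRange (N := n) (by exact_mod_cast hΔ)
        exact ⟨hM.regular.dyadic _ _ _ hv hw, hM.bound _ _ _ hv hw⟩
      · exact hM.bias l s)
  have hch : ∀ n, ∃ (d : ℕ) (M : Net Sg L H D q (EuclideanSpace ℝ (Fin d))),
      n ∈ {n | n ∈ {n | n ∈ I ∧ Δ < n} ∧ ∃ (d : ℕ)
      (M : Net Sg L H D q (EuclideanSpace ℝ (Fin d))), M.Represents ε (F n) n Δ P a ∧ code M = c} →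
      M.Represents ε (F n) n Δ P a ∧ code M = c := by
    intro n
    by_cases hn : ∃ (d : ℕ)
      (M : Net Sg L H D q (EuclideanSpace ℝ (Fin d))), M.Represents ε (F n) n Δ P a ∧ code M = c
    · obtain ⟨d, M, hM⟩ := hn
      exact ⟨d, M, fun _ => hM⟩
    · obtain ⟨m, -, d, M, -⟩ := hc.nonempty
      exact ⟨d, M, fun h => (hn h.2).elim⟩
  choose d M hM using hch
  refine ⟨_, fun n hn => hn.1.1, hc, fun l => WithLp.toLp 2 fun s => c.1 (.inr (l, s)), c.2, d, M,
    fun n hn => ⟨(hM n hn).1, fun l s => ?_, fun l s => ?_⟩, fun n hn m hm => ?_⟩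
  · exact congrFun (congrArg Prod.fst (hM n hn).2) (.inr (l, s))
  · exact congrFun (congrFun (congrArg Prod.snd (hM n hn).2) l) s
  · refine (hM n hn).1.regular.eq_of_box (hM m hm).1.regular fun s v w hv hw => ?_
    exact congrFun (congrArg Prod.fst ((hM n hn).2.trans (hM m hm).2.symm))
      (.inl (s, ⟨v, hv⟩, ⟨w, hw⟩))

/-! ## The limit -/

theorem Src.exists_inRange {Sg : Type*} {L D : ℕ} (v : Src Sg L D) : ∃ k : ℕ, v.InRange k := by
  rcases v with t | (_ | σ | k) | ⟨l, s⟩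
  · exact ⟨t + 1, by simp only [Src.InRange]; exact_mod_cast t.lt_succ_self⟩
  · exact ⟨0, trivial⟩
  · exact ⟨0, trivial⟩
  · exact ⟨k + 1, by simp only [Src.InRange, Token.InVocab]; exact_mod_cast k.lt_succ_self⟩
  · exact ⟨0, trivial⟩

theorem Src.exists_mem_inRange {Sg : Type*} {L D : ℕ} {J : Set ℕ} (hJ : J.Infinite)
    (v w : Src Sg L D) : ∃ n ∈ J, v.InRange n ∧ w.InRange n := by
  obtain ⟨k, hk⟩ := v.exists_inRange
  obtain ⟨m, hm⟩ := w.exists_inRange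
  obtain ⟨n, hn, hlt⟩ := hJ.exists_gt (max k m)
  exact ⟨n, hn, hk.mono (by exact_mod_cast (le_max_left _ _).trans hlt.le),
    hm.mono (by exact_mod_cast (le_max_right _ _).trans hlt.le)⟩

/-- An input has finitely many objects, so length and object indices are small compared with all
large `n`. Thus fitting at all large widths determines every value of `f`. -/
theorem Input.exists_isTraining {Sg : Type*} (x : Input Sg) (ω : Token Sg) :
    ∃ n₀ : ℕ, ∀ n ≥ n₀, IsTraining n x ∧ ω.InVocab n := by
  have hfin : {k | x.HasObj k}.Finite := by
    have := (List.finite_toSet x).preimage (f := Sum.inr) Sum.inr_injective.injOn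
    exact this
  obtain ⟨K, hK⟩ := hfin.bddAbove
  have hK' : ∀ k, x.HasObj k → k ≤ K := fun k hk => hK hk
  obtain ⟨m, hm⟩ := Src.exists_inRange (.tok ω : Src Sg 0 0)
  refine ⟨2 * x.len + 2 * K + m, fun n hn => ⟨⟨by omega, fun k hk => ?_, fun k k' hk hk' => ?_⟩, ?_⟩⟩
  · have := hK' k hk
    have h1 : x.len = List.length x + 1 := rfl
    omega
  · have := hK' k hk
    omega
  · exact Src.InRange.mono (v := (.tok ω : Src Sg 0 0)) (by exact_mod_cast by omega) hm

/-- Infinitely many local transformers of bounded complexity that match `f` on the training inputs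
have a symbolic limit that expresses `f`, and one of them matches `f` on all inputs. -/
theorem expressible_of_infinite {Sg : Type*} [Fintype Sg] {ε C : ℝ} {f : LogitMap Sg} {Δ : ℕ}
    {F : ℕ → FiniteTransformer Sg} {I : Set ℕ} (hI : I.Infinite)
    (hfit : ∀ n ∈ I, F n ∈ fitting ε f n) (hC : ∀ n ∈ I, regularizer n (F n) ≤ C)
    (hΔ : ∀ n ∈ I, (F n).T.Local Δ) :
    ExpressibleBySymbolicLimit ε f ∧ ∃ n ∈ I, ∀ x, (F n).T.MatchesOn ε f x := by
  obtain ⟨B, P, n₀, a, hrep⟩ := BoundedBy.exists_represents (Sg := Sg) (C := C) ε Δ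
  have hI₀ : {n | n ∈ I ∧ n₀ < n}.Infinite := by
    refine (hI.sdiff (Set.finite_Iic n₀)).mono ?_
    rintro n ⟨h1, h2⟩
    exact ⟨h1, not_le.1 h2⟩
  have hS : (Set.Iic B ×ˢ Set.Iic B ×ˢ Set.Iic B ×ˢ Set.Iic B).Finite :=
    (Set.finite_Iic B).prod ((Set.finite_Iic B).prod ((Set.finite_Iic B).prod (Set.finite_Iic B)))
  obtain ⟨⟨L, H, D, q⟩, hI₁⟩ := exists_infinite_of_finite hS hI₀ (fun n z => ∃ (d : ℕ)
    (M : Net Sg z.1 z.2.1 z.2.2.1 z.2.2.2 (EuclideanSpace ℝ (Fin d))),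
      M.Represents ε (F n) n Δ P a) (by
    rintro n ⟨hn, hlt⟩
    obtain ⟨L, hL, H, hH, D, hD, q, hq, d, M, hM⟩ := hrep (F n) n hlt.le (hfit n hn).1
      (boundedBy_of_regularizer_le (hC n hn)) (hΔ n hn)
    exact ⟨(L, H, D, q), ⟨hL, hH, hD, hq⟩, d, M, hM⟩)
  obtain ⟨J, hJI, hJ, b, act, d, M, hM, hagree⟩ := Net.exists_infinite_agree hI₁ fun n hn => hn.2
  have hJI' : ∀ n ∈ J, n ∈ I := fun n hn => (hJI hn).1.1
  have htrain : ∀ x i ω, ∃ n₁ : ℕ, ∀ n ∈ J, n₁ ≤ n → IsTraining n x ∧ ω.InVocab (n : ℕ∞) ∧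
      ((M n).toTransformer n).eval ε x 0 0 i ω = f x i ω := by
    intro x i ω
    obtain ⟨n₁, h1⟩ := x.exists_isTraining ω
    refine ⟨n₁, fun n hn hle => ⟨(h1 n hle).1, (h1 n hle).2, ?_⟩⟩
    have hx := (h1 n hle).1
    have hF := hfit n (hJI' n hn)
    have h0 : ω.shift 0 = ω := by cases ω <;> rfl
    rw [(hM n hn).1.eval_eq]
    have := hF.2 x hx 0 0 (by rw [hF.1.1]; have := hx.1; exact_mod_cast by omega)
      (fun k hk => by rw [hF.1.1]; exact_mod_cast hx.2.1 k hk) i ω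
      (by rw [hF.1.1, h0]; exact (h1 n hle).2)
    rwa [h0] at this
  refine ⟨?_, ?_⟩
  · choose N hNJ hNv hNw using Src.exists_mem_inRange (Sg := Sg) (L := L) (D := D) hJ
    -- The choice of the window does not matter, as the nets in `J` agree on common windows. Each
    -- property of `β` at infinite width is thus read off from one net.
    let β : Products Sg L H D := fun c v w => (M (N v w)).val c v w
    have hβ : ∀ n ∈ J, ∀ c v w, v.InRange n → w.InRange n → (M n).val c v w = β c v w :=
      fun n hn c v w hv hw => hagree n hn _ (hNJ v w) c v w hv hw (hNv v w) (hNw v w)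
    have hreg : β.Regular ⊤ Δ P := by
      refine ⟨fun c v w dp dc _ _ => ?_, fun c v w _ _ => ?_, fun c v w _ _ => ?_,
        fun S k w _ _ => ?_, fun c v w => ?_⟩
      · obtain ⟨n, hn, hv, hw⟩ := Src.exists_mem_inRange hJ (v.shift dp dc) (w.shift dp dc)
        rw [← hβ n hn c _ _ hv hw, ← hβ n hn c _ _ hv.of_shift hw.of_shift]
        exact (hM n hn).1.regular.shift c v w dp dc hv hw
      · exact (hM _ (hNJ v w)).1.regular.far c v w (hNv v w) (hNw v w)
      · exact (hM _ (hNJ v w)).1.regular.dyadic c v w (hNv v w) (hNw v w)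
      · exact (hM _ (hNJ (.tok (.obj k)) w)).1.regular.unembed_obj S k w (hNv (.tok (.obj k)) w)
          (hNw _ w)
      · exact (hM _ (hNJ v w)).1.regular.eq_zero c v w
    obtain ⟨m, hm⟩ := hJ.nonempty
    refine expressible_of_regular ε f hreg q b act
      (fun l s => (hM m hm).2.1 l s ▸ ((hM m hm).1.bias l s).1) fun x i ω => ?_
    obtain ⟨n₁, h1⟩ := htrain x i ω
    obtain ⟨n, hn, hlt⟩ := hJ.exists_gt n₁
    obtain ⟨hx, hω, hev⟩ := h1 n hn hlt.le
    refine ⟨n, d n, M n, (hM n hn).2.1, (hM n hn).2.2, fun j => ?_, fun k hk => ?_, hω, hβ n hn, hev⟩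
    · have := hx.1
      exact_mod_cast (by omega : (j : ℕ) < n)
    · exact_mod_cast hx.2.1 k hk
  -- Any `n` in `J` will do. For given `x` and offsets, some larger `m` in `J` has `x` as a training
  -- input; agreement of the two nets in the smaller window and translation invariance identify the
  -- output at `n` with that at `m` at zero offsets, which is `f`.
  · obtain ⟨n, hn⟩ := hJ.nonempty
    refine ⟨n, hJI' n hn, fun x op oc hlen hobj i ω hω => ?_⟩
    have hFN := (hfit n (hJI' n hn)).1.1
    rw [hFN] at hlen hobj hω
    obtain ⟨n₁, h1⟩ := htrain x i ω
    obtain ⟨m, hm, hlt⟩ := hJ.exists_gt (max n n₁)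
    obtain ⟨hx, -, hev⟩ := h1 m hm ((le_max_right _ _).trans hlt.le)
    have hnm : (n : ℕ∞) ≤ m := by exact_mod_cast (le_max_left n n₁).trans hlt.le
    rw [← hev, ← (hM n hn).1.eval_eq]
    have h0 : ω.shift 0 = ω := by cases ω <;> rfl
    have key := Net.eval_eq ε (N := n) (N' := m) (M n) (M m) op oc 0 0
      (fun v => (v.shift op oc).InRange n) ?_ (fun _ _ => trivial)
      (fun l s => ((hM n hn).2.1 l s).trans ((hM m hm).2.1 l s).symm)
      (fun l s => ((hM n hn).2.2 l s).trans ((hM m hm).2.2 l s).symm) x (fun i => ?_)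
      (fun i => Input.token_inRange hobj i) i ω hω
    · rwa [h0] at key
    · intro c v w hv hw
      rw [(hM n hn).1.regular.shift c v w op oc hv hw, Src.shift_zero, Src.shift_zero]
      exact hagree n hn m hm c v w hv.of_shift hw.of_shift (hv.of_shift.mono hnm)
        (hw.of_shift.mono hnm)
    · refine lt_of_lt_of_le ?_ hlen
      have := i.2
      exact_mod_cast (by omega : (i : ℕ) + op < x.len + op)

/-! ## Runs of the inference procedure -/

section Runs

variable {Sg : Type*} [Fintype Sg] {ε C : ℝ} {f : LogitMap Sg}

/-- Runs exist when some transformer matches the training inputs at every context width. -/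
theorem exists_isRun (h : ∀ n : ℕ, 1 ≤ n → (fitting ε f n).Nonempty) : ∃ F, IsRun ε f F := by
  have key : ∀ n : ℕ, ∃ G : FiniteTransformer Sg, 1 ≤ n → G ∈ fitting ε f n ∧
      regularizer n G ≤ 1 / n + sInf (regularizer n '' fitting ε f n) := by
    intro n
    by_cases hn : 1 ≤ n
    · have hpos : (0 : ℝ) < 1 / n := by
        have : (0 : ℝ) < n := by exact_mod_cast hn
        positivity
      obtain ⟨_, ⟨G, hG, rfl⟩, hlt⟩ := exists_lt_of_csInf_lt ((h n hn).image (regularizer n))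
        (lt_add_of_pos_left _ hpos)
      exact ⟨G, fun _ => ⟨hG, hlt.le⟩⟩
    · exact ⟨(h 1 le_rfl).some, fun h => (hn h).elim⟩
  choose F hF using key
  exact ⟨F, hF⟩

theorem IsRun.regularizer_le {F : ℕ → FiniteTransformer Sg} (hF : IsRun ε f F)
    (hC : ∀ n : ℕ, 1 ≤ n → ∃ G ∈ fitting ε f n, regularizer n G ≤ C) (n : ℕ) (hn : 1 ≤ n) :
    regularizer n (F n) ≤ 1 + C := by
  obtain ⟨G, hG, hle⟩ := hC n hn
  refine (hF n hn).2.trans (add_le_add ?_ ?_)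
  · have : (1 : ℝ) ≤ n := by exact_mod_cast hn
    rw [div_le_one (by linarith)]
    exact this
  · have hbdd : BddBelow (regularizer n '' fitting ε f n) := by
      refine ⟨0, ?_⟩
      rintro _ ⟨G, -, rfl⟩
      exact regularizer_nonneg n G
    exact (csInf_le hbdd ⟨G, hG, rfl⟩).trans hle

theorem IsRun.lengthGeneralizes {F : ℕ → FiniteTransformer Sg} (hF : IsRun ε f F)
    (hC : ∀ n : ℕ, 1 ≤ n → regularizer n (F n) ≤ C) : LengthGeneralizes ε f F := by
  refine ⟨⟨C, hC⟩, ?_⟩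
  obtain ⟨Δ, hΔ⟩ := hF.exists_local hC
  by_contra! hbad
  -- If the run failed at infinitely many widths, the limit argument applied to just these widths
  -- would produce one among them without failure.
  have hI : {n : ℕ | Δ + 1 ≤ n ∧ ∃ x : Input Sg, ¬ (F n).T.MatchesOn ε f x}.Infinite := by
    refine Set.infinite_of_forall_exists_gt fun k => ?_
    obtain ⟨n, hn, x, -, hx⟩ := hbad (max k Δ)
    exact ⟨n, ⟨(le_max_right k Δ).trans_lt hn, x, hx⟩, (le_max_left k Δ).trans_lt hn⟩
  obtain ⟨-, n, ⟨-, x, hx⟩, hall⟩ := expressible_of_infinite (ε := ε) (f := f) (F := F) hI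
    (fun n hn => (hF n ((Nat.le_add_left 1 Δ).trans hn.1)).1)
    (fun n hn => hC n ((Nat.le_add_left 1 Δ).trans hn.1))
    (fun n hn => hΔ n ((Nat.le_succ Δ).trans hn.1))
  exact hx (hall x)

theorem IsRun.expressible {F : ℕ → FiniteTransformer Sg} (hF : IsRun ε f F)
    (hC : ∀ n : ℕ, 1 ≤ n → regularizer n (F n) ≤ C) : ExpressibleBySymbolicLimit ε f := by
  obtain ⟨Δ, hΔ⟩ := hF.exists_local hC
  refine (expressible_of_infinite (I := Set.Ici (Δ + 1)) (Set.Ici_infinite _)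
    (fun n hn => (hF n ((Nat.le_add_left 1 Δ).trans hn)).1)
    (fun n hn => hC n ((Nat.le_add_left 1 Δ).trans hn))
    (fun n hn => hΔ n ((Nat.le_succ Δ).trans hn))).1

end Runs

end LengthGen

theorem theoremC1 {Sg : Type*} [Fintype Sg] (ε : ℝ) (hε : 0 < ε) (f : LengthGen.LogitMap Sg) :
    List.TFAE [
      LengthGen.ExpressibleBySymbolicLimit ε f,
      (∃ F, LengthGen.IsRun ε f F) ∧
        ∀ F, LengthGen.IsRun ε f F → LengthGen.LengthGeneralizes ε f F,
      ∃ F, LengthGen.IsRun ε f F ∧ LengthGen.LengthGeneralizes ε f F] := by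
  tfae_have 1 → 2 := by
    intro hf
    obtain ⟨C, hC⟩ := LengthGen.exists_fitting_le_of_expressible hf
    refine ⟨LengthGen.exists_isRun fun n hn => ?_, fun F hF => ?_⟩
    · obtain ⟨F, hF, -⟩ := hC n hn
      exact ⟨F, hF⟩
    · exact hF.lengthGeneralizes (hF.regularizer_le hC)
  tfae_have 2 → 3 := fun ⟨⟨F, hF⟩, h⟩ => ⟨F, hF, h F hF⟩
  tfae_have 3 → 1 := fun ⟨_, hF, ⟨_, hC⟩, _⟩ => hF.expressible hC
  tfae_finish
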